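/- **Model.** Let $K_n,M_n$ be sequences of non-negative integers and $p_n,q_n\in[0,1]$ with $K_n\to\infty$, $K_n=o(n)$, $0<q_n\le p_n$, $p_n/q_n=\Theta(1)$ and $\limsup_n p_n<1$. Let $V,U$ be probability distributions on a measurable space, not depending on $n$, that are mutually absolutely continuous and whose log-likelihood ratio $L_S=\log\frac{dV}{dU}$ is bounded. The true label vector $x^*$ is uniformly distributed over the vectors in $\{0,1\}^n$ with exactly $K_n$ ones. Given $x^*$, one observes independent variables $G_{ij}$ ($i<j$) and $y_{i,m}$ ($i\le n$, $m\le M_n$), where $G_{ij}$ has law $P=\mathrm{Bernoulli}(p_n)$ if $x^*_i=x^*_j=1$ and law $Q=\mathrm{Bernoulli}(q_n)$ otherwise, and $y_{i,m}$ has law $V$ if $x^*_i=1$ and $U$ if $x^*_i=0$. Exact recovery is achieved if there are (measurable) estimators $\hat x=\hat x(G,Y)$ with $\mathbb P(\hat x=x^*)\to1$ as $n\to\infty$. **Exponent.** Let $L_G=\log\frac{dP}{dQ}$ and, for $\theta,m_1,m_2\in\mathbb R$, $$E_{QU}(\theta,m_1,m_2)=\sup_{t\in[0,1]}\Big(t\theta-m_1\log\mathbb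 E_Q[e^{tL_G}]-m_2\log\mathbb E_U[e^{tL_S}]\Big).$$ **Theorem.** Assume that $$(K_n-1)D(P\|Q)+M_nD(V\|U)\to\infty\quad\text{and}\quad\liminf_{n\to\infty}\frac{(K_n-1)D(P\|Q)+2M_nD(V\|U)}{\log(n/K_n)}>2,$$ where $D(\cdot\|\cdot)$ is the Kullback–Leibler divergence. Leaving out the critical case $$\liminf_{n\to\infty}\frac{E_{QU}(\log(n/K_n),K_n,M_n)}{\log n}=1,$$ exact recovery is achieved if and only if $$\liminf_{n\to\infty}\frac{E_{QU}(\log(n/K_n),K_n,M_n)}{\log n}>1.$$ -/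

import Mathlib

open Filter Topology MeasureTheory ProbabilityTheory InformationTheory
open scoped ENNReal unitInterval

noncomputable section

namespace SingleCommunity

/-- The unordered pairs of distinct nodes of `{0, …, n-1}`, written `(i, j)` with `i < j`. -/
abbrev Pairs (n : ℕ) : Type := {e : Fin n × Fin n // e.1 < e.2}

/-- A labelling of the nodes: `true` inside the community and `false` outside of it. -/
abbrev Labels (n : ℕ) : Type := Fin n → Bool

/-- The labellings whose community has exactly `K` nodes. -/
def communityLabels (n K : ℕ) : Finset (Labels n) :=
  Finset.univ.filter fun x => (Finset.univ.filter fun i => x i = true).card = K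

/-- The law of an edge indicator that is present with probability `p`. -/
abbrev edgeLaw (p : I) : Measure Bool := bernoulliMeasure true false p

/-- An observation: the graph `G` (an edge indicator for each pair) and the side information
`Y` (`M` features for each node). -/
abbrev Obs (𝒴 : Type*) (n M : ℕ) : Type _ := (Pairs n → Bool) × (Fin n → Fin M → 𝒴)

variable {𝒴 : Type*} [MeasurableSpace 𝒴]

/-- The conditional law of `(G, Y)` given the labels `x`: all entries are independent, a pair has
an edge with probability `p` if both nodes are in the community and `q` otherwise, and the features
of a node have law `V` inside the community and `U` outside of it. -/
def obsLaw (n M : ℕ) (p q : I) (V U : Measure 𝒴) (x : Labels n) : Measure (Obs 𝒴 n M) :=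
  (Measure.pi fun e : Pairs n =>
      edgeLaw (if x e.1.1 = true ∧ x e.1.2 = true then p else q)).prod
    (Measure.pi fun i : Fin n => Measure.pi fun _ : Fin M => if x i = true then V else U)

/-- The probability that `est (G, Y)` equals the true labels, when these are uniformly distributed
over the labellings with `K` nodes in the community. -/
def recoveryProb (n K M : ℕ) (p q : I) (V U : Measure 𝒴) (est : Obs 𝒴 n M → Labels n) : ℝ≥0∞ :=
  (∑ x ∈ communityLabels n K, obsLaw n M p q V U x {ω | est ω = x}) /
    ((communityLabels n K).card : ℝ≥0∞)

/-- Exact recovery is achieved: some sequence of (measurable) estimators recovers all the labels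
with probability tending to one. -/
def ExactRecovery (K M : ℕ → ℕ) (p q : ℕ → I) (V U : Measure 𝒴) : Prop :=
  ∃ est : ∀ n : ℕ, Obs 𝒴 n (M n) → Labels n,
    (∀ n, Measurable (est n)) ∧
    Tendsto (fun n => recoveryProb n (K n) (M n) (p n) (q n) V U (est n)) atTop (𝓝 1)

/-- The log-likelihood ratio of a feature is well defined and bounded. -/
def BoundedLLR (V U : Measure 𝒴) : Prop :=
  V ≪ U ∧ U ≪ V ∧ ∃ B : ℝ, ∀ᵐ y ∂U, |llr V U y| ≤ B

/-- `D(μ‖ν)` as a real number. -/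
def klReal {α : Type*} [MeasurableSpace α] (μ ν : Measure α) : ℝ := (klDiv μ ν).toReal

/-- `ψ_QU(t, m₁, m₂) = m₁ log E_Q[exp (t L_G)] + m₂ log E_U[exp (t L_S)]`. -/
def psiQU (p q : I) (V U : Measure 𝒴) (t m₁ m₂ : ℝ) : ℝ :=
  m₁ * cgf (llr (edgeLaw p) (edgeLaw q)) (edgeLaw q) t + m₂ * cgf (llr V U) U t

/-- `E_QU(θ, m₁, m₂) = sup_{t ∈ [0,1]} (t θ - ψ_QU(t, m₁, m₂))`. -/
def exponentQU (p q : I) (V U : Measure 𝒴) (θ m₁ m₂ : ℝ) : ℝ :=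
  ⨆ t : Set.Icc (0 : ℝ) 1, ((t : ℝ) * θ - psiQU p q V U t m₁ m₂)

end SingleCommunity

end

noncomputable section

namespace SingleCommunity

set_option linter.unusedSectionVars false

/-! ### Elementary bounds on the exponential -/

/-! Write `θ = log (n / K)`, `L = log n`, `D` for the edge divergence, `W = K D + M D(V‖U)` for the
divergence of all observations touching one node, and `w = (K - 1) D / 2 + M D(V‖U)`. Relative to
the law without community, a community `C` has likelihood `exp (score C)` (`obsLaw_eq_withDensity`),
so the question is whether some other set of `K` nodes scores higher than the true one. To each node
belongs the log-likelihood ratio of its features and of its pairs with `C`. By Chernoff, a given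
member falls below `θ` with probability about `exp (θ - E_QU)`, and a given outsider exceeds `θ`
with probability about `exp (-E_QU)`. Since `log K + θ = L`, both expected counts are about `exp (L
- E_QU)`, whence the threshold `E_QU = log n`.

Above the threshold (`measureReal_exists_score_le`), competitors are sorted by the number `ℓ` of
exchanged nodes. For `ℓ ≤ εK` the score gap is a sum of node statistics, all separated from `θ` by a
margin, up to a correction on `O(ℓ²)` pairs that a Chernoff bound with a large parameter absorbs.
For `ℓ > εK` there are at most `exp (ℓ (θ + O(1)))` competitors, while the removed block has mean at
least `ℓ w`; the second weak-recovery condition keeps `θ` below `(1 - δ) w`, and `w → ∞` absorbs the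
constants. The bounds are geometric in `ℓ`.

Below the threshold (`measureReal_compl_exists_score_le`), tilting shows that the Chernoff bounds
are sharp up to a factor `exp (-O(ηW))`. This loss is harmless because `E_QU ≥ c W`
(`mul_divQU_le_exponentQU`), so `W = O(L)`. The statistics of the members share pairs; independence
is restored by examining only a small subset `T` of the community against the rest of it. Some
exchange of two nodes then raises the score by `ηW`, and `recoveryProb_le` turns this into the
failure of every estimator.

Boundedness of the log-likelihood ratios makes this uniform in `n`: the relevant moments and
cumulants are at most a constant, depending on the bound `B` and the range of the parameter, times
the divergence. -/

lemma exp_le_add_sq {x b : ℝ} (hx : |x| ≤ b) :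
    Real.exp x ≤ 1 + x + x ^ 2 * Real.exp b := by
  have h := Complex.norm_exp_sub_sum_le_norm_mul_exp (x : ℂ) 2
  have h2 : |Real.exp x - (1 + x)| ≤ |x| ^ 2 * Real.exp |x| := by
    have : Complex.exp x - ∑ m ∈ Finset.range 2, (x : ℂ) ^ m / m.factorial
        = ((Real.exp x - (1 + x) : ℝ) : ℂ) := by
      simp [Finset.sum_range_succ]
    rw [this, Complex.norm_real, Complex.norm_real] at h
    exact h
  have h3 := (le_abs_self _).trans h2
  rw [sq_abs] at h3
  have h4 : x ^ 2 * Real.exp |x| ≤ x ^ 2 * Real.exp b := by gcongr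
  linarith

/-- With `u = exp (x/2) - 1 ≥ x/2`, completing the square gives `exp x - 1 - x ≥ u²`, and `|x|` is
at most a constant times `|u|` on a bounded range. -/
lemma sq_le_exp_sub {x b : ℝ} (hx : |x| ≤ b) :
    x ^ 2 ≤ 4 * Real.exp b * (Real.exp x - 1 - x) := by
  have hw : Real.exp x = Real.exp (x / 2) ^ 2 := by
    rw [← Real.exp_nat_mul]; congr 1; push_cast; ring
  have h1 : x / 2 + 1 ≤ Real.exp (x / 2) := Real.add_one_le_exp _
  have h2 : (Real.exp (x / 2) - 1) ^ 2 ≤ Real.exp x - 1 - x := by nlinarith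
  have h3 : x ^ 2 ≤ 4 * Real.exp b * (Real.exp (x / 2) - 1) ^ 2 := by
    have h4 : |x| ≤ 2 * Real.exp (b / 2) * |Real.exp (x / 2) - 1| := by
      have hb : 1 ≤ Real.exp (b / 2) := Real.one_le_exp (by linarith [abs_nonneg x])
      rcases le_total 0 x with h0 | h0
      · have : 0 ≤ Real.exp (x / 2) - 1 := by linarith
        rw [abs_of_nonneg h0, abs_of_nonneg this]
        nlinarith
      · have h5 : -(x / 2) + 1 ≤ Real.exp (-(x / 2)) := Real.add_one_le_exp _
        have h6 : Real.exp (x / 2) * Real.exp (-(x / 2)) = 1 := by rw [← Real.exp_add]; simp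
        have h7 : Real.exp (-(x / 2)) ≤ Real.exp (b / 2) := by
          rw [Real.exp_le_exp]; rw [abs_of_nonpos h0] at hx; linarith
        have h8 : Real.exp (x / 2) ≤ 1 := Real.exp_le_one_iff.2 (by linarith)
        rw [abs_of_nonpos h0, abs_of_nonpos (by linarith)]
        have h9 : Real.exp (-(x / 2)) * (1 - Real.exp (x / 2)) = Real.exp (-(x / 2)) - 1 := by
          linarith
        nlinarith [mul_le_mul_of_nonneg_right h7 (by linarith : 0 ≤ 1 - Real.exp (x / 2))]
    calc x ^ 2 = |x| ^ 2 := (sq_abs x).symm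
      _ ≤ (2 * Real.exp (b / 2) * |Real.exp (x / 2) - 1|) ^ 2 := by gcongr
      _ = 4 * Real.exp b * (Real.exp (x / 2) - 1) ^ 2 := by
        rw [mul_pow, mul_pow, sq_abs, ← Real.exp_nat_mul]; push_cast; ring_nf
  have : 0 < Real.exp b := Real.exp_pos b
  nlinarith

/-! ### Pairs of distributions with a bounded log-likelihood ratio -/

/-- `μ` and `ν` are mutually absolutely continuous and their log-likelihood ratio is at most `B`
in absolute value. -/
structure LLRBound {α : Type*} [MeasurableSpace α] (μ ν : Measure α) (B : ℝ) : Prop where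
  ac : μ ≪ ν
  ac' : ν ≪ μ
  bound : ∀ᵐ y ∂ν, |llr μ ν y| ≤ B

namespace LLRBound

variable {α : Type*} [MeasurableSpace α] {μ ν : Measure α} {B : ℝ}

lemma bound' (h : LLRBound μ ν B) : ∀ᵐ y ∂μ, |llr μ ν y| ≤ B := h.ac.ae_le h.bound

variable [IsProbabilityMeasure μ] [IsProbabilityMeasure ν]

lemma nonneg (h : LLRBound μ ν B) : 0 ≤ B := by
  obtain ⟨y, hy⟩ := h.bound.exists
  exact (abs_nonneg _).trans hy

lemma integral_one_add_add {ρ : Measure α} [IsProbabilityMeasure ρ] {f g : α → ℝ}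
    (hf : Integrable f ρ) (hg : Integrable g ρ) :
    ∫ y, (1 + f y + g y) ∂ρ = 1 + ∫ y, f y ∂ρ + ∫ y, g y ∂ρ := by
  have h1 : Integrable (fun y => 1 + f y) ρ := (integrable_const 1).add hf
  rw [integral_add h1 hg, integral_add (integrable_const 1) hf]
  simp

lemma integrable_comp (h : LLRBound μ ν B) {g : ℝ → ℝ} (hg : Continuous g) :
    Integrable (fun y => g (llr μ ν y)) ν := by
  obtain ⟨C, hC⟩ := (isCompact_Icc (a := -B) (b := B)).exists_bound_of_continuousOn hg.continuousOn
  refine Integrable.of_bound ((hg.measurable.comp (measurable_llr μ ν)).aestronglyMeasurable) C ?_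
  filter_upwards [h.bound] with y hy using hC _ (abs_le.1 hy)

lemma integrable_comp' (h : LLRBound μ ν B) {g : ℝ → ℝ} (hg : Continuous g) :
    Integrable (fun y => g (llr μ ν y)) μ := by
  obtain ⟨C, hC⟩ := (isCompact_Icc (a := -B) (b := B)).exists_bound_of_continuousOn hg.continuousOn
  refine Integrable.of_bound ((hg.measurable.comp (measurable_llr μ ν)).aestronglyMeasurable) C ?_
  filter_upwards [h.bound'] with y hy using hC _ (abs_le.1 hy)

lemma integral_eq (h : LLRBound μ ν B) (g : α → ℝ) :
    ∫ y, g y ∂μ = ∫ y, Real.exp (llr μ ν y) * g y ∂ν := by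
  rw [← integral_rnDeriv_smul h.ac]
  refine integral_congr_ae ?_
  filter_upwards [exp_llr_of_ac' μ ν h.ac'] with y hy
  rw [hy, smul_eq_mul]

lemma integrable_exp (h : LLRBound μ ν B) (t : ℝ) :
    Integrable (fun y => Real.exp (t * llr μ ν y)) ν :=
  h.integrable_comp (g := fun x => Real.exp (t * x)) (by fun_prop)

lemma integrable_exp' (h : LLRBound μ ν B) (t : ℝ) :
    Integrable (fun y => Real.exp (t * llr μ ν y)) μ :=
  h.integrable_comp' (g := fun x => Real.exp (t * x)) (by fun_prop)

lemma mem_interior (h : LLRBound μ ν B) (t : ℝ) :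
    t ∈ interior (integrableExpSet (llr μ ν) ν) := by
  rw [Set.eq_univ_of_forall (s := integrableExpSet (llr μ ν) ν) h.integrable_exp]; simp

/-- Changing measure from `μ` to `ν` multiplies by `exp (llr μ ν)`, which shifts the parameter by
one; a single cumulant generating function thus serves both laws. -/
lemma mgf_left (h : LLRBound μ ν B) (t : ℝ) :
    mgf (llr μ ν) μ t = mgf (llr μ ν) ν (t + 1) := by
  rw [mgf, mgf, h.integral_eq]
  congr 1 with y
  rw [← Real.exp_add]; ring_nf

lemma cgf_left (h : LLRBound μ ν B) : cgf (llr μ ν) μ = fun t => cgf (llr μ ν) ν (t + 1) := by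
  funext t
  rw [cgf, cgf, h.mgf_left]

lemma mgf_one (h : LLRBound μ ν B) : mgf (llr μ ν) ν 1 = 1 := by
  have := h.mgf_left 0
  rw [zero_add] at this
  rw [← this, mgf_zero]

lemma cgf_one (h : LLRBound μ ν B) : cgf (llr μ ν) ν 1 = 0 := by
  rw [cgf, h.mgf_one, Real.log_one]

lemma klReal_eq (h : LLRBound μ ν B) : klReal μ ν = ∫ y, llr μ ν y ∂μ :=
  toReal_klDiv_of_measure_eq h.ac (by simp)

lemma klReal_nonneg : 0 ≤ klReal μ ν := ENNReal.toReal_nonneg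

lemma klReal_eq' (h : LLRBound μ ν B) :
    klReal μ ν = ∫ y, Real.exp (llr μ ν y) * llr μ ν y ∂ν := by
  rw [h.klReal_eq, h.integral_eq]

lemma integral_exp_llr (h : LLRBound μ ν B) : ∫ y, Real.exp (llr μ ν y) ∂ν = 1 := by
  simpa using (h.integral_eq (fun _ => 1)).symm

/-- Since `exp llr` has mean one, the divergence is the `ν`-mean of `exp x * (exp (-x) - 1 + x)` at
`x = llr`, and this is comparable to `x²` for bounded `x`. -/
lemma sq_le_klReal (h : LLRBound μ ν B) :
    ∫ y, llr μ ν y ^ 2 ∂ν ≤ 4 * Real.exp (2 * B) * klReal μ ν := by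
  have i1 : Integrable (fun y => Real.exp (llr μ ν y) * llr μ ν y) ν :=
    h.integrable_comp (g := fun x => Real.exp x * x) (by fun_prop)
  have i2 : Integrable (fun y => Real.exp (llr μ ν y)) ν := h.integrable_comp Real.continuous_exp
  have hD : klReal μ ν = ∫ y, (Real.exp (llr μ ν y) * llr μ ν y + 1 - Real.exp (llr μ ν y)) ∂ν := by
    have := integral_one_add_add i1 i2.neg
    rw [← h.klReal_eq', integral_neg', h.integral_exp_llr] at this
    rw [show klReal μ ν = 1 + klReal μ ν + -1 by ring, ← this]
    refine integral_congr_ae (.of_forall fun y => ?_)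
    simp only [Pi.neg_apply]
    ring
  rw [hD, ← integral_const_mul]
  refine integral_mono_ae (h.integrable_comp (g := fun x => x ^ 2) (by fun_prop))
    (((i1.add (integrable_const 1)).sub i2).const_mul _) ?_
  filter_upwards [h.bound] with y hy
  set x := llr μ ν y
  have h1 := sq_le_exp_sub (x := -x) (b := B) (by rwa [abs_neg])
  have h2 : Real.exp x * Real.exp (-x) = 1 := by rw [← Real.exp_add]; simp
  have h3 : Real.exp (-B) ≤ Real.exp x := Real.exp_le_exp.2 (abs_le.1 hy).1
  have h4 : Real.exp B * Real.exp (-B) = 1 := by rw [← Real.exp_add]; simp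
  have h5 : 0 < Real.exp B := Real.exp_pos _
  have h6 : 1 ≤ Real.exp B * Real.exp x := by nlinarith
  have h7 : Real.exp (2 * B) = Real.exp B * Real.exp B := by rw [← Real.exp_add]; ring_nf
  have h8 : x ^ 2 ≤ 4 * Real.exp B * (Real.exp (-x) - 1 + x) := by nlinarith
  have h9 : 0 ≤ Real.exp (-x) - 1 + x := by linarith [Real.add_one_le_exp (-x)]
  calc x ^ 2 ≤ 4 * Real.exp B * (Real.exp (-x) - 1 + x) := h8
    _ ≤ 4 * Real.exp B * (Real.exp (-x) - 1 + x) * (Real.exp B * Real.exp x) :=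
      le_mul_of_one_le_right (by positivity) h6
    _ = 4 * Real.exp (2 * B) * (Real.exp x * x + 1 - Real.exp x) := by
      rw [h7]; linear_combination (4 * Real.exp B * Real.exp B) * h2

lemma integral_llr_nonpos (h : LLRBound μ ν B) : ∫ y, llr μ ν y ∂ν ≤ 0 := by
  have i1 : Integrable (fun y => Real.exp (llr μ ν y) - 1) ν :=
    h.integrable_comp (g := fun x => Real.exp x - 1) (by fun_prop)
  calc ∫ y, llr μ ν y ∂ν ≤ ∫ y, (Real.exp (llr μ ν y) - 1) ∂ν :=
        integral_mono (h.integrable_comp continuous_id) i1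
          fun y => by linarith [Real.add_one_le_exp (llr μ ν y)]
    _ = 0 := by
      rw [integral_sub (h.integrable_comp Real.continuous_exp) (integrable_const 1),
        h.integral_exp_llr]; simp

/-- Expanding the identity that `exp llr` has mean one to second order bounds the reverse divergence
by the second moment, hence by the forward divergence. -/
lemma neg_integral_llr_le (h : LLRBound μ ν B) :
    -∫ y, llr μ ν y ∂ν ≤ Real.exp B * ∫ y, llr μ ν y ^ 2 ∂ν := by
  have i0 : Integrable (fun y => llr μ ν y) ν := h.integrable_comp continuous_id
  have i2 : Integrable (fun y => llr μ ν y ^ 2) ν :=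
    h.integrable_comp (g := fun x => x ^ 2) (by fun_prop)
  have h1 : ∫ y, Real.exp (llr μ ν y) ∂ν
      ≤ ∫ y, (1 + llr μ ν y + llr μ ν y ^ 2 * Real.exp B) ∂ν := by
    refine integral_mono_ae (h.integrable_comp Real.continuous_exp)
      (((integrable_const 1).add i0).add (i2.mul_const _)) ?_
    filter_upwards [h.bound] with y hy using exp_le_add_sq hy
  rw [h.integral_exp_llr, integral_one_add_add i0 (i2.mul_const _), integral_mul_const] at h1
  linarith

/-- The constant of `cgf_le`. -/
def cgfConst (S B : ℝ) : ℝ :=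
  (S * Real.exp B + S ^ 2 * Real.exp (S * B)) * (4 * Real.exp (2 * B))

lemma cgfConst_nonneg {S : ℝ} (hS : 0 ≤ S) : 0 ≤ cgfConst S B := by
  unfold cgfConst; positivity

lemma cgf_le_sub_one (h : LLRBound μ ν B) (t : ℝ) :
    cgf (llr μ ν) ν t ≤ mgf (llr μ ν) ν t - 1 :=
  Real.log_le_sub_one_of_pos (mgf_pos (h.integrable_exp t))

/-- A bound linear in the divergence for parameters that may lie far outside `[0, 1]`; it controls
correction terms, for which only the order of magnitude matters. -/
lemma cgf_le (h : LLRBound μ ν B) {S t : ℝ} (ht : |t| ≤ S) :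
    cgf (llr μ ν) ν t ≤ cgfConst S B * klReal μ ν := by
  have hB := h.nonneg
  have hS : 0 ≤ S := (abs_nonneg t).trans ht
  have i0 : Integrable (fun y => llr μ ν y) ν := h.integrable_comp continuous_id
  have i2 : Integrable (fun y => llr μ ν y ^ 2) ν :=
    h.integrable_comp (g := fun x => x ^ 2) (by fun_prop)
  have h1 : mgf (llr μ ν) ν t
      ≤ ∫ y, (1 + t * llr μ ν y + S ^ 2 * Real.exp (S * B) * llr μ ν y ^ 2) ∂ν := by
    refine integral_mono_ae (h.integrable_exp t)
      (((integrable_const 1).add (i0.const_mul _)).add (i2.const_mul _)) ?_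
    filter_upwards [h.bound] with y hy
    have h2 : |t * llr μ ν y| ≤ S * B := by
      rw [abs_mul]; exact mul_le_mul ht hy (abs_nonneg _) hS
    refine (exp_le_add_sq h2).trans ?_
    have h3 : t ^ 2 ≤ S ^ 2 := by rw [← sq_abs t]; gcongr
    have : (t * llr μ ν y) ^ 2 * Real.exp (S * B)
        ≤ S ^ 2 * Real.exp (S * B) * llr μ ν y ^ 2 := by
      rw [mul_pow, mul_right_comm]; gcongr
    linarith
  rw [integral_one_add_add (i0.const_mul _) (i2.const_mul _), integral_const_mul,
    integral_const_mul] at h1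
  have h4 : t * ∫ y, llr μ ν y ∂ν ≤ S * (Real.exp B * ∫ y, llr μ ν y ^ 2 ∂ν) := by
    have a1 := h.integral_llr_nonpos
    have a2 := h.neg_integral_llr_le
    have a3 := abs_le.1 ht
    nlinarith
  have h5 := h.sq_le_klReal
  calc cgf (llr μ ν) ν t ≤ _ := h.cgf_le_sub_one t
    _ ≤ (S * Real.exp B + S ^ 2 * Real.exp (S * B)) * ∫ y, llr μ ν y ^ 2 ∂ν := by linarith
    _ ≤ (S * Real.exp B + S ^ 2 * Real.exp (S * B)) * (4 * Real.exp (2 * B) * klReal μ ν) := by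
      gcongr
    _ = _ := by rw [cgfConst]; ring

lemma cgf_left_le (h : LLRBound μ ν B) {S t : ℝ} (ht : |t| ≤ S) :
    cgf (llr μ ν) μ t ≤ cgfConst (S + 1) B * klReal μ ν := by
  rw [h.cgf_left]
  refine h.cgf_le ((abs_add_le _ _).trans ?_)
  simpa using ht

lemma integral_sq_left_le (h : LLRBound μ ν B) :
    ∫ y, llr μ ν y ^ 2 ∂μ ≤ 4 * Real.exp (3 * B) * klReal μ ν := by
  rw [h.integral_eq]
  have h1 : ∫ y, Real.exp (llr μ ν y) * llr μ ν y ^ 2 ∂ν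
      ≤ ∫ y, Real.exp B * llr μ ν y ^ 2 ∂ν := by
    refine integral_mono_ae (h.integrable_comp (g := fun x => Real.exp x * x ^ 2) (by fun_prop))
      (h.integrable_comp (g := fun x => Real.exp B * x ^ 2) (by fun_prop)) ?_
    filter_upwards [h.bound] with y hy
    have := (abs_le.1 hy).2
    gcongr
  rw [integral_const_mul] at h1
  have h2 := h.sq_le_klReal
  have h3 : Real.exp (3 * B) = Real.exp B * Real.exp (2 * B) := by rw [← Real.exp_add]; ring_nf
  calc _ ≤ _ := h1
    _ ≤ Real.exp B * (4 * Real.exp (2 * B) * klReal μ ν) := by gcongr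
    _ = _ := by rw [h3]; ring

/-- Quadratic upper bound for the cumulant generating function of the reversed log-likelihood
ratio. -/
lemma cgf_left_neg_le (h : LLRBound μ ν B) {t : ℝ} (h0 : 0 ≤ t) (h1 : t ≤ 1) :
    cgf (llr μ ν) μ (-t) ≤ (-t + 4 * Real.exp (4 * B) * t ^ 2) * klReal μ ν := by
  have hB := h.nonneg
  have i0 : Integrable (fun y => llr μ ν y) μ := h.integrable_comp' continuous_id
  have i2 : Integrable (fun y => llr μ ν y ^ 2) μ :=
    h.integrable_comp' (g := fun x => x ^ 2) (by fun_prop)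
  have e1 : mgf (llr μ ν) μ (-t)
      ≤ ∫ y, (1 + -t * llr μ ν y + t ^ 2 * Real.exp B * llr μ ν y ^ 2) ∂μ := by
    refine integral_mono_ae (h.integrable_exp' _)
      (((integrable_const 1).add (i0.const_mul _)).add (i2.const_mul _)) ?_
    filter_upwards [h.bound'] with y hy
    have h2 : |-t * llr μ ν y| ≤ B := by
      rw [abs_mul, abs_neg, abs_of_nonneg h0]
      exact (mul_le_of_le_one_left (abs_nonneg _) h1).trans hy
    refine (exp_le_add_sq h2).trans (le_of_eq ?_)
    ring
  rw [integral_one_add_add (i0.const_mul _) (i2.const_mul _), integral_const_mul,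
    integral_const_mul, ← h.klReal_eq] at e1
  have e2 := Real.log_le_sub_one_of_pos (mgf_pos (h.integrable_exp' (-t)))
  have e3 := h.integral_sq_left_le
  have e4 : Real.exp (4 * B) = Real.exp B * Real.exp (3 * B) := by rw [← Real.exp_add]; ring_nf
  have e5 : t ^ 2 * Real.exp B * ∫ y, llr μ ν y ^ 2 ∂μ
      ≤ t ^ 2 * Real.exp B * (4 * Real.exp (3 * B) * klReal μ ν) := by gcongr
  rw [cgf, e4]
  linarith

/-- Convexity gives `exp (t x) ≤ (1 - t) + t exp x`, and `exp llr` has mean one. Consequently fewer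
pairs can only increase `psiQU` on `[0, 1]`. -/
lemma cgf_nonpos (h : LLRBound μ ν B) {t : ℝ} (h0 : 0 ≤ t) (h1 : t ≤ 1) :
    cgf (llr μ ν) ν t ≤ 0 := by
  have i1 : Integrable (fun y => Real.exp (llr μ ν y)) ν := h.integrable_comp Real.continuous_exp
  have e1 : mgf (llr μ ν) ν t ≤ ∫ y, ((1 - t) + t * Real.exp (llr μ ν y)) ∂ν := by
    refine integral_mono (h.integrable_exp t) ((integrable_const _).add (i1.const_mul _))
      fun y => ?_
    have := convexOn_exp.2 (Set.mem_univ (0 : ℝ)) (Set.mem_univ (llr μ ν y))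
      (by linarith : 0 ≤ 1 - t) h0 (by ring)
    simpa using this
  rw [integral_add (integrable_const _) (i1.const_mul _), integral_const_mul,
    h.integral_exp_llr] at e1
  simp only [integral_const, probReal_univ, smul_eq_mul, mul_one] at e1
  have := h.cgf_le_sub_one t
  linarith

lemma neg_le_cgf (h : LLRBound μ ν B) {t : ℝ} (h0 : 0 ≤ t) (h1 : t ≤ 1) :
    -B ≤ cgf (llr μ ν) ν t := by
  have hB := h.nonneg
  rw [cgf, Real.le_log_iff_exp_le (mgf_pos (h.integrable_exp t))]
  have : ∫ _, Real.exp (-B) ∂ν ≤ mgf (llr μ ν) ν t := by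
    refine integral_mono_ae (integrable_const _) (h.integrable_exp t) ?_
    filter_upwards [h.bound] with y hy
    have := abs_le.1 hy
    simp only [Real.exp_le_exp]
    nlinarith
  simpa using this

lemma deriv_cgf_zero_nonpos (h : LLRBound μ ν B) : deriv (cgf (llr μ ν) ν) 0 ≤ 0 := by
  rw [deriv_cgf_zero (h.mem_interior 0)]
  simpa using h.integral_llr_nonpos

/-- Together with the nonpositive slope at `0`, this shows which means are attained by tilting with
a parameter in `[0, 1]`: all those between zero and the divergence. -/
lemma deriv_cgf_one (h : LLRBound μ ν B) : deriv (cgf (llr μ ν) ν) 1 = klReal μ ν := by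
  rw [deriv_cgf (h.mem_interior 1), h.mgf_one, div_one, h.klReal_eq']
  simp [mul_comm]

lemma contDiff_cgf (h : LLRBound μ ν B) : ContDiff ℝ 2 (cgf (llr μ ν) ν) :=
  contDiff_iff_contDiffAt.2 fun t => (analyticAt_cgf (h.mem_interior t)).contDiffAt

/-- The second derivative is a variance under the tilted law; the squared mean is dropped, and
numerator and denominator are compared with the untilted law at a cost of `exp B` each. -/
lemma iteratedDeriv_two_cgf_le (h : LLRBound μ ν B) {t : ℝ} (h0 : 0 ≤ t) (h1 : t ≤ 1) :
    iteratedDeriv 2 (cgf (llr μ ν) ν) t ≤ 4 * Real.exp (4 * B) * klReal μ ν := by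
  have hB := h.nonneg
  rw [iteratedDeriv_two_cgf (h.mem_interior t)]
  have hm : Real.exp (-B) ≤ mgf (llr μ ν) ν t := by
    rw [← Real.le_log_iff_exp_le (mgf_pos (h.integrable_exp t))]; exact h.neg_le_cgf h0 h1
  have e1 : ∫ y, llr μ ν y ^ 2 * Real.exp (t * llr μ ν y) ∂ν
      ≤ Real.exp B * ∫ y, llr μ ν y ^ 2 ∂ν := by
    rw [← integral_const_mul]
    refine integral_mono_ae
      (h.integrable_comp (g := fun x => x ^ 2 * Real.exp (t * x)) (by fun_prop))
      (h.integrable_comp (g := fun x => Real.exp B * x ^ 2) (by fun_prop)) ?_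
    filter_upwards [h.bound] with y hy
    have h2 := (abs_le.1 hy).2
    have : t * llr μ ν y ≤ B := by nlinarith
    rw [mul_comm]
    gcongr
  have h3 := h.sq_le_klReal
  have e4 : Real.exp (4 * B) * Real.exp (-B) = Real.exp B * Real.exp (2 * B) := by
    rw [← Real.exp_add, ← Real.exp_add]; ring_nf
  have hkl : 0 ≤ klReal μ ν := klReal_nonneg
  have : (∫ y, llr μ ν y ^ 2 * Real.exp (t * llr μ ν y) ∂ν) / mgf (llr μ ν) ν t
      ≤ 4 * Real.exp (4 * B) * klReal μ ν := by
    rw [div_le_iff₀ (mgf_pos (h.integrable_exp t))]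
    calc _ ≤ _ := e1
      _ ≤ Real.exp B * (4 * Real.exp (2 * B) * klReal μ ν) := by gcongr
      _ = 4 * klReal μ ν * (Real.exp (4 * B) * Real.exp (-B)) := by rw [e4]; ring
      _ ≤ 4 * klReal μ ν * (Real.exp (4 * B) * mgf (llr μ ν) ν t) := by gcongr
      _ = _ := by ring
  exact (sub_le_self _ (sq_nonneg _)).trans this

end LLRBound

/-! ### Lower bounds by tilting -/

section Tilting

variable {Ω : Type*} [MeasurableSpace Ω] {μ : Measure Ω} [IsProbabilityMeasure μ] {X : Ω → ℝ}

/-- Under the tilted measure of parameter `s`, with mean `y = (cgf X μ)' s`, the variable `X` is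
close to `y`; this bounds the probability of the same event from below. -/
lemma exists_exp_cgf_le_measureReal (hX : Measurable X)
    (hint : ∀ t, Integrable (fun ω => Real.exp (t * X ω)) μ)
    {a b y v r : ℝ} (hab : a ≤ b) (ha : deriv (cgf X μ) a ≤ y) (hb : y ≤ deriv (cgf X μ) b)
    (hv : ∀ s ∈ Set.Icc a b, iteratedDeriv 2 (cgf X μ) s ≤ v) (hr : 0 < r) (hvr : 2 * v ≤ r ^ 2) :
    ∃ s ∈ Set.Icc a b,
      Real.exp (cgf X μ s - s * y - |s| * r) / 2 ≤ μ.real {ω | |X ω - y| ≤ r} := by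
  have hmem : ∀ t, t ∈ interior (integrableExpSet X μ) := fun t => by
    rw [Set.eq_univ_of_forall (s := integrableExpSet X μ) hint]; simp
  have hsm : ContDiff ℝ 2 (cgf X μ) :=
    contDiff_iff_contDiffAt.2 fun t => (analyticAt_cgf (hmem t)).contDiffAt
  have hcont : Continuous (deriv (cgf X μ)) := hsm.continuous_deriv (by norm_num)
  obtain ⟨s, hs, hsy⟩ := intermediate_value_Icc hab hcont.continuousOn ⟨ha, hb⟩
  refine ⟨s, hs, ?_⟩
  have hprob : IsProbabilityMeasure (μ.tilted (s * X ·)) := isProbabilityMeasure_tilted (hint s)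
  set τ := μ.tilted (s * X ·) with hτ
  set E := {ω | |X ω - y| ≤ r} with hE
  have hEm : MeasurableSet E := measurableSet_le ((hX.sub_const y).abs) measurable_const
  have hmean : ∫ ω, X ω ∂τ = y := by rw [hτ, integral_tilted_mul_self (hmem s), hsy]
  have hvar : Var[X; τ] ≤ v := by rw [hτ, variance_tilted_mul (hmem s)]; exact hv s hs
  -- Chebyshev under the tilted law, where the mean is `y` and the variance at most `v ≤ r² / 2`.
  have hcheb : τ.real Eᶜ ≤ 1 / 2 := by
    have h1 := meas_ge_le_variance_div_sq (memLp_tilted_mul (hmem s) 2) hr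
    rw [← hτ, hmean] at h1
    have h2 : τ Eᶜ ≤ ENNReal.ofReal (1 / 2) := by
      refine (measure_mono fun ω hω => ?_).trans (h1.trans (ENNReal.ofReal_le_ofReal ?_))
      · simp only [hE, Set.mem_compl_iff, Set.mem_ofPred_eq, not_le] at hω
        exact hω.le
      · rw [div_le_div_iff₀ (by positivity) two_pos]; linarith
    exact ENNReal.toReal_le_of_le_ofReal (by norm_num) h2
  have hhalf : 1 / 2 ≤ τ.real E := by
    have := probReal_compl_eq_one_sub (μ := τ) hEm
    linarith
  -- On the window of radius `r` around `y` the tilting density varies by at most `exp (|s| r)`, so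
  -- undoing the tilt costs only this factor.
  have hup : τ.real E ≤ Real.exp (s * y + |s| * r - cgf X μ s) * μ.real E := by
    have h1 : τ.real E = ∫ ω in E, Real.exp (s * X ω - cgf X μ s) ∂μ := by
      rw [measureReal_def, hτ, tilted_mul_apply_eq_ofReal_integral_cgf E (hint s),
        ENNReal.toReal_ofReal (integral_nonneg fun _ => (Real.exp_pos _).le)]
    rw [h1]
    have h2 : ∫ ω in E, Real.exp (s * X ω - cgf X μ s) ∂μ
        ≤ ∫ _ in E, Real.exp (s * y + |s| * r - cgf X μ s) ∂μ := by
      refine setIntegral_mono_on ?_ (integrable_const _) hEm fun ω hω => ?_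
      · simp_rw [Real.exp_sub]
        exact ((hint s).div_const _).integrableOn
      · rw [Real.exp_le_exp]
        have h3 : s * (X ω - y) ≤ |s| * r :=
          (le_abs_self _).trans (by rw [abs_mul]; gcongr; exact hω)
        linarith
    rw [setIntegral_const, smul_eq_mul, mul_comm] at h2
    exact h2
  have hexp : Real.exp (cgf X μ s - s * y - |s| * r)
      * Real.exp (s * y + |s| * r - cgf X μ s) = 1 := by
    rw [← Real.exp_add, ← Real.exp_zero]; ring_nf
  have hpos := Real.exp_pos (cgf X μ s - s * y - |s| * r)
  nlinarith [mul_le_mul_of_nonneg_left (hhalf.trans hup) hpos.le]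

end Tilting

/-! ### Linear statistics of independent variables -/

section Independent

variable {Ω ι : Type*} [MeasurableSpace Ω] {μ : Measure Ω} [IsProbabilityMeasure μ]
  {Z : ι → Ω → ℝ}

lemma cgf_linear [Fintype ι] (hind : iIndepFun Z μ) (hm : ∀ k, Measurable (Z k))
    (hint : ∀ k t, Integrable (fun ω => Real.exp (t * Z k ω)) μ) (c : ι → ℝ) (t : ℝ) :
    Integrable (fun ω => Real.exp (t * ∑ k, c k * Z k ω)) μ ∧
      cgf (fun ω => ∑ k, c k * Z k ω) μ t = ∑ k, cgf (Z k) μ (c k * t) := by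
  have hind' : iIndepFun (fun k ω => c k * Z k ω) μ :=
    hind.comp (fun k x => c k * x) fun k => measurable_const_mul (c k)
  have hm' : ∀ k, Measurable fun ω => c k * Z k ω := fun k => (hm k).const_mul _
  have hint' : ∀ k ∈ Finset.univ, Integrable (fun ω => Real.exp (t * (c k * Z k ω))) μ := by
    intro k _
    simp_rw [← mul_assoc]
    exact hint k _
  have e : (fun ω => ∑ k, c k * Z k ω) = ∑ k, fun ω => c k * Z k ω := by
    ext ω; simp
  refine ⟨by simpa using hind'.integrable_exp_mul_sum hm' hint', ?_⟩
  rw [e, hind'.cgf_sum hm' hint']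
  refine Finset.sum_congr rfl fun k _ => ?_
  rw [cgf, mgf_const_mul, cgf]

/-- The σ-algebra generated by the variables with index in `S`. -/
abbrev blockSigma (Z : ι → Ω → ℝ) (S : Set ι) : MeasurableSpace Ω :=
  ⨆ k ∈ S, MeasurableSpace.comap (Z k) inferInstance

lemma blockSigma_mono {S T : Set ι} (h : S ⊆ T) : blockSigma Z S ≤ blockSigma Z T :=
  biSup_mono h

lemma blockSigma_le (hm : ∀ k, Measurable (Z k)) (S : Set ι) :
    blockSigma Z S ≤ ‹MeasurableSpace Ω› :=
  iSup₂_le fun k _ => (hm k).comap_le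

lemma measurable_blockSigma_linear [Fintype ι] {S : Set ι} {c : ι → ℝ} (hc : ∀ k ∉ S, c k = 0) :
    Measurable[blockSigma Z S] fun ω => ∑ k, c k * Z k ω := by
  refine Finset.measurable_sum _ fun k _ => ?_
  by_cases hk : k ∈ S
  · have : Measurable[blockSigma Z S] (Z k) :=
      Measurable.mono (comap_measurable (Z k))
        (le_iSup₂_of_le (f := fun k (_ : k ∈ S) => MeasurableSpace.comap (Z k) inferInstance)
          k hk le_rfl) le_rfl
    exact this.const_mul _
  · simp only [hc k hk, zero_mul]
    exact measurable_const

lemma measureReal_inter_blockSigma (hind : iIndepFun Z μ) (hm : ∀ k, Measurable (Z k))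
    {S T : Set ι} (hST : Disjoint S T) {A A' : Set Ω} (hA : MeasurableSet[blockSigma Z S] A)
    (hA' : MeasurableSet[blockSigma Z T] A') :
    μ.real (A ∩ A') = μ.real A * μ.real A' := by
  have h : Indep (blockSigma Z S) (blockSigma Z T) μ :=
    indep_iSup_of_disjoint (fun k => (hm k).comap_le) hind hST
  rw [measureReal_def, (Indep_iff _ _ μ).1 h A A' hA hA', ENNReal.toReal_mul]
  rfl

variable {J : Type*} {S : J → Set ι} {A : J → Set Ω}

lemma measurableSet_blockSigma_biInter_compl (T : Finset J)
    (hA : ∀ j ∈ T, MeasurableSet[blockSigma Z (S j)] (A j)) :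
    MeasurableSet[blockSigma Z (⋃ j ∈ T, S j)] (⋂ j ∈ T, (A j)ᶜ) := by
  refine Finset.measurableSet_biInter _ fun j hj => ?_
  exact (blockSigma_mono (Set.subset_biUnion_of_mem (u := S) (show j ∈ (T : Set J) from hj)) _
    (hA j hj)).compl

/-- Many independent events of probability at least `π` are unlikely to all fail. -/
lemma measureReal_biInter_compl_le (hind : iIndepFun Z μ) (hm : ∀ k, Measurable (Z k))
    (T : Finset J) (hS : (T : Set J).PairwiseDisjoint S)
    (hA : ∀ j ∈ T, MeasurableSet[blockSigma Z (S j)] (A j)) {π : ℝ}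
    (hπ : ∀ j ∈ T, π ≤ μ.real (A j)) :
    μ.real (⋂ j ∈ T, (A j)ᶜ) ≤ Real.exp (-(T.card * π)) := by
  classical
  induction T using Finset.induction_on with
  | empty => simp
  | insert j T hj ih =>
    have ih' := ih (hS.subset (by simp)) (fun i hi => hA i (by simp [hi]))
      (fun i hi => hπ i (by simp [hi]))
    have hd : Disjoint (S j) (⋃ i ∈ T, S i) := by
      rw [Set.disjoint_iUnion₂_right]
      intro i hi
      exact hS (by simp) (by simp [hi]) (fun h => hj (h ▸ hi))
    have hAj := hA j (by simp)
    rw [Finset.set_biInter_insert, measureReal_inter_blockSigma hind hm hd hAj.compl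
      (measurableSet_blockSigma_biInter_compl T fun i hi => hA i (by simp [hi])),
      probReal_compl_eq_one_sub (blockSigma_le hm _ _ hAj), Finset.card_insert_of_notMem hj]
    have h1 := hπ j (by simp)
    have h2 : 1 - μ.real (A j) ≤ Real.exp (-π) := by
      linarith [Real.add_one_le_exp (-π)]
    calc _ ≤ Real.exp (-π) * Real.exp (-(T.card * π)) := by gcongr
      _ = _ := by rw [← Real.exp_add]; push_cast; ring_nf

/-- If some of the events `A j` occurs and the events `D j` are unlikely and independent of them,
then some `A j` is likely to occur without `D j`. -/
lemma measureReal_biInter_compl_union_le (hind : iIndepFun Z μ) (hm : ∀ k, Measurable (Z k))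
    {R R' : Set ι} (hR : Disjoint R R') (T : Finset J) {D : J → Set Ω}
    (hA : ∀ j ∈ T, MeasurableSet[blockSigma Z R] (A j))
    (hD : ∀ j ∈ T, MeasurableSet[blockSigma Z R'] (D j)) {β : ℝ}
    (hβ : ∀ j ∈ T, μ.real (D j) ≤ β) (hβ0 : 0 ≤ β) :
    μ.real (⋂ j ∈ T, ((A j)ᶜ ∪ D j)) ≤ μ.real (⋂ j ∈ T, (A j)ᶜ) + β := by
  classical
  -- The outcome is split by the first index, in order of insertion, whose `A j` occurs; this index
  -- is determined by the first block of variables, so its `D j` still has probability at most `β`.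
  -- A union bound over `T` is thereby avoided.
  have key : μ.real ((⋂ j ∈ T, ((A j)ᶜ ∪ D j)) ∩ (⋂ j ∈ T, (A j)ᶜ)ᶜ)
      ≤ β * μ.real (⋂ j ∈ T, (A j)ᶜ)ᶜ := by
    induction T using Finset.induction_on with
    | empty => simp
    | insert j T hj ih =>
      have ih' := ih (fun i hi => hA i (by simp [hi])) (fun i hi => hD i (by simp [hi]))
        (fun i hi => hβ i (by simp [hi]))
      set N := ⋂ i ∈ T, (A i)ᶜ with hN
      set G := ⋂ i ∈ T, ((A i)ᶜ ∪ D i) with hG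
      have hAj := hA j (by simp)
      have hNm : MeasurableSet[blockSigma Z R] N :=
        Finset.measurableSet_biInter _ fun i hi => (hA i (by simp [hi])).compl
      have hN' := blockSigma_le hm _ _ hNm
      have hAj' := blockSigma_le hm _ _ hAj
      rw [Finset.set_biInter_insert, Finset.set_biInter_insert, ← hN, ← hG]
      have e1 : (((A j)ᶜ ∪ D j) ∩ G) ∩ ((A j)ᶜ ∩ N)ᶜ ⊆ (G ∩ Nᶜ) ∪ ((N ∩ A j) ∩ D j) := by
        intro ω
        simp only [Set.mem_inter_iff, Set.mem_union, Set.mem_compl_iff]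
        tauto
      have e2 : ((A j)ᶜ ∩ N)ᶜ = Nᶜ ∪ (N ∩ A j) := by
        ext ω
        simp only [Set.mem_inter_iff, Set.mem_union, Set.mem_compl_iff]
        tauto
      have e3 : μ.real (Nᶜ ∪ (N ∩ A j)) = μ.real Nᶜ + μ.real (N ∩ A j) :=
        measureReal_union (Set.disjoint_left.2 fun ω h h' => h h'.1) (hN'.inter hAj')
      calc _ ≤ μ.real (G ∩ Nᶜ) + μ.real ((N ∩ A j) ∩ D j) :=
            (measureReal_mono e1).trans (measureReal_union_le _ _)
        _ = μ.real (G ∩ Nᶜ) + μ.real (N ∩ A j) * μ.real (D j) := by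
            rw [measureReal_inter_blockSigma hind hm hR (MeasurableSet.inter hNm hAj)
              (hD j (by simp))]
        _ ≤ β * μ.real Nᶜ + μ.real (N ∩ A j) * β := by
            gcongr
            exact hβ j (by simp)
        _ = _ := by rw [e2, e3]; ring
  have h1 : μ.real (⋂ j ∈ T, ((A j)ᶜ ∪ D j))
      ≤ μ.real (⋂ j ∈ T, (A j)ᶜ)
        + μ.real ((⋂ j ∈ T, ((A j)ᶜ ∪ D j)) ∩ (⋂ j ∈ T, (A j)ᶜ)ᶜ) := by
    refine (measureReal_mono fun ω hω => ?_).trans (measureReal_union_le _ _)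
    by_cases h : ω ∈ ⋂ j ∈ T, (A j)ᶜ
    · exact Or.inl h
    · exact Or.inr ⟨hω, h⟩
  have h2 : β * μ.real (⋂ j ∈ T, (A j)ᶜ)ᶜ ≤ β * 1 := by
    gcongr; exact measureReal_le_one
  linarith

end Independent

/-! ### Densities of product measures -/

lemma pi_withDensity {ι : Type*} [Fintype ι] {α : ι → Type*} [∀ i, MeasurableSpace (α i)]
    (ν : ∀ i, Measure (α i)) [∀ i, IsProbabilityMeasure (ν i)] (f : ∀ i, α i → ℝ≥0∞)
    (hf : ∀ i, Measurable (f i)) [∀ i, SigmaFinite ((ν i).withDensity (f i))] :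
    Measure.pi (fun i => (ν i).withDensity (f i))
      = (Measure.pi ν).withDensity fun ω => ∏ i, f i (ω i) := by
  refine Measure.pi_eq fun s hs => ?_
  have hind : iIndepFun (fun i (ω : ∀ i, α i) => (s i).indicator (f i) (ω i)) (Measure.pi ν) :=
    iIndepFun_pi fun i => ((hf i).indicator (hs i)).aemeasurable
  have hmeas : ∀ i, Measurable fun ω : ∀ i, α i => (s i).indicator (f i) (ω i) := fun i =>
    ((hf i).indicator (hs i)).comp (measurable_pi_apply i)
  rw [withDensity_apply _ (MeasurableSet.univ_pi hs), ← lintegral_indicator (MeasurableSet.univ_pi hs)]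
  have e : (Set.univ.pi s).indicator (fun ω : ∀ i, α i => ∏ i, f i (ω i))
      = fun ω => ∏ i, (s i).indicator (f i) (ω i) := by
    funext ω
    by_cases hω : ω ∈ Set.univ.pi s
    · rw [Set.indicator_of_mem hω]
      exact Finset.prod_congr rfl fun i _ => (Set.indicator_of_mem (hω i trivial) _).symm
    · rw [Set.indicator_of_notMem hω]
      simp only [Set.mem_univ_pi, not_forall] at hω
      obtain ⟨i, hi⟩ := hω
      exact (Finset.prod_eq_zero (Finset.mem_univ i) (Set.indicator_of_notMem hi _)).symm
  rw [e, lintegral_prod_eq_prod_lintegral_of_indepFun Finset.univ _ hind hmeas]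
  refine Finset.prod_congr rfl fun i _ => ?_
  rw [withDensity_apply _ (hs i), ← lintegral_indicator (hs i)]
  exact (measurePreserving_eval ν i).lintegral_comp ((hf i).indicator (hs i))

/-! ### Weights of linear statistics -/

section Weights

variable {n : ℕ}

/-- The indicator function of a set of nodes. -/
def ind (S : Finset (Fin n)) (i : Fin n) : ℝ := if i ∈ S then 1 else 0

/-- The weights of the pairs in the bilinear form with weights `f i * g j`. -/
def pairWeight (f g : Fin n → ℝ) (e : Pairs n) : ℝ :=
  f e.1.1 * g e.1.2 + f e.1.2 * g e.1.1

lemma sum_ind (S : Finset (Fin n)) : ∑ i, ind S i = S.card := by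
  simp [ind]

/-- The two terms of `pairWeight` account for both orders of a pair, so the full double sum is
recovered except for its diagonal. -/
lemma sum_pairWeight (f g : Fin n → ℝ) :
    ∑ e, pairWeight f g e = (∑ i, f i) * (∑ j, g j) - ∑ i, f i * g i := by
  have h1 : ∀ F : Fin n × Fin n → ℝ,
      ∑ e : Pairs n, F e.1 = ∑ e : Fin n × Fin n, if e.1 < e.2 then F e else 0 := by
    intro F
    rw [← Finset.sum_filter]
    exact (Finset.sum_subtype _ (by simp) F).symm
  have h2 : ∑ e : Fin n × Fin n, (if e.1 < e.2 then f e.2 * g e.1 else 0)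
      = ∑ e : Fin n × Fin n, if e.2 < e.1 then f e.1 * g e.2 else 0 :=
    Fintype.sum_equiv (Equiv.prodComm _ _) _ _ fun e => by congr
  have h3 : ∑ e : Fin n × Fin n, (if e.1 = e.2 then f e.1 * g e.2 else 0) = ∑ i, f i * g i := by
    rw [Fintype.sum_prod_type]; simp
  have h4 : (∑ i, f i) * (∑ j, g j) = ∑ e : Fin n × Fin n, f e.1 * g e.2 := by
    rw [Finset.sum_mul_sum, Fintype.sum_prod_type]
  have h5 := h1 fun e => f e.1 * g e.2
  have h6 := h1 fun e => f e.2 * g e.1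
  simp only [pairWeight, Finset.sum_add_distrib]
  rw [h5, h6, h2, h4, ← h3, ← Finset.sum_add_distrib, ← Finset.sum_sub_distrib]
  refine Finset.sum_congr rfl fun e _ => ?_
  rcases lt_trichotomy e.1 e.2 with h | h | h
  · simp [h, h.ne, h.not_gt]
  · simp [h]
  · simp [h, h.ne', h.not_gt]

lemma ind_eq_sdiff_add (C C' : Finset (Fin n)) (i : Fin n) :
    ind C i = ind (C \ C') i + ind (C ∩ C') i := by
  by_cases h : i ∈ C <;> by_cases h' : i ∈ C' <;> simp [ind, h, h']

lemma sum_ind_singleton (S : Finset (Fin n)) (i : Fin n) : ∑ j ∈ S, ind {j} i = ind S i := by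
  simp [ind]

lemma sum_pairWeight_ind (S T : Finset (Fin n)) :
    ∑ e, pairWeight (ind S) (ind T) e = S.card * T.card - (S ∩ T).card := by
  rw [sum_pairWeight, sum_ind, sum_ind, ← sum_ind (S ∩ T)]
  congr 1
  refine Finset.sum_congr rfl fun i _ => ?_
  by_cases h : i ∈ S <;> by_cases h' : i ∈ T <;> simp [ind, h, h']

end Weights

/-! ### The independent entries of an observation -/

section Model

variable {𝒴 : Type*} [MeasurableSpace 𝒴] {n M : ℕ}

instance (V U : Measure 𝒴) [IsProbabilityMeasure V] [IsProbabilityMeasure U] (b : Prop)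
    [Decidable b] : IsProbabilityMeasure (if b then V else U) := by
  split_ifs <;> infer_instance

instance (p q : I) (V U : Measure 𝒴) [IsProbabilityMeasure V] [IsProbabilityMeasure U]
    (x : Labels n) : IsProbabilityMeasure (obsLaw n M p q V U x) := by
  unfold obsLaw; infer_instance

/-- The log-likelihood ratios of the single entries of an observation. -/
def entryLLR (n M : ℕ) (p q : I) (V U : Measure 𝒴) :
    Pairs n ⊕ (Fin n × Fin M) → Obs 𝒴 n M → ℝ
  | .inl e, ω => llr (edgeLaw p) (edgeLaw q) (ω.1 e)
  | .inr k, ω => llr V U (ω.2 k.1 k.2)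

/-- The coefficients of the statistic with weight `w e` on the pair `e` and `u i` on the features
of the node `i`. -/
def coeff (M : ℕ) (w : Pairs n → ℝ) (u : Fin n → ℝ) : Pairs n ⊕ (Fin n × Fin M) → ℝ
  | .inl e => w e
  | .inr k => u k.1

/-- The linear statistic with weight `w e` on the pair `e` and `u i` on the features of `i`. -/
def stat (p q : I) (V U : Measure 𝒴) (w : Pairs n → ℝ) (u : Fin n → ℝ) (ω : Obs 𝒴 n M) : ℝ :=
  ∑ e, w e * llr (edgeLaw p) (edgeLaw q) (ω.1 e) + ∑ i, u i * ∑ m, llr V U (ω.2 i m)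

variable {p q : I} {V U : Measure 𝒴}

lemma stat_eq_sum (w : Pairs n → ℝ) (u : Fin n → ℝ) (ω : Obs 𝒴 n M) :
    stat p q V U w u ω = ∑ k, coeff M w u k * entryLLR n M p q V U k ω := by
  rw [Fintype.sum_sum_type, Fintype.sum_prod_type]
  simp [stat, coeff, entryLLR, Finset.mul_sum]

lemma measurable_entryLLR (k : Pairs n ⊕ (Fin n × Fin M)) :
    Measurable (entryLLR n M p q V U k) := by
  rcases k with e | k
  · exact (measurable_llr _ _).comp ((measurable_pi_apply e).comp measurable_fst)
  · exact (measurable_llr _ _).comp ((measurable_pi_apply k.2).comp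
      ((measurable_pi_apply k.1).comp measurable_snd))

lemma measurable_stat (w : Pairs n → ℝ) (u : Fin n → ℝ) :
    Measurable (stat (M := M) p q V U w u) := by
  have : stat (M := M) p q V U w u
      = fun ω => ∑ k, coeff M w u k * entryLLR n M p q V U k ω := funext (stat_eq_sum w u)
  rw [this]
  exact Finset.measurable_sum _ fun k _ => (measurable_entryLLR k).const_mul _

variable [IsProbabilityMeasure V] [IsProbabilityMeasure U] (x : Labels n)

lemma measurePreserving_edge (e : Pairs n) :
    MeasurePreserving (fun ω : Obs 𝒴 n M => ω.1 e) (obsLaw n M p q V U x)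
      (edgeLaw (if x e.1.1 = true ∧ x e.1.2 = true then p else q)) :=
  (measurePreserving_eval _ e).comp measurePreserving_fst

lemma measurePreserving_feature (i : Fin n) (m : Fin M) :
    MeasurePreserving (fun ω : Obs 𝒴 n M => ω.2 i m) (obsLaw n M p q V U x)
      (if x i = true then V else U) :=
  (measurePreserving_eval (fun _ : Fin M => if x i = true then V else U) m).comp
    ((measurePreserving_eval (fun i : Fin n => Measure.pi fun _ : Fin M =>
      if x i = true then V else U) i).comp measurePreserving_snd)

lemma iIndepFun_entryLLR : iIndepFun (entryLLR n M p q V U) (obsLaw n M p q V U x) := by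
  classical
  rw [iIndepFun_iff_measure_inter_preimage_eq_mul]
  intro S s hs
  set f : Pairs n → Set Bool := fun e =>
    if Sum.inl e ∈ S then llr (edgeLaw p) (edgeLaw q) ⁻¹' s (.inl e) else Set.univ with hf
  set g : Fin n → Fin M → Set 𝒴 := fun i m =>
    if Sum.inr (i, m) ∈ S then llr V U ⁻¹' s (.inr (i, m)) else Set.univ with hg
  -- Padding the unconstrained coordinates with the whole space turns the event into a box, whose
  -- product measure factors.
  have e1 : (⋂ k ∈ S, entryLLR n M p q V U k ⁻¹' s k)
      = (Set.univ.pi f) ×ˢ (Set.univ.pi fun i => Set.univ.pi (g i)) := by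
    ext ω
    simp only [Set.mem_iInter, Set.mem_preimage, Set.mem_prod, Set.mem_univ_pi]
    constructor
    · intro h
      refine ⟨fun e => ?_, fun i m => ?_⟩
      · by_cases he : Sum.inl e ∈ S
        · simp only [hf, he, if_true]; exact h _ he
        · simp [hf, he]
      · by_cases he : Sum.inr (i, m) ∈ S
        · simp only [hg, he, if_true]; exact h _ he
        · simp [hg, he]
    · rintro ⟨h1, h2⟩ (e | ⟨i, m⟩) hk
      · have := h1 e
        simp only [hf, hk, if_true] at this; exact this
      · have := h2 i m
        simp only [hg, hk, if_true] at this; exact this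
  have e2 : ∀ k ∈ S, obsLaw n M p q V U x (entryLLR n M p q V U k ⁻¹' s k)
      = Sum.elim (fun e => edgeLaw (if x e.1.1 = true ∧ x e.1.2 = true then p else q) (f e))
        (fun k => (if x k.1 = true then V else U) (g k.1 k.2)) k := by
    rintro (e | ⟨i, m⟩) hk
    · simp only [Sum.elim_inl, hf, hk, if_true]
      exact (measurePreserving_edge x e).measure_preimage
        ((measurable_llr _ _) (hs _ hk)).nullMeasurableSet
    · simp only [Sum.elim_inr, hg, hk, if_true]
      exact (measurePreserving_feature x i m).measure_preimage
        ((measurable_llr _ _) (hs _ hk)).nullMeasurableSet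
  rw [e1, Finset.prod_congr rfl e2, obsLaw, Measure.prod_prod, Measure.pi_pi, Measure.pi_pi]
  simp_rw [Measure.pi_pi]
  rw [Finset.prod_subset (Finset.subset_univ S), Fintype.prod_sum_type, Fintype.prod_prod_type]
  · rfl
  · rintro (e | ⟨i, m⟩) - hk
    · simp [hf, hk]
    · simp [hg, hk]

lemma mgf_entryLLR (k : Pairs n ⊕ (Fin n × Fin M)) (t : ℝ) :
    mgf (entryLLR n M p q V U k) (obsLaw n M p q V U x) t
      = Sum.elim (fun e => mgf (llr (edgeLaw p) (edgeLaw q))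
          (edgeLaw (if x e.1.1 = true ∧ x e.1.2 = true then p else q)) t)
        (fun k => mgf (llr V U) (if x k.1 = true then V else U) t) k := by
  rcases k with e | ⟨i, m⟩
  · have h := measurePreserving_edge (M := M) (p := p) (q := q) (V := V) (U := U) x e
    simp only [Sum.elim_inl]
    rw [← h.map_eq, mgf_map h.measurable.aemeasurable
      (((measurable_llr _ _).const_mul t).exp.aestronglyMeasurable)]
    rfl
  · have h := measurePreserving_feature (p := p) (q := q) (V := V) (U := U) x i m
    simp only [Sum.elim_inr]
    rw [← h.map_eq, mgf_map h.measurable.aemeasurable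
      (((measurable_llr _ _).const_mul t).exp.aestronglyMeasurable)]
    rfl

variable {B : ℝ} (hE : LLRBound (edgeLaw p) (edgeLaw q) B) (hS : LLRBound V U B)

include hE hS in
lemma integrable_exp_entryLLR (k : Pairs n ⊕ (Fin n × Fin M)) (t : ℝ) :
    Integrable (fun ω => Real.exp (t * entryLLR n M p q V U k ω)) (obsLaw n M p q V U x) := by
  rcases k with e | ⟨i, m⟩
  · refine (measurePreserving_edge x e).integrable_comp_of_integrable
      (g := fun b => Real.exp (t * llr (edgeLaw p) (edgeLaw q) b)) ?_
    split_ifs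
    · exact hE.integrable_exp' t
    · exact hE.integrable_exp t
  · refine (measurePreserving_feature x i m).integrable_comp_of_integrable
      (g := fun b => Real.exp (t * llr V U b)) ?_
    split_ifs
    · exact hS.integrable_exp' t
    · exact hS.integrable_exp t

include hE hS in
lemma integrable_exp_stat (w : Pairs n → ℝ) (u : Fin n → ℝ) (t : ℝ) :
    Integrable (fun ω => Real.exp (t * stat p q V U w u ω)) (obsLaw n M p q V U x) := by
  simp_rw [stat_eq_sum]
  exact (cgf_linear (iIndepFun_entryLLR x) measurable_entryLLR
    (integrable_exp_entryLLR x hE hS) _ t).1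

include hE hS in
lemma cgf_stat (w : Pairs n → ℝ) (u : Fin n → ℝ) (t : ℝ) :
    cgf (stat p q V U w u) (obsLaw n M p q V U x) t
      = ∑ e, cgf (llr (edgeLaw p) (edgeLaw q))
          (edgeLaw (if x e.1.1 = true ∧ x e.1.2 = true then p else q)) (w e * t)
        + ∑ i, M * cgf (llr V U) (if x i = true then V else U) (u i * t) := by
  have e : stat (M := M) p q V U w u
      = fun ω => ∑ k, coeff M w u k * entryLLR n M p q V U k ω := funext (stat_eq_sum w u)
  rw [e, (cgf_linear (iIndepFun_entryLLR x) measurable_entryLLR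
    (integrable_exp_entryLLR x hE hS) _ t).2, Fintype.sum_sum_type, Fintype.sum_prod_type]
  simp only [cgf, mgf_entryLLR, coeff, Sum.elim_inl, Sum.elim_inr]
  congr 1
  refine Finset.sum_congr rfl fun i _ => ?_
  rw [Finset.sum_eq_card_nsmul (b := Real.log (mgf (llr V U) (if x i = true then V else U)
    (u i * t))) fun m _ => by congr]
  simp

include hE hS in
/-- The cumulant generating function of a statistic with weights `0` and `1` all of whose pairs,
respectively features, have the same law. -/
lemma cgf_stat_unit {w : Pairs n → ℝ} {u : Fin n → ℝ} {r : I} {ρ : Measure 𝒴}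
    (hr : ∀ e, w e = 0 ∨ w e = 1 ∧ (if x e.1.1 = true ∧ x e.1.2 = true then p else q) = r)
    (hρ : ∀ i, u i = 0 ∨ u i = 1 ∧ (if x i = true then V else U) = ρ) :
    cgf (stat p q V U w u) (obsLaw n M p q V U x) = fun t =>
      (∑ e, w e) * cgf (llr (edgeLaw p) (edgeLaw q)) (edgeLaw r) t
        + (∑ i, u i) * M * cgf (llr V U) ρ t := by
  funext t
  rw [cgf_stat x hE hS, Finset.sum_mul, Finset.sum_mul, Finset.sum_mul]
  congr 1
  · refine Finset.sum_congr rfl fun e _ => ?_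
    rcases hr e with h | ⟨h, h'⟩
    · simp [h]
    · rw [h, h', one_mul, one_mul]
  · refine Finset.sum_congr rfl fun i _ => ?_
    rcases hρ i with h | ⟨h, h'⟩
    · simp [h]
    · rw [h, h', one_mul, one_mul]

/-! ### The likelihood -/

/-- The nodes of the community. -/
def community (x : Labels n) : Finset (Fin n) := Finset.univ.filter fun i => x i = true

lemma mem_community {x : Labels n} {i : Fin n} : i ∈ community x ↔ x i = true := by
  simp [community]

lemma community_injective : Function.Injective (community (n := n)) := by
  intro x y h
  funext i
  have := congrArg (i ∈ ·) h
  simp only [mem_community, eq_iff_iff] at this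
  exact Bool.eq_iff_iff.2 this

lemma mem_communityLabels {K : ℕ} {x : Labels n} :
    x ∈ communityLabels n K ↔ (community x).card = K := by
  simp [communityLabels, community]

/-- The log-likelihood of the community `C`, up to a constant. -/
def score (p q : I) (V U : Measure 𝒴) (C : Finset (Fin n)) (ω : Obs 𝒴 n M) : ℝ :=
  stat p q V U (fun e => pairWeight (ind C) (ind C) e / 2) (ind C) ω

lemma withDensity_exp_llr {α : Type*} [MeasurableSpace α] {μ ν : Measure α}
    [IsProbabilityMeasure μ] [IsProbabilityMeasure ν] {B : ℝ} (h : LLRBound μ ν B) :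
    ν.withDensity (fun y => ENNReal.ofReal (Real.exp (llr μ ν y))) = μ := by
  conv_rhs => rw [← Measure.withDensity_rnDeriv_eq μ ν h.ac]
  refine withDensity_congr_ae ?_
  filter_upwards [exp_llr_of_ac' μ ν h.ac', Measure.rnDeriv_lt_top μ ν] with y hy hy'
  rw [hy, ENNReal.ofReal_toReal hy'.ne]

lemma withDensity_exp_mul_llr {α : Type*} [MeasurableSpace α] {μ ν : Measure α}
    [IsProbabilityMeasure μ] [IsProbabilityMeasure ν] {B : ℝ} (h : LLRBound μ ν B) (b : Prop)
    [Decidable b] :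
    ν.withDensity (fun y => ENNReal.ofReal (Real.exp ((if b then 1 else 0) * llr μ ν y)))
      = if b then μ else ν := by
  split_ifs
  · simpa using withDensity_exp_llr h
  · simp

include hE hS in
-- All conditional laws get a density with respect to the same law, that of pure noise, so
-- likelihoods of different labellings can be compared pointwise.
lemma obsLaw_eq_withDensity :
    obsLaw n M p q V U x = (obsLaw n M p q V U fun _ => false).withDensity
      fun ω => ENNReal.ofReal (Real.exp (score p q V U (community x) ω)) := by
  have hG : (Measure.pi fun e : Pairs n =>
      edgeLaw (if x e.1.1 = true ∧ x e.1.2 = true then p else q))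
      = (Measure.pi fun _ : Pairs n => edgeLaw q).withDensity fun G => ∏ e : Pairs n,
        ENNReal.ofReal (Real.exp ((if x e.1.1 = true ∧ x e.1.2 = true then 1 else 0)
          * llr (edgeLaw p) (edgeLaw q) (G e))) := by
    have h : ∀ e : Pairs n, (edgeLaw q).withDensity (fun b =>
        ENNReal.ofReal (Real.exp ((if x e.1.1 = true ∧ x e.1.2 = true then 1 else 0)
          * llr (edgeLaw p) (edgeLaw q) b)))
        = edgeLaw (if x e.1.1 = true ∧ x e.1.2 = true then p else q) := fun e => by
      rw [withDensity_exp_mul_llr hE]; split_ifs <;> rfl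
    have : ∀ e : Pairs n, SigmaFinite ((edgeLaw q).withDensity (fun b =>
        ENNReal.ofReal (Real.exp ((if x e.1.1 = true ∧ x e.1.2 = true then 1 else 0)
          * llr (edgeLaw p) (edgeLaw q) b)))) := fun e => by rw [h]; infer_instance
    rw [← pi_withDensity _ _ fun e =>
      ((measurable_llr _ _).const_mul _).exp.ennreal_ofReal]
    simp_rw [h]
  have hY : ∀ i : Fin n, (Measure.pi fun _ : Fin M => if x i = true then V else U)
      = (Measure.pi fun _ : Fin M => U).withDensity fun y => ∏ m : Fin M,
        ENNReal.ofReal (Real.exp ((if x i = true then 1 else 0) * llr V U (y m))) := by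
    intro i
    have h := withDensity_exp_mul_llr hS (x i = true)
    have : SigmaFinite (U.withDensity (fun b =>
        ENNReal.ofReal (Real.exp ((if x i = true then 1 else 0) * llr V U b)))) := by
      rw [h]; infer_instance
    rw [← pi_withDensity _ _ fun e =>
      ((measurable_llr _ _).const_mul _).exp.ennreal_ofReal]
    simp_rw [h]
  have mY : ∀ i : Fin n, Measurable fun y : Fin M → 𝒴 => ∏ m : Fin M,
        ENNReal.ofReal (Real.exp ((if x i = true then 1 else 0) * llr V U (y m))) := fun i =>
    Finset.measurable_prod _ fun m _ =>
      (((measurable_llr V U).comp (measurable_pi_apply m)).const_mul _).exp.ennreal_ofReal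
  have hF : (Measure.pi fun i : Fin n => Measure.pi fun _ : Fin M => if x i = true then V else U)
      = (Measure.pi fun _ : Fin n => Measure.pi fun _ : Fin M => U).withDensity fun Y =>
        ∏ i : Fin n, ∏ m : Fin M,
          ENNReal.ofReal (Real.exp ((if x i = true then 1 else 0) * llr V U (Y i m))) := by
    have : ∀ i : Fin n, SigmaFinite ((Measure.pi fun _ : Fin M => U).withDensity fun y =>
        ∏ m : Fin M,
        ENNReal.ofReal (Real.exp ((if x i = true then 1 else 0) * llr V U (y m)))) := fun i => by
      rw [← hY]; infer_instance
    simp_rw [hY]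
    exact pi_withDensity _ _ mY
  have mG : Measurable fun G : Pairs n → Bool => ∏ e : Pairs n,
        ENNReal.ofReal (Real.exp ((if x e.1.1 = true ∧ x e.1.2 = true then 1 else 0)
          * llr (edgeLaw p) (edgeLaw q) (G e))) :=
    Finset.measurable_prod _ fun e _ =>
      (((measurable_llr _ _).comp (measurable_pi_apply e)).const_mul _).exp.ennreal_ofReal
  have mF : Measurable fun Y : Fin n → Fin M → 𝒴 => ∏ i : Fin n, ∏ m : Fin M,
          ENNReal.ofReal (Real.exp ((if x i = true then 1 else 0) * llr V U (Y i m))) :=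
    Finset.measurable_prod _ fun i _ => (mY i).comp (measurable_pi_apply i)
  rw [obsLaw, hG, hF]
  have : SFinite ((Measure.pi fun _ : Fin n => Measure.pi fun _ : Fin M => U).withDensity fun Y =>
        ∏ i : Fin n, ∏ m : Fin M,
          ENNReal.ofReal (Real.exp ((if x i = true then 1 else 0) * llr V U (Y i m)))) := by
    rw [← hF]; infer_instance
  rw [prod_withDensity mG mF]
  have h0 : (obsLaw n M p q V U fun _ => false) = (Measure.pi fun _ : Pairs n => edgeLaw q).prod
      (Measure.pi fun _ : Fin n => Measure.pi fun _ : Fin M => U) := by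
    simp [obsLaw]
  rw [h0]
  congr 1
  funext ω
  rw [score, stat, Real.exp_add, ENNReal.ofReal_mul (Real.exp_pos _).le, Real.exp_sum,
    Real.exp_sum, ENNReal.ofReal_prod_of_nonneg fun _ _ => (Real.exp_pos _).le,
    ENNReal.ofReal_prod_of_nonneg fun _ _ => (Real.exp_pos _).le]
  congr 1
  · refine Finset.prod_congr rfl fun e _ => ?_
    congr 3
    -- A pair inside the community has `pairWeight` two, which explains the halving in `score`.
    simp only [pairWeight, ind, mem_community]
    by_cases h1 : x e.1.1 = true <;> by_cases h2 : x e.1.2 = true <;> simp [h1, h2]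
  · refine Finset.prod_congr rfl fun i _ => ?_
    rw [Finset.mul_sum, Real.exp_sum, ENNReal.ofReal_prod_of_nonneg fun _ _ => (Real.exp_pos _).le]
    simp [ind, mem_community]

end Model

section Bounds

variable {𝒴 : Type*} [MeasurableSpace 𝒴] {n M : ℕ} {p q : I} {V U : Measure 𝒴}
  [IsProbabilityMeasure V] [IsProbabilityMeasure U] {B : ℝ}

/-! ### The exponent -/

/-- A real supremum dominates its terms only if the family is bounded above, which holds because
both cumulant generating functions are at least `-B` on `[0, 1]`. -/
lemma le_exponentQU (hE : LLRBound (edgeLaw p) (edgeLaw q) B) (hS : LLRBound V U B)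
    {θ m₁ m₂ t : ℝ} (h₁ : 0 ≤ m₁) (h₂ : 0 ≤ m₂) (ht : t ∈ Set.Icc (0 : ℝ) 1) :
    t * θ - psiQU p q V U t m₁ m₂ ≤ exponentQU p q V U θ m₁ m₂ := by
  refine le_ciSup (f := fun t : Set.Icc (0 : ℝ) 1 => (t : ℝ) * θ - psiQU p q V U t m₁ m₂)
    ⟨|θ| + m₁ * B + m₂ * B, ?_⟩ ⟨t, ht⟩
  rintro _ ⟨⟨s, hs⟩, rfl⟩
  have a1 := hE.neg_le_cgf hs.1 hs.2
  have a2 := hS.neg_le_cgf hs.1 hs.2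
  have a3 : s * θ ≤ |θ| := (le_abs_self _).trans (by
    rw [abs_mul, abs_of_nonneg hs.1]; exact mul_le_of_le_one_left (abs_nonneg _) hs.2)
  simp only [psiQU]
  nlinarith

/-- A parameter that is optimal up to `1` suffices, because additive constants are negligible
against `log n`. -/
lemma exists_exponentQU_lt (p q : I) (V U : Measure 𝒴) (θ m₁ m₂ : ℝ) :
    ∃ t ∈ Set.Icc (0 : ℝ) 1,
      exponentQU p q V U θ m₁ m₂ - 1 < t * θ - psiQU p q V U t m₁ m₂ := by
  have : Nonempty (Set.Icc (0 : ℝ) 1) := ⟨0, by simp⟩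
  obtain ⟨⟨t, ht⟩, h⟩ := exists_lt_of_lt_ciSup
    (f := fun t : Set.Icc (0 : ℝ) 1 => (t : ℝ) * θ - psiQU p q V U t m₁ m₂)
    (sub_one_lt (exponentQU p q V U θ m₁ m₂))
  exact ⟨t, ht, h⟩

/-- The exponent exceeds `θ` by a multiple of the total divergence `W`, as long as `θ < W`. -/
lemma exponentQU_ge (hE : LLRBound (edgeLaw p) (edgeLaw q) B) (hS : LLRBound V U B)
    {θ m₁ m₂ t : ℝ} (h₁ : 0 ≤ m₁) (h₂ : 0 ≤ m₂) (h0 : 0 ≤ t) (h1 : t ≤ 1) :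
    θ - t * θ + (t - 4 * Real.exp (4 * B) * t ^ 2)
        * (m₁ * klReal (edgeLaw p) (edgeLaw q) + m₂ * klReal V U)
      ≤ exponentQU p q V U θ m₁ m₂ := by
  -- At `1 - t` the generating functions under `Q` and `U` are those under `P` and `V` at `-t`, to
  -- which the quadratic bound applies.
  have h := le_exponentQU hE hS (θ := θ) h₁ h₂ (t := 1 - t) ⟨by linarith, by linarith⟩
  refine le_trans ?_ h
  have a1 := hE.cgf_left_neg_le h0 h1
  have a2 := hS.cgf_left_neg_le h0 h1
  rw [hE.cgf_left] at a1
  rw [hS.cgf_left] at a2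
  simp only [neg_add_eq_sub] at a1 a2
  rw [psiQU]
  have b1 := mul_le_mul_of_nonneg_left a1 h₁
  have b2 := mul_le_mul_of_nonneg_left a2 h₂
  linarith

/-! ### Statistics of nodes and of sets of nodes -/

/-- The statistic of the node `i` when the other members of the community are `S`. -/
def nodeStat (p q : I) (V U : Measure 𝒴) (S : Finset (Fin n)) (i : Fin n) : Obs 𝒴 n M → ℝ :=
  stat p q V U (pairWeight (ind {i}) (ind S)) (ind {i})

/-- The contribution of the set `A` to the score of `A ∪ S`. -/
def blockStat (p q : I) (V U : Measure 𝒴) (A S : Finset (Fin n)) : Obs 𝒴 n M → ℝ :=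
  stat p q V U (fun e => pairWeight (ind A) (ind A) e / 2 + pairWeight (ind A) (ind S) e) (ind A)

/-- The correction for the pairs inside of `A ∪ A'` when the sum of the statistics of the single
nodes is compared with the score. -/
def innerStat (p q : I) (V U : Measure 𝒴) (A A' : Finset (Fin n)) : Obs 𝒴 n M → ℝ :=
  stat p q V U (fun e => pairWeight (ind A) (ind A) e / 2 - pairWeight (ind A) (ind A') e
    + pairWeight (ind A') (ind A') e / 2) 0

lemma stat_add (w w' : Pairs n → ℝ) (u u' : Fin n → ℝ) (ω : Obs 𝒴 n M) :
    stat p q V U w u ω + stat p q V U w' u' ω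
      = stat p q V U (fun e => w e + w' e) (fun i => u i + u' i) ω := by
  simp only [stat, add_mul, Finset.sum_add_distrib]; ring

lemma stat_sub (w w' : Pairs n → ℝ) (u u' : Fin n → ℝ) (ω : Obs 𝒴 n M) :
    stat p q V U w u ω - stat p q V U w' u' ω
      = stat p q V U (fun e => w e - w' e) (fun i => u i - u' i) ω := by
  simp only [stat, sub_mul, Finset.sum_sub_distrib]; ring

lemma stat_sum {J : Type*} (T : Finset J) (w : J → Pairs n → ℝ) (u : J → Fin n → ℝ)
    (ω : Obs 𝒴 n M) :
    ∑ j ∈ T, stat p q V U (w j) (u j) ω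
      = stat p q V U (fun e => ∑ j ∈ T, w j e) (fun i => ∑ j ∈ T, u j i) ω := by
  simp only [stat, Finset.sum_mul, Finset.sum_add_distrib]
  rw [Finset.sum_comm]
  congr 1
  rw [Finset.sum_comm]

lemma sum_nodeStat (C A : Finset (Fin n)) (ω : Obs 𝒴 n M) :
    ∑ i ∈ A, nodeStat p q V U C i ω = stat p q V U (pairWeight (ind A) (ind C)) (ind A) ω := by
  simp only [nodeStat]
  rw [stat_sum]
  congr 1
  · funext e
    simp only [pairWeight, Finset.sum_add_distrib, ← Finset.sum_mul, sum_ind_singleton]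
  · funext i; rw [sum_ind_singleton]

/-- The contribution of the common part `C ∩ C'` cancels. -/
lemma score_sub_score (C C' : Finset (Fin n)) (ω : Obs 𝒴 n M) :
    score p q V U C ω - score p q V U C' ω
      = blockStat p q V U (C \ C') (C ∩ C') ω - blockStat p q V U (C' \ C) (C ∩ C') ω := by
  simp only [score, blockStat, stat_sub]
  have h : ∀ i, ind C i = ind (C \ C') i + ind (C ∩ C') i := ind_eq_sdiff_add C C'
  have h' : ∀ i, ind C' i = ind (C' \ C) i + ind (C ∩ C') i := fun i => by
    rw [ind_eq_sdiff_add C' C, Finset.inter_comm]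
  congr 1
  · funext e; simp only [pairWeight, h, h']; ring
  · funext i; rw [h, h']; ring

/-- The node statistics are all taken against `C`: the pairs inside `C \ C'` are counted twice,
those between the two differences are counted wrongly, and those inside `C' \ C` are missed.
`innerStat` repairs exactly these. -/
lemma score_sub_score' (C C' : Finset (Fin n)) (ω : Obs 𝒴 n M) :
    score p q V U C ω - score p q V U C' ω
      = ∑ i ∈ C \ C', nodeStat p q V U C i ω - ∑ j ∈ C' \ C, nodeStat p q V U C j ω
        - innerStat p q V U (C \ C') (C' \ C) ω := by
  simp only [score, sum_nodeStat, innerStat, stat_sub]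
  have h : ∀ i, ind C i = ind (C \ C') i + ind (C ∩ C') i := ind_eq_sdiff_add C C'
  have h' : ∀ i, ind C' i = ind (C' \ C) i + ind (C ∩ C') i := fun i => by
    rw [ind_eq_sdiff_add C' C, Finset.inter_comm]
  congr 1
  · funext e; simp only [pairWeight, h, h']; ring
  · funext i; rw [h, h']; simp

/-! ### Chernoff bounds -/

lemma sum_ind_mul_singleton (S : Finset (Fin n)) (i : Fin n) :
    ∑ e, pairWeight (ind {i}) (ind S) e = S.card - ind S i := by
  rw [sum_pairWeight, sum_ind, sum_ind]
  simp [ind]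

variable (x : Labels n) (hE : LLRBound (edgeLaw p) (edgeLaw q) B) (hS : LLRBound V U B)

include hE hS in
lemma cgf_nodeStat_of_mem {i : Fin n} (hi : i ∈ community x) {S : Finset (Fin n)}
    (hSC : S ⊆ community x) :
    cgf (nodeStat p q V U S i) (obsLaw n M p q V U x) = fun t =>
      (S.card - ind S i) * cgf (llr (edgeLaw p) (edgeLaw q)) (edgeLaw p) t
        + M * cgf (llr V U) V t := by
  rw [nodeStat, cgf_stat_unit x hE hS (r := p) (ρ := V)]
  · funext t
    rw [sum_ind_mul_singleton, sum_ind]; simp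
  · intro e
    have hne : e.1.1 ≠ e.1.2 := e.2.ne
    rw [mem_community] at hi
    have hS' : ∀ {k}, k ∈ S → x k = true := fun hk => mem_community.1 (hSC hk)
    simp only [pairWeight, ind, Finset.mem_singleton]
    by_cases h1 : e.1.1 = i
    · have h2 : e.1.2 ≠ i := fun h => hne (h1.trans h.symm)
      by_cases h3 : e.1.2 ∈ S
      · right; simp [h1, h2, h3, hi, hS' h3]
      · left; simp [h2, h3]
    · by_cases h2 : e.1.2 = i
      · by_cases h3 : e.1.1 ∈ S
        · right; simp [h1, h2, h3, hi, hS' h3]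
        · left; simp [h1, h3]
      · left; simp [h1, h2]
  · intro j
    by_cases h : j = i
    · right; simp [ind, h, mem_community.1 hi]
    · left; simp [ind, h]

include hE hS in
lemma cgf_nodeStat_of_notMem {i : Fin n} (hi : i ∉ community x) (S : Finset (Fin n)) :
    cgf (nodeStat p q V U S i) (obsLaw n M p q V U x) = fun t =>
      (S.card - ind S i) * cgf (llr (edgeLaw p) (edgeLaw q)) (edgeLaw q) t
        + M * cgf (llr V U) U t := by
  rw [nodeStat, cgf_stat_unit x hE hS (r := q) (ρ := U)]
  · funext t
    rw [sum_ind_mul_singleton, sum_ind]; simp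
  · intro e
    have hne : e.1.1 ≠ e.1.2 := e.2.ne
    rw [mem_community] at hi
    simp only [pairWeight, ind, Finset.mem_singleton]
    by_cases h1 : e.1.1 = i
    · have h2 : e.1.2 ≠ i := fun h => hne (h1.trans h.symm)
      by_cases h3 : e.1.2 ∈ S
      · right; simp [h1, h2, h3, hi]
      · left; simp [h2, h3]
    · by_cases h2 : e.1.2 = i
      · by_cases h3 : e.1.1 ∈ S
        · right; simp [h1, h2, h3, hi]
        · left; simp [h1, h3]
      · left; simp [h1, h2]
  · intro j
    by_cases h : j = i
    · rw [mem_community] at hi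
      right; simp [ind, h, hi]
    · left; simp [ind, h]

include hE hS in
-- Chernoff at parameter `-(1 - t)` under the laws `P`, `V` becomes `psiQU` at `t` after the shift
-- by one, so members and outsiders are governed by the same `t`.
lemma nodeStat_le_of_mem {i : Fin n} (hi : i ∈ community x) {t : ℝ} (h0 : 0 ≤ t) (h1 : t ≤ 1)
    (b : ℝ) :
    (obsLaw n M p q V U x).real {ω | nodeStat p q V U (community x) i ω ≤ b}
      ≤ Real.exp ((1 - t) * b + psiQU p q V U t (community x).card M + B) := by
  have h := measure_le_le_exp_cgf (μ := obsLaw n M p q V U x) b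
    (show -(1 - t) ≤ 0 by linarith)
    (integrable_exp_stat (M := M) x hE hS (pairWeight (ind {i}) (ind (community x))) (ind {i}) _)
  refine h.trans (Real.exp_le_exp.2 ?_)
  have := cgf_nodeStat_of_mem (M := M) x hE hS hi subset_rfl
  rw [nodeStat] at this
  rw [this, hE.cgf_left, hS.cgf_left, psiQU]
  have e : -(1 - t) + 1 = t := by ring
  have hb := hE.neg_le_cgf h0 h1
  simp only [ind, hi, if_true, e]
  linarith

include hE hS in
lemma le_nodeStat_of_notMem {i : Fin n} (hi : i ∉ community x) {t : ℝ} (h0 : 0 ≤ t) (b : ℝ) :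
    (obsLaw n M p q V U x).real {ω | b ≤ nodeStat p q V U (community x) i ω}
      ≤ Real.exp (-t * b + psiQU p q V U t (community x).card M) := by
  have h := measure_ge_le_exp_cgf (μ := obsLaw n M p q V U x) b h0
    (integrable_exp_stat (M := M) x hE hS (pairWeight (ind {i}) (ind (community x))) (ind {i}) _)
  refine h.trans (Real.exp_le_exp.2 ?_)
  have := cgf_nodeStat_of_notMem (M := M) x hE hS hi (community x)
  rw [nodeStat] at this
  rw [this, psiQU]
  simp [ind, hi]

include hE hS in
lemma blockStat_le {A : Finset (Fin n)} (hA : A ⊆ community x) {t : ℝ} (h0 : 0 ≤ t) (h1 : t ≤ 1)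
    (b : ℝ) :
    (obsLaw n M p q V U x).real {ω | blockStat p q V U A (community x \ A) ω ≤ b}
      ≤ Real.exp (t * b + (-t + 4 * Real.exp (4 * B) * t ^ 2)
        * (((A.card ^ 2 - A.card) / 2 + A.card * ((community x).card - A.card))
            * klReal (edgeLaw p) (edgeLaw q) + A.card * M * klReal V U)) := by
  have h := measure_le_le_exp_cgf (μ := obsLaw n M p q V U x) b
    (show -t ≤ 0 by linarith)
    (integrable_exp_stat (M := M) x hE hS (fun e => pairWeight (ind A) (ind A) e / 2
      + pairWeight (ind A) (ind (community x \ A)) e) (ind A) _)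
  refine h.trans (Real.exp_le_exp.2 ?_)
  rw [cgf_stat_unit x hE hS (r := p) (ρ := V)]
  · have hc : (((community x \ A).card : ℕ) : ℝ) = (community x).card - A.card := by
      rw [Finset.card_sdiff_of_subset hA, Nat.cast_sub (Finset.card_le_card hA)]
    have hw : ∑ e, (pairWeight (ind A) (ind A) e / 2 + pairWeight (ind A) (ind (community x \ A)) e)
        = (A.card ^ 2 - A.card) / 2 + A.card * ((community x).card - A.card) := by
      rw [Finset.sum_add_distrib, ← Finset.sum_div, sum_pairWeight_ind, sum_pairWeight_ind, hc,
        Finset.inter_self, Finset.inter_sdiff_self]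
      simp; ring
    have hN : 0 ≤ ((A.card : ℝ) ^ 2 - A.card) / 2 + A.card * ((community x).card - A.card) := by
      rw [← hw]
      refine Finset.sum_nonneg fun e _ => ?_
      unfold pairWeight ind
      positivity
    have a1 := mul_le_mul_of_nonneg_left (hE.cgf_left_neg_le h0 h1) hN
    have a2 := mul_le_mul_of_nonneg_left (hS.cgf_left_neg_le h0 h1)
      (by positivity : 0 ≤ (A.card : ℝ) * M)
    simp only [hw, sum_ind]
    linarith
  · intro e
    have hx : ∀ {k}, k ∈ A → x k = true := fun hk => mem_community.1 (hA hk)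
    simp only [pairWeight, ind, Finset.mem_sdiff, mem_community]
    by_cases h1 : e.1.1 ∈ A <;> by_cases h2 : e.1.2 ∈ A
    · right; simp [h1, h2, hx h1, hx h2]
    · by_cases h3 : x e.1.2 = true <;> simp [h1, h2, h3, hx h1]
    · by_cases h3 : x e.1.1 = true <;> simp [h1, h2, h3, hx h2]
    · left; simp [h1, h2]
  · intro j
    by_cases h : j ∈ A
    · right; simp [ind, h, mem_community.1 (hA h)]
    · left; simp [ind, h]

include hE hS in
-- Chernoff at parameter `1`: the statistic is a log-likelihood ratio whose exponential has mean
-- one, so no divergence enters.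
lemma le_blockStat {A S : Finset (Fin n)} (hA : Disjoint A (community x)) (hSC : S ⊆ community x)
    (b : ℝ) :
    (obsLaw n M p q V U x).real {ω | b ≤ blockStat p q V U A S ω} ≤ Real.exp (-b) := by
  have h := measure_ge_le_exp_cgf (μ := obsLaw n M p q V U x) b
    zero_le_one
    (integrable_exp_stat (M := M) x hE hS (fun e => pairWeight (ind A) (ind A) e / 2
      + pairWeight (ind A) (ind S) e) (ind A) _)
  refine h.trans (Real.exp_le_exp.2 ?_)
  have hx : ∀ {k}, k ∈ A → x k ≠ true := fun hk h' =>
    Finset.disjoint_left.1 hA hk (mem_community.2 h')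
  rw [cgf_stat_unit x hE hS (r := q) (ρ := U)]
  · simp [hE.cgf_one, hS.cgf_one]
  · intro e
    have hAS : ∀ {k}, k ∈ A → k ∉ S := fun hk h' => Finset.disjoint_left.1 hA hk (hSC h')
    simp only [pairWeight, ind]
    by_cases h1 : e.1.1 ∈ A <;> by_cases h2 : e.1.2 ∈ A
    · right; simp [h1, h2, hx h1, hAS h1, hAS h2]
    · by_cases h3 : e.1.2 ∈ S <;> simp [h1, h2, h3, hx h1]
    · by_cases h3 : e.1.1 ∈ S <;> simp [h1, h2, h3, hx h2]
    · left; simp [h1, h2]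
  · intro j
    by_cases h : j ∈ A
    · right; simp [ind, h, hx h]
    · left; simp [ind, h]

include hE hS in
-- The weights are `0` or `±1`, with at most `2ℓ²` nonzero ones; each such pair costs at most one
-- multiple of the divergence, whatever its sign and its law.
lemma le_innerStat {A A' : Finset (Fin n)} (hAA' : Disjoint A A') {ℓ : ℕ} (hA : A.card = ℓ)
    (hA' : A'.card = ℓ) {s : ℝ} (hs : 0 ≤ s) (b : ℝ) :
    (obsLaw n M p q V U x).real {ω | b ≤ innerStat p q V U A A' ω}
      ≤ Real.exp (-s * b + 2 * (ℓ : ℝ) ^ 2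
        * (LLRBound.cgfConst (s + 1) B * klReal (edgeLaw p) (edgeLaw q))) := by
  set w : Pairs n → ℝ := fun e => pairWeight (ind A) (ind A) e / 2
    - pairWeight (ind A) (ind A') e + pairWeight (ind A') (ind A') e / 2 with hw
  have h := measure_ge_le_exp_cgf (μ := obsLaw n M p q V U x) b hs
    (integrable_exp_stat (M := M) x hE hS w 0 _)
  refine h.trans (Real.exp_le_exp.2 ?_)
  rw [cgf_stat x hE hS]
  set c := LLRBound.cgfConst (s + 1) B * klReal (edgeLaw p) (edgeLaw q) with hc
  have hc0 : 0 ≤ c :=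
    mul_nonneg (LLRBound.cgfConst_nonneg (by linarith)) LLRBound.klReal_nonneg
  have hcgf : ∀ (P : Prop) [Decidable P] (t : ℝ), |t| ≤ s →
      cgf (llr (edgeLaw p) (edgeLaw q)) (edgeLaw (if P then p else q)) t ≤ c := by
    intro P _ t ht
    split_ifs
    · exact hE.cgf_left_le ht
    · exact hE.cgf_le (ht.trans (by linarith))
  have key : ∀ e : Pairs n, cgf (llr (edgeLaw p) (edgeLaw q))
      (edgeLaw (if x e.1.1 = true ∧ x e.1.2 = true then p else q)) (w e * s)
      ≤ (pairWeight (ind A) (ind A) e / 2 + pairWeight (ind A) (ind A') e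
        + pairWeight (ind A') (ind A') e / 2) * c := by
    intro e
    have hd : ∀ {k}, k ∈ A → k ∉ A' := fun hk => Finset.disjoint_left.1 hAA' hk
    have hcases : (w e = 0 ∧ pairWeight (ind A) (ind A) e / 2 + pairWeight (ind A) (ind A') e
        + pairWeight (ind A') (ind A') e / 2 = 0) ∨ (|w e| = 1 ∧ pairWeight (ind A) (ind A) e / 2
        + pairWeight (ind A) (ind A') e + pairWeight (ind A') (ind A') e / 2 = 1) := by
      simp only [hw, pairWeight, ind]
      by_cases h1 : e.1.1 ∈ A <;> by_cases h2 : e.1.2 ∈ A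
      · simp [h1, h2, hd h1, hd h2]
      · by_cases h3 : e.1.2 ∈ A' <;> simp [h1, h2, h3, hd h1]
      · by_cases h3 : e.1.1 ∈ A' <;> simp [h1, h2, h3, hd h2]
      · by_cases h3 : e.1.1 ∈ A' <;> by_cases h4 : e.1.2 ∈ A' <;> simp [h1, h2, h3, h4]
    rcases hcases with ⟨h1, h2⟩ | ⟨h1, h2⟩
    · rw [h1, h2]; simp
    · rw [h2, one_mul]
      refine hcgf _ _ ?_
      rw [abs_mul, h1, one_mul, abs_of_nonneg hs]
  have hsum := Finset.sum_le_sum fun e (_ : e ∈ Finset.univ) => key e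
  rw [← Finset.sum_mul, Finset.sum_add_distrib, Finset.sum_add_distrib, ← Finset.sum_div,
    ← Finset.sum_div, sum_pairWeight_ind, sum_pairWeight_ind, sum_pairWeight_ind,
    Finset.inter_self, Finset.inter_self, Finset.disjoint_iff_inter_eq_empty.1 hAA', hA, hA'] at hsum
  simp only [Pi.zero_apply, zero_mul, cgf_zero, mul_zero, Finset.sum_const_zero, add_zero]
  have h3 : (((ℓ : ℝ) * ℓ - ℓ) / 2 + (ℓ * ℓ - ((∅ : Finset (Fin n)).card : ℝ))
      + (ℓ * ℓ - ℓ) / 2) * c ≤ 2 * (ℓ : ℝ) ^ 2 * c := by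
    refine mul_le_mul_of_nonneg_right ?_ hc0
    have : (0 : ℝ) ≤ ℓ := Nat.cast_nonneg _
    simp only [Finset.card_empty, Nat.cast_zero]
    nlinarith
  linarith

end Bounds

/-! ### The error probability of the maximum likelihood estimator -/

/-- Combine `N.choose k ≤ N ^ k / k!` with `k ^ k / k! ≤ exp k`. -/
lemma choose_le_exp {N k : ℕ} {r : ℝ} (hr : 0 < r) (hN : (N : ℝ) ≤ r * k) :
    (N.choose k : ℝ) ≤ Real.exp (k * (1 + Real.log r)) := by
  have h1 : (N.choose k : ℝ) ≤ (N : ℝ) ^ k / k.factorial := Nat.choose_le_pow_div k N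
  have h2 := Real.pow_div_factorial_le_exp (k : ℝ) (Nat.cast_nonneg k) k
  have h3 : Real.exp (k * (1 + Real.log r)) = r ^ k * Real.exp k := by
    rw [mul_add, Real.exp_add, mul_one, Real.exp_nat_mul, Real.exp_log hr, mul_comm]
  rw [h3]
  calc (N.choose k : ℝ) ≤ (N : ℝ) ^ k / k.factorial := h1
    _ ≤ (r * k) ^ k / k.factorial := by gcongr
    _ = r ^ k * ((k : ℝ) ^ k / k.factorial) := by rw [mul_pow]; ring
    _ ≤ _ := by gcongr

lemma sum_Icc_pow_le {r : ℝ} (h0 : 0 ≤ r) (h1 : r ≤ 1 / 2) (K : ℕ) :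
    ∑ k ∈ Finset.Icc 1 K, r ^ k ≤ 2 * r := by
  have h : ∀ K : ℕ, ∑ k ∈ Finset.Icc 1 K, r ^ k ≤ 2 * r - 2 * r ^ (K + 1) := by
    intro K
    induction K with
    | zero => simp
    | succ K ih =>
      rw [Finset.sum_Icc_succ_top (by omega)]
      have : r ^ (K + 1 + 1) ≤ r ^ (K + 1) * (1 / 2) := by
        rw [pow_succ]; gcongr
      linarith
  exact (h K).trans (by linarith [pow_nonneg h0 (K + 1)])

section Sufficiency

variable {𝒴 : Type*} [MeasurableSpace 𝒴] {n M K : ℕ} {p q : I} {V U : Measure 𝒴}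
  [IsProbabilityMeasure V] [IsProbabilityMeasure U] {B : ℝ}

lemma exp_neg_mul_nat (R : ℝ) (k : ℕ) : Real.exp (-R) ^ k = Real.exp (-(R * k)) := by
  rw [← Real.exp_nat_mul]; ring_nf

variable (x : Labels n) (hE : LLRBound (edgeLaw p) (edgeLaw q) B) (hS : LLRBound V U B)

include hE hS in
/-- All nodes are well separated by their statistics. -/
lemma measureReal_nodes_le (hcard : (community x).card = K) (hK : 0 < K) {θ m R : ℝ}
    (hθ : θ = Real.log (n / K)) (hm : 0 ≤ m)
    (h : Real.log n + m - exponentQU p q V U θ K M + 1 + B ≤ -R) :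
    (obsLaw n M p q V U x).real ((⋃ i ∈ community x,
        {ω | nodeStat p q V U (community x) i ω ≤ θ + m}) ∪
      ⋃ i ∈ (community x)ᶜ, {ω | θ - m ≤ nodeStat p q V U (community x) i ω})
      ≤ 2 * Real.exp (-R) := by
  have hB := hE.nonneg
  have hKn : K ≤ n := by rw [← hcard]; exact (Finset.card_le_univ _).trans_eq (by simp)
  have hK' : (0 : ℝ) < K := by exact_mod_cast hK
  have hn' : (0 : ℝ) < n := by exact_mod_cast hK.trans_le hKn
  obtain ⟨t, ht, hlt⟩ := exists_exponentQU_lt p q V U θ K M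
  -- This identity balances the two union bounds: `K` members failing at rate `E - θ` and at most
  -- `n` outsiders failing at rate `E`.
  have hθ' : Real.log K + θ = Real.log n := by
    rw [hθ, Real.log_div hn'.ne' hK'.ne']; ring
  have h1 : (obsLaw n M p q V U x).real (⋃ i ∈ community x,
      {ω | nodeStat p q V U (community x) i ω ≤ θ + m}) ≤ Real.exp (-R) := by
    refine (measureReal_biUnion_finset_le _ _).trans ?_
    refine (Finset.sum_le_card_nsmul _ _ _ fun i hi =>
      nodeStat_le_of_mem x hE hS hi ht.1 ht.2 _).trans ?_
    rw [nsmul_eq_mul, hcard, ← Real.exp_log hK', ← Real.exp_add, Real.exp_log hK']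
    refine Real.exp_le_exp.2 ?_
    have : t * m ≥ 0 := mul_nonneg ht.1 hm
    nlinarith
  have h2 : (obsLaw n M p q V U x).real (⋃ i ∈ (community x)ᶜ,
      {ω | θ - m ≤ nodeStat p q V U (community x) i ω}) ≤ Real.exp (-R) := by
    refine (measureReal_biUnion_finset_le _ _).trans ?_
    refine (Finset.sum_le_card_nsmul _ _ _ fun i hi =>
      le_nodeStat_of_notMem x hE hS (Finset.mem_compl.1 hi) ht.1 _).trans ?_
    have hc : (((community x)ᶜ.card : ℕ) : ℝ) ≤ n := by
      exact_mod_cast (Finset.card_le_univ _).trans_eq (by simp)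
    rw [nsmul_eq_mul, hcard]
    calc _ ≤ (n : ℝ) * Real.exp (-t * (θ - m) + psiQU p q V U t K M) := by gcongr
      _ = Real.exp (Real.log n + (-t * (θ - m) + psiQU p q V U t K M)) := by
        rw [Real.exp_add (Real.log n), Real.exp_log hn']
      _ ≤ _ := by
        refine Real.exp_le_exp.2 ?_
        have : t * m ≤ m := mul_le_of_le_one_left hm ht.2
        nlinarith
  exact (measureReal_union_le _ _).trans (by linarith)

include hE hS in
-- The union bound costs `2ℓ log n`. As `ℓ ≤ εK`, the quadratic Chernoff term is at most `ℓ` times a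
-- multiple of `ε K D`; a large `s` then beats the entropy and a small `ε` tames the divergence.
lemma measureReal_inner_le (hcard : (community x).card = K) {m s ε R : ℝ} {ℓ : ℕ}
    (hℓ : 0 < ℓ) (hℓK : ℓ ≤ K) (hℓε : (ℓ : ℝ) ≤ ε * K) (hs : 0 ≤ s)
    (h : 2 * Real.log n - 2 * s * m
      + 2 * LLRBound.cgfConst (s + 1) B * ε * (K * klReal (edgeLaw p) (edgeLaw q)) ≤ -R) :
    (obsLaw n M p q V U x).real (⋃ A ∈ (community x).powersetCard ℓ,
      ⋃ A' ∈ (community x)ᶜ.powersetCard ℓ, {ω | 2 * ℓ * m ≤ innerStat p q V U A A' ω})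
      ≤ Real.exp (-R) ^ ℓ := by
  have hKn : K ≤ n := by rw [← hcard]; exact (Finset.card_le_univ _).trans_eq (by simp)
  have hn' : (0 : ℝ) < n := by exact_mod_cast (hℓ.trans_le hℓK).trans_le hKn
  set c := LLRBound.cgfConst (s + 1) B * klReal (edgeLaw p) (edgeLaw q) with hc
  have hc0 : 0 ≤ c :=
    mul_nonneg (LLRBound.cgfConst_nonneg (by linarith)) LLRBound.klReal_nonneg
  have h1 : ∀ A ∈ (community x).powersetCard ℓ, (obsLaw n M p q V U x).real
      (⋃ A' ∈ (community x)ᶜ.powersetCard ℓ, {ω | 2 * ℓ * m ≤ innerStat p q V U A A' ω})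
      ≤ (n : ℝ) ^ ℓ * Real.exp (-s * (2 * ℓ * m) + 2 * (ℓ : ℝ) ^ 2 * c) := by
    intro A hA
    rw [Finset.mem_powersetCard] at hA
    refine (measureReal_biUnion_finset_le _ _).trans ?_
    refine (Finset.sum_le_card_nsmul _ _ (Real.exp (-s * (2 * ℓ * m) + 2 * (ℓ : ℝ) ^ 2 * c))
      fun A' hA' => ?_).trans ?_
    · rw [Finset.mem_powersetCard] at hA'
      have hd : Disjoint A A' := Finset.disjoint_left.2 fun k hk hk' =>
        (Finset.mem_compl.1 (hA'.1 hk')) (hA.1 hk)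
      exact le_innerStat x hE hS hd hA.2 hA'.2 hs _
    · rw [nsmul_eq_mul, Finset.card_powersetCard]
      gcongr
      have : (((community x)ᶜ.card.choose ℓ : ℕ) : ℝ) ≤ ((n ^ ℓ : ℕ) : ℝ) := by
        refine Nat.cast_le.2 ((Nat.choose_le_pow _ _).trans (Nat.pow_le_pow_left ?_ ℓ))
        exact (Finset.card_le_univ _).trans_eq (by simp)
      simpa using this
  refine (measureReal_biUnion_finset_le _ _).trans ?_
  refine (Finset.sum_le_card_nsmul _ _ _ h1).trans ?_
  rw [nsmul_eq_mul, Finset.card_powersetCard, hcard]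
  have h2 : ((K.choose ℓ : ℕ) : ℝ) ≤ (n : ℝ) ^ ℓ := by
    have : ((K.choose ℓ : ℕ) : ℝ) ≤ ((n ^ ℓ : ℕ) : ℝ) :=
      Nat.cast_le.2 ((Nat.choose_le_pow _ _).trans (Nat.pow_le_pow_left hKn ℓ))
    simpa using this
  have h3 : (n : ℝ) ^ ℓ = Real.exp (ℓ * Real.log n) := by
    rw [Real.exp_nat_mul, Real.exp_log hn']
  calc _ ≤ (n : ℝ) ^ ℓ * ((n : ℝ) ^ ℓ * Real.exp (-s * (2 * ℓ * m) + 2 * (ℓ : ℝ) ^ 2 * c)) := by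
        gcongr
    _ = Real.exp (ℓ * Real.log n + (ℓ * Real.log n
          + (-s * (2 * ℓ * m) + 2 * (ℓ : ℝ) ^ 2 * c))) := by
        rw [h3, ← Real.exp_add, ← Real.exp_add]
    _ ≤ _ := by
        rw [exp_neg_mul_nat]
        refine Real.exp_le_exp.2 ?_
        have h4 : (0 : ℝ) < ℓ := by exact_mod_cast hℓ
        have h5 : (ℓ : ℝ) * c ≤ ε * K * c := by gcongr
        have h6 : 2 * Real.log n - 2 * s * m + 2 * (ℓ * c) ≤ -R := by
          have : 2 * LLRBound.cgfConst (s + 1) B * ε * (K * klReal (edgeLaw p) (edgeLaw q))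
            = 2 * (ε * K * c) := by rw [hc]; ring
          linarith
        have := mul_le_mul_of_nonneg_left h6 h4.le
        nlinarith

include hE hS in
-- For `ℓ ≥ εK` the entropy per exchanged node is constant for the choice of `A` and `θ` plus a
-- constant for `A'`. The level `(1 - η) w` per node separates the typical removed blocks from all
-- inserted ones.
lemma measureReal_block_le (hcard : (community x).card = K) {θ ε η t R w : ℝ} {ℓ : ℕ}
    (hθ : θ = Real.log (n / K))
    (hw : w = (K - 1) * klReal (edgeLaw p) (edgeLaw q) / 2 + M * klReal V U)
    (hℓ : 0 < ℓ) (hℓK : ℓ ≤ K) (hε : 0 < ε) (hℓε : ε * K ≤ ℓ) (h0 : 0 ≤ t) (h1 : t ≤ 1)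
    (ht : -t + 4 * Real.exp (4 * B) * t ^ 2 ≤ 0)
    (hP : 1 + Real.log (1 / ε) - (t * η - 4 * Real.exp (4 * B) * t ^ 2) * w ≤ -R)
    (hQ : 2 * (1 + Real.log (1 / ε)) + θ - (1 - η) * w ≤ -R) :
    (obsLaw n M p q V U x).real ((⋃ A ∈ (community x).powersetCard ℓ,
        {ω | blockStat p q V U A (community x \ A) ω ≤ ℓ * ((1 - η) * w)}) ∪
      ⋃ A ∈ (community x).powersetCard ℓ, ⋃ A' ∈ (community x)ᶜ.powersetCard ℓ,
        {ω | ℓ * ((1 - η) * w) ≤ blockStat p q V U A' (community x \ A) ω})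
      ≤ 2 * Real.exp (-R) ^ ℓ := by
  have hKn : K ≤ n := by rw [← hcard]; exact (Finset.card_le_univ _).trans_eq (by simp)
  have hK' : (0 : ℝ) < K := by exact_mod_cast hℓ.trans_le hℓK
  have hn' : (0 : ℝ) < n := by exact_mod_cast (hℓ.trans_le hℓK).trans_le hKn
  have hℓ' : (0 : ℝ) < ℓ := by exact_mod_cast hℓ
  have hℓK' : (ℓ : ℝ) ≤ K := by exact_mod_cast hℓK
  have cK : ((K.choose ℓ : ℕ) : ℝ) ≤ Real.exp (ℓ * (1 + Real.log (1 / ε))) := by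
    refine choose_le_exp (by positivity) ?_
    rw [one_div, ← div_eq_inv_mul, le_div_iff₀ hε]; linarith
  have cn : ((n.choose ℓ : ℕ) : ℝ) ≤ Real.exp (ℓ * (1 + Real.log (1 / ε) + θ)) := by
    have : 1 + Real.log (1 / ε) + θ = 1 + Real.log (1 / ε * (n / K)) := by
      rw [Real.log_mul (by positivity) (by positivity), hθ]; ring
    rw [this]
    refine choose_le_exp (by positivity) ?_
    rw [div_mul_div_comm, div_mul_eq_mul_div, le_div_iff₀ (by positivity), one_mul]
    gcongr
  have b1 : (obsLaw n M p q V U x).real (⋃ A ∈ (community x).powersetCard ℓ,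
      {ω | blockStat p q V U A (community x \ A) ω ≤ ℓ * ((1 - η) * w)})
      ≤ Real.exp (-R) ^ ℓ := by
    refine (measureReal_biUnion_finset_le _ _).trans ?_
    refine (Finset.sum_le_card_nsmul _ _ (Real.exp (t * (ℓ * ((1 - η) * w))
      + (-t + 4 * Real.exp (4 * B) * t ^ 2) * (ℓ * w))) fun A hA => ?_).trans ?_
    · rw [Finset.mem_powersetCard] at hA
      refine (blockStat_le x hE hS hA.1 h0 h1 _).trans (Real.exp_le_exp.2 ?_)
      rw [hA.2, hcard]
      have hD : 0 ≤ klReal (edgeLaw p) (edgeLaw q) := LLRBound.klReal_nonneg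
      have : ℓ * w ≤ (((ℓ : ℝ) ^ 2 - ℓ) / 2 + ℓ * (K - ℓ)) * klReal (edgeLaw p) (edgeLaw q)
          + ℓ * M * klReal V U := by
        rw [hw]
        -- The number of pairs meeting `A`, divided by `ℓ`, is smallest at `ℓ = K`, where it is `(K
        -- - 1) / 2`; hence the halved edge divergence in `w`.
        have : (ℓ : ℝ) * ((K - 1) / 2) ≤ ((ℓ : ℝ) ^ 2 - ℓ) / 2 + ℓ * (K - ℓ) := by nlinarith
        nlinarith
      have := mul_le_mul_of_nonpos_left this ht
      linarith
    · rw [nsmul_eq_mul, Finset.card_powersetCard, hcard]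
      calc _ ≤ Real.exp (ℓ * (1 + Real.log (1 / ε))) * Real.exp (t * (ℓ * ((1 - η) * w))
            + (-t + 4 * Real.exp (4 * B) * t ^ 2) * (ℓ * w)) := by gcongr
        _ ≤ _ := by
          rw [exp_neg_mul_nat, ← Real.exp_add]
          refine Real.exp_le_exp.2 ?_
          have := mul_le_mul_of_nonneg_left hP hℓ'.le
          linarith
  have b2 : (obsLaw n M p q V U x).real (⋃ A ∈ (community x).powersetCard ℓ,
      ⋃ A' ∈ (community x)ᶜ.powersetCard ℓ,
        {ω | ℓ * ((1 - η) * w) ≤ blockStat p q V U A' (community x \ A) ω})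
      ≤ Real.exp (-R) ^ ℓ := by
    refine (measureReal_biUnion_finset_le _ _).trans ?_
    refine (Finset.sum_le_card_nsmul _ _ (Real.exp (ℓ * (1 + Real.log (1 / ε) + θ))
      * Real.exp (-(ℓ * ((1 - η) * w)))) fun A hA => ?_).trans ?_
    · refine (measureReal_biUnion_finset_le _ _).trans ?_
      refine (Finset.sum_le_card_nsmul _ _ (Real.exp (-(ℓ * ((1 - η) * w))))
        fun A' hA' => ?_).trans ?_
      · rw [Finset.mem_powersetCard] at hA'
        have hd : Disjoint A' (community x) := Finset.disjoint_left.2 fun k hk hk' =>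
          (Finset.mem_compl.1 (hA'.1 hk)) hk'
        exact le_blockStat x hE hS hd Finset.sdiff_subset _
      · rw [nsmul_eq_mul, Finset.card_powersetCard]
        gcongr
        refine le_trans ?_ cn
        exact_mod_cast Nat.choose_le_choose _ ((Finset.card_le_univ _).trans_eq (by simp))
    · rw [nsmul_eq_mul, Finset.card_powersetCard, hcard]
      calc _ ≤ Real.exp (ℓ * (1 + Real.log (1 / ε)))
            * (Real.exp (ℓ * (1 + Real.log (1 / ε) + θ)) * Real.exp (-(ℓ * ((1 - η) * w)))) := by
            gcongr
        _ ≤ _ := by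
          rw [exp_neg_mul_nat, ← Real.exp_add, ← Real.exp_add]
          refine Real.exp_le_exp.2 ?_
          have := mul_le_mul_of_nonneg_left hQ hℓ'.le
          linarith
  exact (measureReal_union_le _ _).trans (by linarith)

include hE hS in
/-- The true community is the unique maximizer of the likelihood with high probability. -/
theorem measureReal_exists_score_le (hcard : (community x).card = K) (hK : 0 < K)
    {θ m s ε η t R w : ℝ} (hθ : θ = Real.log (n / K))
    (hw : w = (K - 1) * klReal (edgeLaw p) (edgeLaw q) / 2 + M * klReal V U)
    (hR : 1 ≤ R) (hm : 0 ≤ m) (hs : 0 ≤ s) (hε : 0 < ε) (h0 : 0 ≤ t) (h1 : t ≤ 1)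
    (ht : -t + 4 * Real.exp (4 * B) * t ^ 2 ≤ 0)
    (hnodes : Real.log n + m - exponentQU p q V U θ K M + 1 + B ≤ -R)
    (hinner : 2 * Real.log n - 2 * s * m
      + 2 * LLRBound.cgfConst (s + 1) B * ε * (K * klReal (edgeLaw p) (edgeLaw q)) ≤ -R)
    (hP : 1 + Real.log (1 / ε) - (t * η - 4 * Real.exp (4 * B) * t ^ 2) * w ≤ -R)
    (hQ : 2 * (1 + Real.log (1 / ε)) + θ - (1 - η) * w ≤ -R) :
    (obsLaw n M p q V U x).real {ω | ∃ x' ∈ communityLabels n K, x' ≠ x ∧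
      score p q V U (community x) ω ≤ score p q V U (community x') ω} ≤ 6 * Real.exp (-R) := by
  classical
  set C := community x with hC
  -- Few exchanges are treated through single nodes, many exchanges through whole blocks.
  set F : ℕ → Set (Obs 𝒴 n M) := fun ℓ =>
    if (ℓ : ℝ) ≤ ε * K then
      ⋃ A ∈ C.powersetCard ℓ, ⋃ A' ∈ Cᶜ.powersetCard ℓ, {ω | 2 * ℓ * m ≤ innerStat p q V U A A' ω}
    else (⋃ A ∈ C.powersetCard ℓ, {ω | blockStat p q V U A (C \ A) ω ≤ ℓ * ((1 - η) * w)}) ∪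
      ⋃ A ∈ C.powersetCard ℓ, ⋃ A' ∈ Cᶜ.powersetCard ℓ,
        {ω | ℓ * ((1 - η) * w) ≤ blockStat p q V U A' (C \ A) ω} with hF
  have hsub : {ω | ∃ x' ∈ communityLabels n K, x' ≠ x ∧
      score p q V U C ω ≤ score p q V U (community x') ω} ⊆
      ((⋃ i ∈ C, {ω | nodeStat p q V U C i ω ≤ θ + m}) ∪
      ⋃ i ∈ Cᶜ, {ω | θ - m ≤ nodeStat p q V U C i ω}) ∪ ⋃ ℓ ∈ Finset.Icc 1 K, F ℓ := by
    rintro ω ⟨x', hx', hne, hle⟩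
    by_contra hcon
    simp only [Set.mem_union, Set.mem_iUnion, Set.mem_ofPred_eq, not_or, not_exists, not_le]
      at hcon
    obtain ⟨⟨hc1, hc2⟩, hc3⟩ := hcon
    rw [mem_communityLabels] at hx'
    set C' := community x' with hC'
    have hCne : C' ≠ C := fun h => hne (community_injective h)
    have hcd : (C' \ C).card = (C \ C').card := by
      have e1 := Finset.card_sdiff_add_card_inter C' C
      have e2 := Finset.card_sdiff_add_card_inter C C'
      rw [Finset.inter_comm] at e1
      omega
    set ℓ := (C \ C').card with hℓ
    have hpos : 0 < ℓ := by
      rw [hℓ, Finset.card_pos, Finset.sdiff_nonempty]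
      intro h
      exact hCne (Finset.eq_of_subset_of_card_le h (by rw [hx', hcard])).symm
    have hA : C \ C' ∈ C.powersetCard ℓ := Finset.mem_powersetCard.2 ⟨Finset.sdiff_subset, rfl⟩
    have hA' : C' \ C ∈ Cᶜ.powersetCard ℓ := Finset.mem_powersetCard.2
      ⟨fun k hk => Finset.mem_compl.2 (Finset.mem_sdiff.1 hk).2, hcd⟩
    have hℓK : ℓ ≤ K := by rw [← hcard]; exact Finset.card_le_card Finset.sdiff_subset
    have hnF := hc3 ℓ (Finset.mem_Icc.2 ⟨hpos, hℓK⟩)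
    have hinter : C \ (C \ C') = C ∩ C' := Finset.sdiff_sdiff_self_left C C'
    simp only [hF] at hnF
    split_ifs at hnF with hsmall
    · simp only [Set.mem_iUnion, Set.mem_ofPred_eq, not_exists, not_le] at hnF
      have i1 := hnF _ hA _ hA'
      have i2 := score_sub_score' (p := p) (q := q) (V := V) (U := U) C C' ω
      have i3 : ℓ * (θ + m) ≤ ∑ i ∈ C \ C', nodeStat p q V U C i ω := by
        have := Finset.card_nsmul_le_sum (C \ C') (fun i => nodeStat p q V U C i ω) (θ + m)
          fun i hi => (hc1 i (Finset.mem_sdiff.1 hi).1).le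
        rwa [nsmul_eq_mul] at this
      have i4 : ∑ i ∈ C' \ C, nodeStat p q V U C i ω ≤ ℓ * (θ - m) := by
        have := Finset.sum_le_card_nsmul (C' \ C) (fun i => nodeStat p q V U C i ω) (θ - m)
          fun i hi => (hc2 i (Finset.mem_compl.2 (Finset.mem_sdiff.1 hi).2)).le
        rwa [nsmul_eq_mul, hcd] at this
      linarith
    · simp only [Set.mem_union, Set.mem_iUnion, Set.mem_ofPred_eq, not_or, not_exists,
        not_le] at hnF
      have i1 := hnF.1 _ hA
      have i2 := hnF.2 _ hA _ hA'
      rw [hinter] at i1 i2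
      have i3 := score_sub_score (p := p) (q := q) (V := V) (U := U) C C' ω
      linarith
  -- The geometric series over `ℓ` is then at most twice its first term: `4 exp (-R)` from the sets
  -- `F ℓ` and `2 exp (-R)` from the nodes.
  have hr : Real.exp (-R) ≤ 1 / 2 := by
    have h2 : (2 : ℝ) ≤ Real.exp R := by linarith [Real.add_one_le_exp R]
    rw [Real.exp_neg, one_div]
    exact inv_anti₀ two_pos h2
  have hFb : ∀ ℓ ∈ Finset.Icc 1 K,
      (obsLaw n M p q V U x).real (F ℓ) ≤ 2 * Real.exp (-R) ^ ℓ := by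
    intro ℓ hℓ
    rw [Finset.mem_Icc] at hℓ
    have hp : 0 ≤ Real.exp (-R) ^ ℓ := by positivity
    simp only [hF]
    split_ifs with hsmall
    · have := measureReal_inner_le (M := M) (m := m) x hE hS hcard hℓ.1 hℓ.2 hsmall hs hinner
      linarith
    · exact measureReal_block_le x hE hS hcard hθ hw hℓ.1 hℓ.2 hε (not_le.1 hsmall).le h0 h1 ht
        hP hQ
  have hsum : (obsLaw n M p q V U x).real (⋃ ℓ ∈ Finset.Icc 1 K, F ℓ) ≤ 4 * Real.exp (-R) := by
    refine (measureReal_biUnion_finset_le _ _).trans ((Finset.sum_le_sum hFb).trans ?_)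
    rw [← Finset.mul_sum]
    linarith [sum_Icc_pow_le (Real.exp_pos (-R)).le hr K]
  have hn := measureReal_nodes_le (M := M) x hE hS hcard hK hθ hm hnodes
  exact (measureReal_mono hsub).trans ((measureReal_union_le _ _).trans (by linarith))

end Sufficiency

/-! ### Failure of exact recovery below the threshold -/

section Necessity

variable {𝒴 : Type*} [MeasurableSpace 𝒴] {n M K : ℕ} {p q : I} {V U : Measure 𝒴}
  [IsProbabilityMeasure V] [IsProbabilityMeasure U] {B : ℝ}

/-- A lower bound for a variable whose cumulant generating function is a shift of that of
a sum of log-likelihood ratios. -/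
lemma exists_exp_le_of_cgf_eq (hE : LLRBound (edgeLaw p) (edgeLaw q) B) (hS : LLRBound V U B)
    {Ω : Type*} [MeasurableSpace Ω] {μ : Measure Ω} [IsProbabilityMeasure μ] {X : Ω → ℝ}
    (hX : Measurable X) (hint : ∀ t, Integrable (fun ω => Real.exp (t * X ω)) μ)
    {N m δ y r : ℝ} (hN : 0 ≤ N) (hm : 0 ≤ m)
    (hcgf : cgf X μ = fun t => psiQU p q V U (t + δ) N m) (hy0 : 0 ≤ y)
    (hy1 : y ≤ N * klReal (edgeLaw p) (edgeLaw q) + m * klReal V U) (hr : 0 < r)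
    (hvr : 2 * (4 * Real.exp (4 * B) * (N * klReal (edgeLaw p) (edgeLaw q) + m * klReal V U))
      ≤ r ^ 2) :
    ∃ t ∈ Set.Icc (0 : ℝ) 1,
      Real.exp (psiQU p q V U t N m - (t - δ) * y - |t - δ| * r) / 2
        ≤ μ.real {ω | |X ω - y| ≤ r} := by
  set f : ℝ → ℝ := fun t => psiQU p q V U t N m with hf
  have c1 := hE.contDiff_cgf
  have c2 := hS.contDiff_cgf
  have hd : ∀ t, deriv f t = N * deriv (cgf (llr (edgeLaw p) (edgeLaw q)) (edgeLaw q)) t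
      + m * deriv (cgf (llr V U) U) t := by
    intro t
    have d1 := (c1.differentiable two_ne_zero t).hasDerivAt.const_mul N
    have d2 := (c2.differentiable two_ne_zero t).hasDerivAt.const_mul m
    exact (d1.add d2).deriv
  have hdd : ∀ t ∈ Set.Icc (0 : ℝ) 1, iteratedDeriv 2 f t
      ≤ 4 * Real.exp (4 * B) * (N * klReal (edgeLaw p) (edgeLaw q) + m * klReal V U) := by
    intro t ht
    have e : iteratedDeriv 2 f t
        = N * iteratedDeriv 2 (cgf (llr (edgeLaw p) (edgeLaw q)) (edgeLaw q)) t
          + m * iteratedDeriv 2 (cgf (llr V U) U) t := by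
      have : f = (fun t => N * cgf (llr (edgeLaw p) (edgeLaw q)) (edgeLaw q) t)
          + fun t => m * cgf (llr V U) U t := rfl
      rw [this, iteratedDeriv_add (contDiff_const.mul c1).contDiffAt
        (contDiff_const.mul c2).contDiffAt, iteratedDeriv_const_mul_field,
        iteratedDeriv_const_mul_field]
    rw [e]
    have a1 := mul_le_mul_of_nonneg_left (hE.iteratedDeriv_two_cgf_le ht.1 ht.2) hN
    have a2 := mul_le_mul_of_nonneg_left (hS.iteratedDeriv_two_cgf_le ht.1 ht.2) hm
    linarith
  have hcgf' : cgf X μ = fun t => f (t + δ) := hcgf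
  -- The interval `[-δ, 1 - δ]` is `[0, 1]` in the unshifted parameter; `δ` is `1` for members and
  -- `0` for outsiders.
  obtain ⟨s, hs, h⟩ := exists_exp_cgf_le_measureReal hX hint (a := -δ) (b := 1 - δ) (y := y)
    (v := 4 * Real.exp (4 * B) * (N * klReal (edgeLaw p) (edgeLaw q) + m * klReal V U)) (r := r)
    (by linarith) (by
      rw [hcgf', deriv_comp_add_const, neg_add_cancel, hd]
      have a1 := mul_nonneg hN (neg_nonneg.2 hE.deriv_cgf_zero_nonpos)
      have a2 := mul_nonneg hm (neg_nonneg.2 hS.deriv_cgf_zero_nonpos)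
      linarith) (by
      rw [hcgf', deriv_comp_add_const, sub_add_cancel, hd, hE.deriv_cgf_one, hS.deriv_cgf_one]
      exact hy1) (fun s hs => by
      rw [hcgf', iteratedDeriv_comp_add_const]
      exact hdd _ ⟨by linarith [hs.1], by linarith [hs.2]⟩) hr hvr
  refine ⟨s + δ, ⟨by linarith [hs.1], by linarith [hs.2]⟩, ?_⟩
  rw [hcgf] at h
  simpa using h

variable (x : Labels n) (hE : LLRBound (edgeLaw p) (edgeLaw q) B) (hS : LLRBound V U B)

include hE hS in
-- Tilting to mean `θ` makes the Chernoff bound sharp up to `exp (-r) / 2`. Using only the partners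
-- in `S` is harmless, since dropping pairs increases `psiQU`.
lemma exp_le_measureReal_nodeStat_of_mem {i : Fin n} (hi : i ∈ community x) {S : Finset (Fin n)}
    (hSC : S ⊆ community x) (hiS : i ∉ S) (hcard : (community x).card = K) {θ r W : ℝ}
    (hθ : 0 ≤ θ) (hW : W = K * klReal (edgeLaw p) (edgeLaw q) + M * klReal V U)
    (hθS : θ ≤ S.card * klReal (edgeLaw p) (edgeLaw q) + M * klReal V U) (hr : 0 < r)
    (hrW : 2 * (4 * Real.exp (4 * B) * W) ≤ r ^ 2) :
    Real.exp (θ - exponentQU p q V U θ K M - r) / 2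
      ≤ (obsLaw n M p q V U x).real {ω | nodeStat p q V U S i ω ≤ θ + r} := by
  have hSK : (S.card : ℝ) ≤ K := by rw [← hcard]; exact_mod_cast Finset.card_le_card hSC
  have hD : 0 ≤ klReal (edgeLaw p) (edgeLaw q) := LLRBound.klReal_nonneg
  obtain ⟨t, ht, h⟩ := exists_exp_le_of_cgf_eq (N := S.card) (m := M) (δ := 1) (y := θ) (r := r)
    hE hS (measurable_stat (M := M) (p := p) (q := q) (V := V) (U := U)
      (pairWeight (ind {i}) (ind S)) (ind {i}))
    (integrable_exp_stat x hE hS _ _) (Nat.cast_nonneg _) (Nat.cast_nonneg _) (by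
      have := cgf_nodeStat_of_mem (M := M) x hE hS hi hSC
      rw [nodeStat] at this
      rw [this, hE.cgf_left, hS.cgf_left]
      simp [psiQU, ind, hiS]) hθ hθS hr (by
      refine le_trans ?_ hrW
      rw [hW]
      gcongr)
  have hle := le_exponentQU hE hS (θ := θ) (Nat.cast_nonneg K) (Nat.cast_nonneg M) ht
  have hpsi : psiQU p q V U t K M ≤ psiQU p q V U t S.card M := by
    simp only [psiQU]
    have := mul_le_mul_of_nonpos_right hSK (hE.cgf_nonpos ht.1 ht.2)
    linarith
  refine le_trans ?_ (h.trans (measureReal_mono fun ω hω => ?_))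
  · have habs : |t - 1| * r ≤ r := by
      refine mul_le_of_le_one_left hr.le ?_
      rw [abs_le]; constructor <;> linarith [ht.1, ht.2]
    refine div_le_div_of_nonneg_right (Real.exp_le_exp.2 ?_) zero_le_two
    linarith
  · have := (abs_le.1 (show |nodeStat p q V U S i ω - θ| ≤ r from hω)).2
    show nodeStat p q V U S i ω ≤ θ + r
    linarith

include hE hS in
-- Aiming at `θ + d` instead of `θ` costs `t d ≤ d` in the exponent, because the tilt lies in `[0,
-- 1]`.
lemma exp_le_measureReal_nodeStat_of_notMem {i : Fin n} (hi : i ∉ community x)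
    (hcard : (community x).card = K) {θ d r W : ℝ} (hθ : 0 ≤ θ) (hd : 0 ≤ d)
    (hW : W = K * klReal (edgeLaw p) (edgeLaw q) + M * klReal V U)
    (hθW : θ + d ≤ W) (hr : 0 < r) (hrW : 2 * (4 * Real.exp (4 * B) * W) ≤ r ^ 2) :
    Real.exp (-exponentQU p q V U θ K M - d - r) / 2
      ≤ (obsLaw n M p q V U x).real
        {ω | θ + d - r ≤ nodeStat p q V U (community x) i ω} := by
  obtain ⟨t, ht, h⟩ := exists_exp_le_of_cgf_eq (N := K) (m := M) (δ := 0) (y := θ + d) (r := r)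
    hE hS (measurable_stat (M := M) (p := p) (q := q) (V := V) (U := U)
      (pairWeight (ind {i}) (ind (community x))) (ind {i}))
    (integrable_exp_stat x hE hS _ _) (Nat.cast_nonneg _) (Nat.cast_nonneg _) (by
      have := cgf_nodeStat_of_notMem (M := M) x hE hS hi (community x)
      rw [nodeStat] at this
      rw [this]
      simp [psiQU, ind, hi, hcard]) (by linarith) (by rw [← hW]; exact hθW) hr
      (by rw [← hW]; exact hrW)
  have hle := le_exponentQU hE hS (θ := θ) (Nat.cast_nonneg K) (Nat.cast_nonneg M) ht
  refine le_trans ?_ (h.trans (measureReal_mono fun ω hω => ?_))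
  · have habs : |t - 0| * r ≤ r := by
      refine mul_le_of_le_one_left hr.le ?_
      rw [abs_le]; constructor <;> linarith [ht.1, ht.2]
    have htd : t * d ≤ d := mul_le_of_le_one_left hd ht.2
    refine div_le_div_of_nonneg_right (Real.exp_le_exp.2 ?_) zero_le_two
    linarith
  · have := (abs_le.1
      (show |nodeStat p q V U (community x) i ω - (θ + d)| ≤ r from hω)).1
    show θ + d - r ≤ nodeStat p q V U (community x) i ω
    linarith

include hE hS in
-- A crude Chernoff bound for the part of a member's statistic that was set aside to gain
-- independence; it is small since `T` is.
lemma measureReal_le_stat_le {T : Finset (Fin n)} (hT : T ⊆ community x) {i : Fin n} (hi : i ∈ T)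
    (b : ℝ) :
    (obsLaw n M p q V U x).real {ω | b ≤ stat p q V U (pairWeight (ind {i}) (ind T)) 0 ω}
      ≤ Real.exp (-b + T.card * (LLRBound.cgfConst 2 B * klReal (edgeLaw p) (edgeLaw q))) := by
  have h := measure_ge_le_exp_cgf (μ := obsLaw n M p q V U x) b zero_le_one
    (integrable_exp_stat (M := M) x hE hS (pairWeight (ind {i}) (ind T)) 0 _)
  refine h.trans (Real.exp_le_exp.2 ?_)
  rw [cgf_stat_unit x hE hS (r := p) (ρ := V)]
  · have hc := hE.cgf_left_le (S := 1) (t := 1) (by simp)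
    have hc0 : 0 ≤ LLRBound.cgfConst 2 B * klReal (edgeLaw p) (edgeLaw q) :=
      mul_nonneg (LLRBound.cgfConst_nonneg (by norm_num)) LLRBound.klReal_nonneg
    have hT1 : (1 : ℝ) ≤ T.card := by exact_mod_cast Finset.card_pos.2 ⟨i, hi⟩
    simp only [sum_ind_mul_singleton, ind, hi, if_true, Pi.zero_apply, Finset.sum_const_zero,
      zero_mul, add_zero]
    norm_num at hc
    have := mul_le_mul_of_nonneg_left hc (by linarith : (0 : ℝ) ≤ T.card - 1)
    linarith
  · intro e
    have hne : e.1.1 ≠ e.1.2 := e.2.ne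
    have hx : ∀ {k}, k ∈ T → x k = true := fun hk => mem_community.1 (hT hk)
    have hxi := hx hi
    simp only [pairWeight, ind, Finset.mem_singleton]
    by_cases h1 : e.1.1 = i
    · have h2 : e.1.2 ≠ i := fun h => hne (h1.trans h.symm)
      by_cases h3 : e.1.2 ∈ T
      · right; simp [h1, h2, h3, hxi, hx h3]
      · left; simp [h2, h3]
    · by_cases h2 : e.1.2 = i
      · by_cases h3 : e.1.1 ∈ T
        · right; simp [h1, h2, h3, hxi, hx h3]
        · left; simp [h1, h3]
      · left; simp [h1, h2]
  · intro j; left; rfl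

lemma pairWeight_ind_ne_zero {A S : Finset (Fin n)} {e : Pairs n}
    (h : pairWeight (ind A) (ind S) e ≠ 0) :
    (e.1.1 ∈ A ∧ e.1.2 ∈ S) ∨ (e.1.2 ∈ A ∧ e.1.1 ∈ S) := by
  by_contra hc
  refine h ?_
  simp only [pairWeight, ind]
  by_cases h1 : e.1.1 ∈ A <;> by_cases h2 : e.1.2 ∈ A <;> by_cases h3 : e.1.1 ∈ S <;>
    by_cases h4 : e.1.2 ∈ S <;> simp_all

/-- The entries on which the statistic with weights `w` and `u` depends. -/
def coeffSupport (M : ℕ) (w : Pairs n → ℝ) (u : Fin n → ℝ) : Set (Pairs n ⊕ (Fin n × Fin M)) :=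
  {k | coeff M w u k ≠ 0}

lemma measurable_blockSigma_stat (w : Pairs n → ℝ) (u : Fin n → ℝ) :
    Measurable[blockSigma (entryLLR n M p q V U) (coeffSupport M w u)]
      (stat (M := M) p q V U w u) := by
  have e : stat (M := M) p q V U w u
      = fun ω => ∑ k, coeff M w u k * entryLLR n M p q V U k ω := funext (stat_eq_sum w u)
  rw [e]
  exact measurable_blockSigma_linear fun k hk => not_not.1 hk

/-- The only pair the two statistics could share is `{i, j}`, and the one of `j` would use it only
if `i ∈ S`. -/
lemma disjoint_coeffSupport_nodeStat {i j : Fin n} (hij : i ≠ j) {S : Finset (Fin n)}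
    (hi : i ∉ S) :
    Disjoint (coeffSupport M (pairWeight (ind {i}) (ind S)) (ind {i}))
      (coeffSupport M (pairWeight (ind {j}) (ind S)) (ind {j})) := by
  refine Set.disjoint_left.2 ?_
  rintro (e | ⟨k, m⟩) h1 h2
  · have h1' := pairWeight_ind_ne_zero h1
    have h2' := pairWeight_ind_ne_zero h2
    simp only [Finset.mem_singleton] at h1' h2'
    rcases h1' with ⟨a, b⟩ | ⟨a, b⟩ <;> rcases h2' with ⟨c, d⟩ | ⟨c, d⟩
    · exact hij (a.symm.trans c)
    · exact hi (a ▸ d)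
    · exact hi (a ▸ d)
    · exact hij (a.symm.trans c)
  · have h1' : ind {i} k ≠ 0 := h1
    have h2' : ind {j} k ≠ 0 := h2
    simp only [ind, Finset.mem_singleton, ne_eq, ite_eq_right_iff, one_ne_zero, imp_false,
      not_not] at h1' h2'
    exact hij (h1'.symm.trans h2')

lemma disjoint_coeffSupport_of_subset {i j : Fin n} {S T : Finset (Fin n)} (hST : Disjoint S T)
    (hj : j ∈ T) :
    Disjoint (coeffSupport M (pairWeight (ind {i}) (ind S)) (ind {i}))
      (coeffSupport M (pairWeight (ind {j}) (ind T)) 0) := by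
  refine Set.disjoint_left.2 ?_
  rintro (e | ⟨k, m⟩) h1 h2
  · have h1' := pairWeight_ind_ne_zero h1
    have h2' := pairWeight_ind_ne_zero h2
    have hd : ∀ {k}, k ∈ S → k ∉ T := fun hk => Finset.disjoint_left.1 hST hk
    simp only [Finset.mem_singleton] at h1' h2'
    rcases h1' with ⟨a, b⟩ | ⟨a, b⟩ <;> rcases h2' with ⟨c, d⟩ | ⟨c, d⟩
    · exact hd b d
    · exact hd b (c ▸ hj)
    · exact hd b (c ▸ hj)
    · exact hd b d
  · exact h2 rfl

/-- When two single nodes are exchanged, the correction involves just the pair they form. -/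
lemma abs_innerStat_singleton_le {i j : Fin n} (hij : i ≠ j) {ω : Obs 𝒴 n M}
    (hω : ∀ e, |llr (edgeLaw p) (edgeLaw q) (ω.1 e)| ≤ B) :
    |innerStat p q V U {i} {j} ω| ≤ B := by
  have hself : ∀ (k : Fin n) (e : Pairs n), pairWeight (ind {k}) (ind {k}) e = 0 := by
    intro k e
    by_contra h
    have hne : e.1.1 ≠ e.1.2 := e.2.ne
    have := pairWeight_ind_ne_zero h
    simp only [Finset.mem_singleton] at this
    rcases this with ⟨a, b⟩ | ⟨a, b⟩
    · exact hne (a.trans b.symm)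
    · exact hne (b.trans a.symm)
  have hnn : ∀ e, 0 ≤ pairWeight (ind {i}) (ind {j}) e := fun e => by
    unfold pairWeight ind; positivity
  have hsum : ∑ e, pairWeight (ind {i}) (ind {j}) e = 1 := by
    rw [sum_pairWeight_ind]
    simp [Finset.singleton_inter_of_notMem, hij]
  have e1 : innerStat p q V U {i} {j} ω
      = -∑ e, pairWeight (ind {i}) (ind {j}) e * llr (edgeLaw p) (edgeLaw q) (ω.1 e) := by
    simp [innerStat, stat, hself]
  rw [e1, abs_neg]
  calc _ ≤ ∑ e, |pairWeight (ind {i}) (ind {j}) e * llr (edgeLaw p) (edgeLaw q) (ω.1 e)| :=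
        Finset.abs_sum_le_sum_abs _ _
    _ ≤ ∑ e, pairWeight (ind {i}) (ind {j}) e * B := by
        refine Finset.sum_le_sum fun e _ => ?_
        rw [abs_mul, abs_of_nonneg (hnn e)]
        exact mul_le_mul_of_nonneg_left (hω e) (hnn e)
    _ = B := by rw [← Finset.sum_mul, hsum, one_mul]

lemma exists_community_eq_insert_erase (x : Labels n) {i j : Fin n} :
    ∃ x' : Labels n, community x' = insert j ((community x).erase i) := by
  refine ⟨fun k => decide (k ∈ insert j ((community x).erase i)), ?_⟩
  ext k
  rw [mem_community, decide_eq_true_iff]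

include hE hS in
/-- Below the threshold some exchange of two nodes increases the likelihood considerably. -/
theorem measureReal_compl_exists_score_le (hcard : (community x).card = K) {θ η W : ℝ}
    {T : Finset (Fin n)} (hT : T ⊆ community x) (hθ : 0 ≤ θ)
    (hW : W = K * klReal (edgeLaw p) (edgeLaw q) + M * klReal V U) (hηW : 0 < η * W)
    (hθW : θ + 5 * (η * W) ≤ W)
    (hθT : θ ≤ ((community x \ T).card : ℝ) * klReal (edgeLaw p) (edgeLaw q) + M * klReal V U)
    (hvar : 2 * (4 * Real.exp (4 * B) * W) ≤ (η * W) ^ 2)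
    (hTD : T.card * (LLRBound.cgfConst 2 B * klReal (edgeLaw p) (edgeLaw q)) ≤ η * W / 2)
    (hBW : B ≤ η * W) :
    (obsLaw n M p q V U x).real {ω | ∃ x' ∈ communityLabels n K,
        score p q V U (community x) ω + η * W ≤ score p q V U (community x') ω}ᶜ
      ≤ Real.exp (-(T.card * (Real.exp (θ - exponentQU p q V U θ K M - η * W) / 2)))
        + Real.exp (-(η * W / 2))
        + Real.exp (-(((community x)ᶜ.card : ℝ)
          * (Real.exp (-exponentQU p q V U θ K M - 6 * (η * W)) / 2))) := by
  classical
  set C := community x with hC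
  set r := η * W with hr
  set P := obsLaw n M p q V U x with hP
  -- Restricting to partners in `C \ T` makes these events independent over `T`; the pairs inside
  -- `T` are left to `D`.
  set A : Fin n → Set (Obs 𝒴 n M) := fun i => {ω | nodeStat p q V U (C \ T) i ω ≤ θ + r} with hA
  set D : Fin n → Set (Obs 𝒴 n M) := fun i =>
    {ω | r ≤ stat p q V U (pairWeight (ind {i}) (ind T)) 0 ω} with hD
  -- Budget of the exchange: the member is below `θ + 2r`, the outsider at least `θ + 4r`, and the
  -- pair they form costs at most `B ≤ r`; a gain of `r` remains.
  set A' : Fin n → Set (Obs 𝒴 n M) := fun j =>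
    {ω | θ + 5 * r - r ≤ nodeStat p q V U C j ω} with hA'
  have hind := iIndepFun_entryLLR (M := M) (p := p) (q := q) (V := V) (U := U) x
  have hmeas : ∀ k, Measurable (entryLLR n M p q V U k) := measurable_entryLLR
  have mA : ∀ i, MeasurableSet[blockSigma (entryLLR n M p q V U)
      (coeffSupport M (pairWeight (ind {i}) (ind (C \ T))) (ind {i}))] (A i) := fun i =>
    measurable_blockSigma_stat (p := p) (q := q) (V := V) (U := U) _ _
      (measurableSet_Iic (a := θ + r))
  have mD : ∀ i, MeasurableSet[blockSigma (entryLLR n M p q V U)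
      (coeffSupport M (pairWeight (ind {i}) (ind T)) 0)] (D i) := fun i =>
    measurable_blockSigma_stat (p := p) (q := q) (V := V) (U := U) _ _
      (measurableSet_Ici (a := r))
  have mA' : ∀ i, MeasurableSet[blockSigma (entryLLR n M p q V U)
      (coeffSupport M (pairWeight (ind {i}) (ind C)) (ind {i}))] (A' i) := fun i =>
    measurable_blockSigma_stat (p := p) (q := q) (V := V) (U := U) _ _
      (measurableSet_Ici (a := θ + 5 * r - r))
  have hTn : ∀ {i}, i ∈ T → i ∉ C \ T := fun hi h => (Finset.mem_sdiff.1 h).2 hi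
  have b1 : P.real (⋂ i ∈ T, (A i)ᶜ)
      ≤ Real.exp (-(T.card * (Real.exp (θ - exponentQU p q V U θ K M - r) / 2))) := by
    refine measureReal_biInter_compl_le hind hmeas T
      (S := fun i => coeffSupport M (pairWeight (ind {i}) (ind (C \ T))) (ind {i})) ?_
      (fun i _ => mA i) fun i hi => ?_
    · intro i hi j hj hij
      exact disjoint_coeffSupport_nodeStat hij (hTn hi)
    · exact exp_le_measureReal_nodeStat_of_mem x hE hS (hT hi) Finset.sdiff_subset (hTn hi) hcard
        hθ hW hθT hηW hvar
  have b2 : P.real (⋂ i ∈ T, ((A i)ᶜ ∪ D i))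
      ≤ Real.exp (-(T.card * (Real.exp (θ - exponentQU p q V U θ K M - r) / 2)))
        + Real.exp (-(r / 2)) := by
    refine (measureReal_biInter_compl_union_le hind hmeas
      (R := ⋃ i ∈ T, coeffSupport M (pairWeight (ind {i}) (ind (C \ T))) (ind {i}))
      (R' := ⋃ i ∈ T, coeffSupport M (pairWeight (ind {i}) (ind T)) 0) ?_ T (D := D)
      (β := Real.exp (-(r / 2))) (fun i hi => ?_) (fun i hi => ?_) (fun i hi => ?_)
      (Real.exp_pos _).le).trans (by linarith)
    · simp only [Set.disjoint_iUnion_left, Set.disjoint_iUnion_right]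
      intro i hi j hj
      exact disjoint_coeffSupport_of_subset Finset.sdiff_disjoint (by assumption)
    · exact blockSigma_mono (Set.subset_biUnion_of_mem (u := fun i =>
        coeffSupport M (pairWeight (ind {i}) (ind (C \ T))) (ind {i}))
        (show i ∈ (T : Set (Fin n)) from hi)) _ (mA i)
    · exact blockSigma_mono (Set.subset_biUnion_of_mem (u := fun i =>
        coeffSupport M (pairWeight (ind {i}) (ind T)) 0)
        (show i ∈ (T : Set (Fin n)) from hi)) _ (mD i)
    · refine (measureReal_le_stat_le x hE hS hT hi r).trans (Real.exp_le_exp.2 ?_)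
      linarith
  have b3 : P.real (⋂ j ∈ Cᶜ, (A' j)ᶜ) ≤ Real.exp (-((Cᶜ.card : ℝ)
          * (Real.exp (-exponentQU p q V U θ K M - 6 * r) / 2))) := by
    refine measureReal_biInter_compl_le hind hmeas Cᶜ
      (S := fun i => coeffSupport M (pairWeight (ind {i}) (ind C)) (ind {i})) ?_
      (fun i _ => mA' i) fun i hi => ?_
    · intro i hi j hj hij
      exact disjoint_coeffSupport_nodeStat hij (Finset.mem_compl.1 hi)
    · have := exp_le_measureReal_nodeStat_of_notMem (M := M) x hE hS (Finset.mem_compl.1 hi) hcard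
        hθ (by linarith : 0 ≤ 5 * r) hW hθW hηW hvar
      rwa [show -exponentQU p q V U θ K M - 5 * r - r = -exponentQU p q V U θ K M - 6 * r by ring]
        at this
  have hae : ∀ᵐ ω ∂P, ∀ e, |llr (edgeLaw p) (edgeLaw q) (ω.1 e)| ≤ B := by
    rw [ae_all_iff]
    intro e
    refine (measurePreserving_edge x e).quasiMeasurePreserving.ae
      (p := fun b => |llr (edgeLaw p) (edgeLaw q) b| ≤ B) ?_
    split_ifs
    · exact hE.bound'
    · exact hE.bound
  have hsub : {ω | ∃ x' ∈ communityLabels n K,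
        score p q V U C ω + r ≤ score p q V U (community x') ω}ᶜ
      ≤ᵐ[P] ((⋂ i ∈ T, ((A i)ᶜ ∪ D i)) ∪ ⋂ j ∈ Cᶜ, (A' j)ᶜ : Set (Obs 𝒴 n M)) := by
    filter_upwards [hae] with ω hω hnot
    by_contra hcon
    have hcon' : ω ∉ ((⋂ i ∈ T, ((A i)ᶜ ∪ D i)) ∪ ⋂ j ∈ Cᶜ, (A' j)ᶜ) := hcon
    simp only [Set.mem_union, Set.mem_iInter, Set.mem_compl_iff, not_or, not_forall, not_not,
      exists_prop] at hcon'
    obtain ⟨⟨i, hi, hiA, hiD⟩, j, hj, hjA⟩ := hcon'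
    refine hnot ?_
    obtain ⟨x', hx'⟩ := exists_community_eq_insert_erase x (i := i) (j := j)
    rw [← hC] at hx'
    have hiC := hT hi
    have hjC : j ∉ C := by simpa using hj
    have hij : i ≠ j := fun h => hjC (h ▸ hiC)
    refine ⟨x', ?_, ?_⟩
    · rw [mem_communityLabels, hx', Finset.card_insert_of_notMem (by simp [hjC]),
        Finset.card_erase_add_one hiC, hcard]
    · have d1 : C \ community x' = {i} := by
        rw [hx']; ext k
        simp only [Finset.mem_sdiff, Finset.mem_insert, Finset.mem_erase, Finset.mem_singleton]
        constructor
        · rintro ⟨h1, h2⟩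
          by_contra hk
          exact h2 (Or.inr ⟨hk, h1⟩)
        · rintro rfl
          exact ⟨hiC, by rintro (h | h); exacts [hij h, h.1 rfl]⟩
      have d2 : community x' \ C = {j} := by
        rw [hx']; ext k
        simp only [Finset.mem_sdiff, Finset.mem_insert, Finset.mem_erase, Finset.mem_singleton]
        constructor
        · rintro ⟨h1 | h1, h2⟩
          exacts [h1, absurd h1.2 h2]
        · rintro rfl
          exact ⟨Or.inl rfl, hjC⟩
      have h1 := score_sub_score' (p := p) (q := q) (V := V) (U := U) C (community x') ω
      rw [d1, d2, Finset.sum_singleton, Finset.sum_singleton] at h1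
      have h2 := (abs_le.1 (abs_innerStat_singleton_le (V := V) (U := U) hij hω)).1
      have h3 : nodeStat p q V U C i ω = nodeStat p q V U (C \ T) i ω
          + stat p q V U (pairWeight (ind {i}) (ind T)) 0 ω := by
        rw [nodeStat, nodeStat, stat_add]
        have hsplit : ∀ k, ind C k = ind (C \ T) k + ind T k := fun k => by
          rw [ind_eq_sdiff_add C T, Finset.inter_eq_right.2 hT]
        congr 1
        · funext e; simp only [pairWeight, hsplit]; ring
        · funext k; simp
      have h4 : nodeStat p q V U (C \ T) i ω ≤ θ + r := hiA
      have h5 : stat p q V U (pairWeight (ind {i}) (ind T)) 0 ω < r := not_le.1 hiD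
      have h6 : θ + 5 * r - r ≤ nodeStat p q V U C j ω := hjA
      linarith
  have hfin : P.real {ω | ∃ x' ∈ communityLabels n K,
        score p q V U C ω + r ≤ score p q V U (community x') ω}ᶜ
      ≤ P.real ((⋂ i ∈ T, ((A i)ᶜ ∪ D i)) ∪ ⋂ j ∈ Cᶜ, (A' j)ᶜ) :=
    ENNReal.toReal_mono (measure_ne_top _ _) (measure_mono_ae hsub)
  exact hfin.trans ((measureReal_union_le _ _).trans (add_le_add b2 b3))

end Necessity

/-! ### Recovery probabilities -/

section Recovery

variable {𝒴 : Type*} [MeasurableSpace 𝒴] {n M K : ℕ} {p q : I} {V U : Measure 𝒴}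

lemma measurable_score (C : Finset (Fin n)) : Measurable (score (M := M) p q V U C) :=
  measurable_stat _ _

open Classical in
/-- The labelling that maximizes the likelihood, if there is a unique one. -/
def maxLikelihood (n K M : ℕ) (p q : I) (V U : Measure 𝒴) (ω : Obs 𝒴 n M) : Labels n := fun i =>
  decide (∃ x ∈ communityLabels n K, x i = true ∧ ∀ x' ∈ communityLabels n K, x' ≠ x →
    score p q V U (community x') ω < score p q V U (community x) ω)

lemma measurable_maxLikelihood : Measurable (maxLikelihood n K M p q V U) := by
  classical
  refine measurable_pi_iff.2 fun i => measurable_to_bool ?_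
  have : (fun ω => maxLikelihood n K M p q V U ω i) ⁻¹' {true}
      = ⋃ x ∈ communityLabels n K, ⋃ _ : x i = true, ⋂ x' ∈ communityLabels n K, ⋂ _ : x' ≠ x,
        {ω | score p q V U (community x') ω < score p q V U (community x) ω} := by
    ext ω
    simp only [maxLikelihood, Set.mem_preimage, Set.mem_singleton_iff, decide_eq_true_eq,
      Set.mem_iUnion, Set.mem_iInter, Set.mem_ofPred_eq, exists_prop]
  rw [this]
  refine Finset.measurableSet_biUnion _ fun x _ => MeasurableSet.iUnion fun _ =>
    Finset.measurableSet_biInter _ fun x' _ => MeasurableSet.iInter fun _ => ?_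
  exact measurableSet_lt (measurable_score _) (measurable_score _)

lemma maxLikelihood_eq {x : Labels n} (hx : x ∈ communityLabels n K) {ω : Obs 𝒴 n M}
    (h : ¬ ∃ x' ∈ communityLabels n K, x' ≠ x ∧
      score p q V U (community x) ω ≤ score p q V U (community x') ω) :
    maxLikelihood n K M p q V U ω = x := by
  push Not at h
  funext i
  rw [maxLikelihood, Bool.eq_iff_iff, decide_eq_true_iff]
  constructor
  · rintro ⟨y, hy, hyi, hmax⟩
    by_cases hyx : y = x
    · rwa [← hyx]
    · exact absurd (hmax x hx (Ne.symm hyx)) (h y hy hyx).not_gt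
  · intro hi
    exact ⟨x, hx, hi, h⟩

variable [IsProbabilityMeasure V] [IsProbabilityMeasure U]

lemma recoveryProb_le_one (est : Obs 𝒴 n M → Labels n) :
    recoveryProb n K M p q V U est ≤ 1 := by
  refine ENNReal.div_le_of_le_mul ?_
  rw [one_mul]
  refine (Finset.sum_le_card_nsmul _ _ 1 fun x _ => prob_le_one).trans ?_
  simp

lemma one_sub_le_recoveryProb {δ : ℝ} (hne : (communityLabels n K).Nonempty)
    (h : ∀ x ∈ communityLabels n K, (obsLaw n M p q V U x).real
      {ω | ∃ x' ∈ communityLabels n K, x' ≠ x ∧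
        score p q V U (community x) ω ≤ score p q V U (community x') ω} ≤ δ) :
    1 - ENNReal.ofReal δ ≤ recoveryProb n K M p q V U (maxLikelihood n K M p q V U) := by
  have hc : ((communityLabels n K).card : ℝ≥0∞) ≠ 0 := by
    simpa using hne.ne_empty
  rw [recoveryProb, ENNReal.le_div_iff_mul_le (Or.inl hc) (Or.inl (by simp)), mul_comm,
    ← nsmul_eq_mul]
  refine Finset.card_nsmul_le_sum _ _ _ fun x hx => ?_
  set S := {ω | maxLikelihood n K M p q V U ω = x} with hS
  have hSm : MeasurableSet S := measurable_maxLikelihood (measurableSet_singleton x)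
  have h1 : obsLaw n M p q V U x Sᶜ ≤ ENNReal.ofReal δ := by
    refine (measure_mono fun ω hω => ?_).trans
      (ENNReal.le_ofReal_iff_toReal_le (measure_ne_top _ _) (measureReal_nonneg.trans (h x hx))
        |>.2 (h x hx))
    by_contra hcon
    exact hω (maxLikelihood_eq hx hcon)
  have h2 := prob_add_prob_compl (μ := obsLaw n M p q V U x) hSm
  rw [tsub_le_iff_right, ← h2]
  gcongr

variable {B : ℝ}

/-- At each observation an estimator names only one labelling. If some other one is `exp s` times as
likely, the named one carries at most a fraction `exp (-s)` of the total likelihood; integrating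
over the noise law gives the bound for arbitrary estimators. -/
lemma recoveryProb_le (hE : LLRBound (edgeLaw p) (edgeLaw q) B) (hS : LLRBound V U B)
    {δ s : ℝ} (hδ : 0 ≤ δ) {est : Obs 𝒴 n M → Labels n} (hest : Measurable est)
    (h : ∀ x ∈ communityLabels n K, (obsLaw n M p q V U x).real
      {ω | ∃ x' ∈ communityLabels n K,
        score p q V U (community x) ω + s ≤ score p q V U (community x') ω}ᶜ ≤ δ) :
    recoveryProb n K M p q V U est ≤ ENNReal.ofReal (δ + Real.exp (-s)) := by
  classical
  set L := communityLabels n K with hL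
  set ν := obsLaw n M p q V U fun _ => false with hν
  set F : Labels n → Set (Obs 𝒴 n M) := fun x => {ω | ∃ x' ∈ L,
    score p q V U (community x) ω + s ≤ score p q V U (community x') ω} with hF
  set f : Labels n → Obs 𝒴 n M → ℝ≥0∞ := fun x ω =>
    ENNReal.ofReal (Real.exp (score p q V U (community x) ω)) with hf
  have mf : ∀ x, Measurable (f x) := fun x => (measurable_score _).exp.ennreal_ofReal
  have mF : ∀ x, MeasurableSet (F x) := by
    intro x
    have : F x = ⋃ x' ∈ L,
        {ω | score p q V U (community x) ω + s ≤ score p q V U (community x') ω} := by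
      ext ω; simp [hF]
    rw [this]
    exact Finset.measurableSet_biUnion _ fun x' _ =>
      measurableSet_le ((measurable_score _).add_const _) (measurable_score _)
  have me : ∀ x, MeasurableSet {ω | est ω = x} := fun x => hest (measurableSet_singleton x)
  have hlaw : ∀ x, obsLaw n M p q V U x = ν.withDensity (f x) := fun x =>
    obsLaw_eq_withDensity x hE hS
  have hsplit : ∀ x ∈ L, obsLaw n M p q V U x {ω | est ω = x}
      ≤ ENNReal.ofReal δ + ∫⁻ ω, ({ω | est ω = x} ∩ F x).indicator (f x) ω ∂ν := by
    intro x hx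
    have h1 : obsLaw n M p q V U x (F x)ᶜ ≤ ENNReal.ofReal δ :=
      (ENNReal.le_ofReal_iff_toReal_le (measure_ne_top _ _) hδ).2 (h x hx)
    have h2 : obsLaw n M p q V U x ({ω | est ω = x} ∩ F x)
        = ∫⁻ ω, ({ω | est ω = x} ∩ F x).indicator (f x) ω ∂ν := by
      rw [lintegral_indicator ((me x).inter (mF x)), hlaw,
        withDensity_apply _ ((me x).inter (mF x))]
    rw [← h2]
    calc _ ≤ obsLaw n M p q V U x ((F x)ᶜ ∪ ({ω | est ω = x} ∩ F x)) :=
          measure_mono fun ω hω => by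
            by_cases hω' : ω ∈ F x
            · exact Or.inr ⟨hω, hω'⟩
            · exact Or.inl hω'
      _ ≤ _ := (measure_union_le _ _).trans (by gcongr)
  have hpt : ∀ ω, ∑ x ∈ L, ({ω | est ω = x} ∩ F x).indicator (f x) ω
      ≤ ENNReal.ofReal (Real.exp (-s)) * ∑ x ∈ L, f x ω := by
    intro ω
    by_cases hω : est ω ∈ L ∧ ω ∈ F (est ω)
    · rw [Finset.sum_eq_single (est ω)]
      · obtain ⟨x', hx', hle⟩ := hω.2
        rw [Set.indicator_of_mem 
          (show ω ∈ {ω' | est ω' = est ω} ∩ F (est ω) from ⟨rfl, hω.2⟩)]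
        calc f (est ω) ω ≤ ENNReal.ofReal (Real.exp (-s)) * f x' ω := by
              simp only [hf]
              rw [← ENNReal.ofReal_mul (Real.exp_pos _).le, ← Real.exp_add]
              exact ENNReal.ofReal_le_ofReal (Real.exp_le_exp.2 (by linarith))
          _ ≤ _ := by
              gcongr
              exact Finset.single_le_sum (f := fun x => f x ω) (fun _ _ => zero_le) hx'
      · intro x _ hne
        exact Set.indicator_of_notMem (fun hm => hne hm.1.symm) _
      · intro hn
        exact absurd hω.1 hn
    · rw [Finset.sum_eq_zero]
      · exact zero_le
      · intro x hx
        refine Set.indicator_of_notMem (fun hm => hω ?_) _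
        have : est ω = x := hm.1
        rw [this]
        exact ⟨hx, hm.2⟩
  have hone : ∀ x, ∫⁻ ω, f x ω ∂ν = 1 := by
    intro x
    have : obsLaw n M p q V U x Set.univ = 1 := measure_univ
    rwa [hlaw, withDensity_apply _ MeasurableSet.univ, Measure.restrict_univ] at this
  refine ENNReal.div_le_of_le_mul ?_
  calc ∑ x ∈ L, obsLaw n M p q V U x {ω | est ω = x}
      ≤ ∑ x ∈ L, (ENNReal.ofReal δ + ∫⁻ ω, ({ω | est ω = x} ∩ F x).indicator (f x) ω ∂ν) :=
        Finset.sum_le_sum hsplit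
    _ = L.card * ENNReal.ofReal δ
          + ∫⁻ ω, ∑ x ∈ L, ({ω | est ω = x} ∩ F x).indicator (f x) ω ∂ν := by
        rw [Finset.sum_add_distrib, Finset.sum_const, nsmul_eq_mul, lintegral_finsetSum]
        exact fun x _ => (mf x).indicator ((me x).inter (mF x))
    _ ≤ L.card * ENNReal.ofReal δ
          + ∫⁻ ω, ENNReal.ofReal (Real.exp (-s)) * ∑ x ∈ L, f x ω ∂ν := by
        gcongr with ω
        exact hpt ω
    _ = L.card * ENNReal.ofReal δ + ENNReal.ofReal (Real.exp (-s)) * L.card := by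
        rw [lintegral_const_mul _ (Finset.measurable_sum _ fun x _ => mf x),
          lintegral_finsetSum _ fun x _ => mf x]
        simp [hone]
    _ = _ := by rw [ENNReal.ofReal_add hδ (Real.exp_pos _).le]; ring

end Recovery

/-! ### Edge laws -/

lemma edgeLaw_singleton (p : I) (b : Bool) :
    edgeLaw p {b} = ENNReal.ofReal (if b = true then (p : ℝ) else 1 - p) := by
  rw [← ofReal_measureReal, bernoulliMeasure_real_apply _ (measurableSet_singleton b)]
  cases b <;> simp

lemma edgeLaw_absolutelyContinuous (p : I) {q : I} (hq0 : 0 < (q : ℝ)) (hq1 : (q : ℝ) < 1) :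
    edgeLaw p ≪ edgeLaw q := by
  refine Measure.AbsolutelyContinuous.mk fun s _ hs => ?_
  have : s = ∅ := by
    rw [Set.eq_empty_iff_forall_notMem]
    intro b hb
    have h1 : edgeLaw q {b} = 0 := measure_mono_null (Set.singleton_subset_iff.2 hb) hs
    rw [edgeLaw_singleton, ENNReal.ofReal_eq_zero] at h1
    cases b <;> simp at h1 <;> linarith
  simp [this]

lemma llr_edgeLaw {p q : I} (hq0 : 0 < (q : ℝ)) (hq1 : (q : ℝ) < 1) (b : Bool) :
    llr (edgeLaw p) (edgeLaw q) b
      = Real.log ((if b = true then (p : ℝ) else 1 - p) / (if b = true then (q : ℝ) else 1 - q)) := by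
  have h1 : edgeLaw p {b} = (edgeLaw p).rnDeriv (edgeLaw q) b * edgeLaw q {b} := by
    conv_lhs => rw [← Measure.withDensity_rnDeriv_eq _ _ (edgeLaw_absolutelyContinuous p hq0 hq1)]
    rw [withDensity_apply _ (measurableSet_singleton b), lintegral_singleton]
  have hpos : 0 < (if b = true then (q : ℝ) else 1 - q) := by split_ifs <;> linarith
  have hp : 0 ≤ (if b = true then (p : ℝ) else 1 - p) := by
    split_ifs
    exacts [p.2.1, by linarith [p.2.2]]
  rw [edgeLaw_singleton, edgeLaw_singleton] at h1
  have h2 := congrArg ENNReal.toReal h1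
  rw [ENNReal.toReal_mul, ENNReal.toReal_ofReal hp, ENNReal.toReal_ofReal hpos.le] at h2
  rw [llr, h2, mul_div_cancel_right₀ _ hpos.ne']

/-- On an edge the ratio lies in `[1, R]`, on a non-edge in `[1 - P, 1]`. -/
lemma llrBound_edgeLaw {p q : I} {B R P : ℝ} (hq0 : 0 < (q : ℝ)) (hqp : (q : ℝ) ≤ p) (hpP : (p : ℝ) ≤ P)
    (hP : P < 1) (hR : (p : ℝ) / q ≤ R) (hB₁ : Real.log R ≤ B) (hB₂ : -Real.log (1 - P) ≤ B) :
    LLRBound (edgeLaw p) (edgeLaw q) B := by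
  have hq1 : (q : ℝ) < 1 := by linarith
  refine ⟨edgeLaw_absolutelyContinuous p hq0 hq1,
    edgeLaw_absolutelyContinuous q (by linarith) (by linarith), .of_forall fun b => ?_⟩
  rw [llr_edgeLaw hq0 hq1]
  have h1 : 1 ≤ (p : ℝ) / q := by rwa [le_div_iff₀ hq0, one_mul]
  cases b
  · simp only [Bool.false_eq_true, if_false]
    have h2 : (1 - (p : ℝ)) / (1 - q) ≤ 1 := by rw [div_le_one (by linarith)]; linarith
    have h3 : 1 - P ≤ (1 - (p : ℝ)) / (1 - q) := by
      rw [le_div_iff₀ (by linarith)]; nlinarith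
    have h4 := Real.log_le_log (by linarith) h3
    have h5 : Real.log ((1 - (p : ℝ)) / (1 - q)) ≤ 0 := Real.log_nonpos (by linarith) h2
    rw [abs_of_nonpos h5]
    linarith
  · simp only [if_true]
    rw [abs_of_nonneg (Real.log_nonneg h1)]
    exact (Real.log_le_log (by linarith) hR).trans hB₁

/-! ### Asymptotics -/

section Asymptotics

variable {𝒴 : Type*} [MeasurableSpace 𝒴] {V U : Measure 𝒴}
  [IsProbabilityMeasure V] [IsProbabilityMeasure U]

/-- The minimal expected log-likelihood gap per wrong node. -/
def gapQU (p q : I) (V U : Measure 𝒴) (K M : ℕ) : ℝ :=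
  ((K : ℝ) - 1) * klReal (edgeLaw p) (edgeLaw q) / 2 + M * klReal V U

/-- The total divergence of the observations that concern a node. -/
def divQU (p q : I) (V U : Measure 𝒴) (K M : ℕ) : ℝ :=
  K * klReal (edgeLaw p) (edgeLaw q) + M * klReal V U

lemma gapQU_le_divQU (p q : I) (V U : Measure 𝒴) {K : ℕ} (M : ℕ) (hK : 0 < K) :
    gapQU p q V U K M ≤ divQU p q V U K M := by
  have hK' : (1 : ℝ) ≤ K := by exact_mod_cast hK
  have hD : 0 ≤ klReal (edgeLaw p) (edgeLaw q) := LLRBound.klReal_nonneg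
  unfold gapQU divQU
  nlinarith

/-- The exponent is at least of the order of the divergence when `θ` is bounded away from the
divergence. -/
lemma mul_divQU_le_exponentQU {p q : I} {B δ θ : ℝ} {K M : ℕ}
    (hE : LLRBound (edgeLaw p) (edgeLaw q) B) (hS : LLRBound V U B) (hδ : 0 < δ) (hδ1 : δ ≤ 1)
    (hθ : 0 ≤ θ) (hθW : θ ≤ (1 - δ) * divQU p q V U K M) :
    δ ^ 2 / (16 * Real.exp (4 * B)) * divQU p q V U K M ≤ exponentQU p q V U θ K M := by
  have hB := hE.nonneg
  have he : 1 ≤ Real.exp (4 * B) := Real.one_le_exp (by linarith)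
  -- The maximizer of `δ t - 4 exp (4B) t²`, with value `t δ / 2`.
  set t := δ / (8 * Real.exp (4 * B)) with ht
  have ht0 : 0 ≤ t := by positivity
  have ht1 : t ≤ 1 := by rw [ht, div_le_one (by positivity)]; linarith
  have h := exponentQU_ge hE hS (θ := θ) (Nat.cast_nonneg K) (Nat.cast_nonneg M) ht0 ht1
  refine le_trans ?_ h
  rw [← divQU]
  set W := divQU p q V U K M
  have e1 : t * (8 * Real.exp (4 * B)) = δ := by rw [ht]; field_simp
  have e2 : δ ^ 2 / (16 * Real.exp (4 * B)) = t * δ / 2 := by rw [ht]; field_simp; ring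
  have e3 : 4 * Real.exp (4 * B) * t ^ 2 = t * δ / 2 := by rw [← e1]; ring
  rw [e2, e3]
  have := mul_le_mul_of_nonneg_left hθW ht0
  nlinarith

/-- Uniform bounds on the error of the maximum likelihood estimator above the threshold. -/
lemma eventually_measureReal_exists_score_le {K M : ℕ → ℕ} {p q : ℕ → I} {B δ γ : ℝ}
    (hS : LLRBound V U B) (hδ : 0 < δ) (hδ1 : δ ≤ 1) (hγ : 0 < γ)
    (hE : ∀ᶠ n in atTop, LLRBound (edgeLaw (p n)) (edgeLaw (q n)) B)
    (hK : ∀ᶠ n in atTop, 0 < K n)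
    (hθ : ∀ᶠ n : ℕ in atTop, 0 ≤ Real.log (n / K n))
    (hgap : ∀ᶠ n : ℕ in atTop,
      Real.log (n / K n) ≤ (1 - δ) * gapQU (p n) (q n) V U (K n) (M n))
    (hgap_top : Tendsto (fun n => gapQU (p n) (q n) V U (K n) (M n)) atTop atTop)
    (hexp : ∀ᶠ n : ℕ in atTop, (1 + γ) * Real.log n
      ≤ exponentQU (p n) (q n) V U (Real.log (n / K n)) (K n) (M n))
    {R : ℝ} (hR : 1 ≤ R) :
    ∀ᶠ n : ℕ in atTop, ∀ x ∈ communityLabels n (K n),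
      (obsLaw n (M n) (p n) (q n) V U x).real {ω | ∃ x' ∈ communityLabels n (K n), x' ≠ x ∧
        score (p n) (q n) V U (community x) ω ≤ score (p n) (q n) V U (community x') ω}
      ≤ 6 * Real.exp (-R) := by
  have hB := hS.nonneg
  set e4 := Real.exp (4 * B) with he4
  have he : 1 ≤ e4 := Real.one_le_exp (by linarith)
  set c := δ ^ 2 / (16 * e4) with hc
  have hc0 : 0 < c := by positivity
  -- Chosen so that `(1 - lam) (1 + γ) = 1 + γ / 2`: mixing the bounds `(1 + γ) L` and `c W` for the
  -- exponent leaves a surplus over `L` of order `L + W`.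
  set lam := γ / (2 * (1 + γ)) with hlam
  have hlam0 : 0 < lam := by positivity
  have hlam1 : lam * (2 * (1 + γ)) = γ := by rw [hlam]; field_simp
  -- The margin will be `m = a (L + W)`, and the surplus is at least `2m`: one half pays for the
  -- margin, the other for the constants.
  set a := min (γ / 4) (lam * c / 2) with ha
  have ha0 : 0 < a := by positivity
  have ha1 : a ≤ γ / 4 := min_le_left _ _
  have ha2 : a ≤ lam * c / 2 := min_le_right _ _
  -- Makes `2 s m = 4 (L + W)`, against an entropy of `2L` and, by the choice of `ε`, a divergence
  -- term of at most `2W`.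
  set s := 2 / a with hs
  have hs0 : 0 ≤ s := by positivity
  set cs := LLRBound.cgfConst (s + 1) B with hcs
  have hcs0 : 0 ≤ cs := LLRBound.cgfConst_nonneg (by linarith)
  set ε := 1 / (cs + 1) with hε
  have hε0 : 0 < ε := by positivity
  have hcsε : cs * ε ≤ 1 := by
    rw [hε, mul_one_div, div_le_one (by positivity)]; linarith
  -- Half of the gap `δ` remains, so `(1 - η) w` still exceeds `θ` by `η w`.
  set η := δ / 2 with hη
  set t := η / (8 * e4) with ht
  have ht0 : 0 ≤ t := by positivity
  have ht1 : t * (8 * e4) = η := by rw [ht]; field_simp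
  have ht2 : t ≤ 1 := by rw [ht, div_le_one (by positivity)]; linarith
  have ht3 : 4 * e4 * t ^ 2 = t * η / 2 := by rw [← ht1]; ring
  have htη : 0 < t * η / 2 := by positivity
  have hlog : Tendsto (fun n : ℕ => Real.log n) atTop atTop :=
    Real.tendsto_log_atTop.comp tendsto_natCast_atTop_atTop
  filter_upwards [hE, hK, hθ, hgap, hexp, hlog.eventually_ge_atTop (R / 2),
    hlog.eventually_ge_atTop ((R + 1 + B) / a), hgap_top.eventually_ge_atTop 0,
    hgap_top.eventually_ge_atTop ((R + (1 + Real.log (1 / ε))) / (t * η / 2)),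
    hgap_top.eventually_ge_atTop ((R + 2 * (1 + Real.log (1 / ε))) / η)]
    with n hE hK hθ hgap hexp hL1 hL2 hw0 hw1 hw2 x hx
  rw [mem_communityLabels] at hx
  have hWw := gapQU_le_divQU (p n) (q n) V U (M n) hK
  set W := divQU (p n) (q n) V U (K n) (M n) with hW
  set w := gapQU (p n) (q n) V U (K n) (M n) with hw
  set L := Real.log (n : ℝ) with hL
  set θ := Real.log ((n : ℝ) / K n) with hθ'
  set Ex := exponentQU (p n) (q n) V U θ (K n) (M n) with hEx
  have hL0 : 0 ≤ L := by linarith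
  have hEW : c * W ≤ Ex := by
    refine mul_divQU_le_exponentQU hE hS hδ hδ1 hθ (hgap.trans ?_)
    exact mul_le_mul_of_nonneg_left hWw (by linarith)
  have hW0 : 0 ≤ W := hw0.trans hWw
  have hlam2 : lam ≤ 1 := by rw [hlam, div_le_one (by positivity)]; linarith
  have hmain : L + 2 * (a * (L + W)) ≤ Ex := by
    have h1 := mul_le_mul_of_nonneg_left hexp (by linarith : 0 ≤ 1 - lam)
    have h2 := mul_le_mul_of_nonneg_left hEW hlam0.le
    have h3 : (1 - lam) * ((1 + γ) * L) = (1 + γ / 2) * L := by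
      have : lam * (1 + γ) = γ / 2 := by linarith
      linear_combination (-L) * this
    have h4 := mul_le_mul_of_nonneg_right ha1 hL0
    have h5 := mul_le_mul_of_nonneg_right ha2 hW0
    rw [h3] at h1
    linarith
  have hKD : K n * klReal (edgeLaw (p n)) (edgeLaw (q n)) ≤ W := by
    rw [hW, divQU]
    have : 0 ≤ (M n : ℝ) * klReal V U := mul_nonneg (Nat.cast_nonneg _) LLRBound.klReal_nonneg
    linarith
  have hKD0 : 0 ≤ K n * klReal (edgeLaw (p n)) (edgeLaw (q n)) :=
    mul_nonneg (Nat.cast_nonneg _) LLRBound.klReal_nonneg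
  refine measureReal_exists_score_le x hE hS hx hK (θ := θ) (m := a * (L + W)) (s := s) (ε := ε)
    (η := η) (t := t) (w := w) hθ' rfl hR (by positivity) hs0 hε0 ht0 ht2 ?_ ?_ ?_ ?_ ?_
  · rw [← he4, ht3]
    have : t * η ≤ t := mul_le_of_le_one_right ht0 (by linarith)
    linarith
  · rw [div_le_iff₀ ha0] at hL2
    have : a * L ≤ a * (L + W) := by gcongr; linarith
    linarith
  · have h1 : 2 * s * (a * (L + W)) = 4 * (L + W) := by rw [hs]; field_simp; ring
    rw [h1]
    have h2 : 2 * cs * ε * (K n * klReal (edgeLaw (p n)) (edgeLaw (q n))) ≤ 2 * W := by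
      have := mul_le_of_le_one_left hKD0 hcsε
      linarith
    linarith
  · rw [← he4, ht3]
    rw [div_le_iff₀ htη] at hw1
    linarith
  · rw [div_le_iff₀ (by positivity)] at hw2
    have : (1 - η) * w = (1 - δ) * w + η * w := by rw [hη]; ring
    rw [this]
    linarith

/-- Below the threshold every estimator fails. -/
lemma eventually_recoveryProb_le {K M : ℕ → ℕ} {p q : ℕ → I} {B δ γ : ℝ}
    (hS : LLRBound V U B) (hδ : 0 < δ) (hδ1 : δ ≤ 1) (hγ : 0 < γ)
    (hE : ∀ᶠ n in atTop, LLRBound (edgeLaw (p n)) (edgeLaw (q n)) B)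
    (hK : Tendsto K atTop atTop)
    (hKn : ∀ᶠ n in atTop, 2 * K n ≤ n)
    (hθ : ∀ᶠ n : ℕ in atTop, 0 ≤ Real.log (n / K n))
    (hgap : ∀ᶠ n : ℕ in atTop,
      Real.log (n / K n) ≤ (1 - δ) * gapQU (p n) (q n) V U (K n) (M n))
    (hgap_top : Tendsto (fun n => gapQU (p n) (q n) V U (K n) (M n)) atTop atTop) :
    ∀ᶠ n : ℕ in atTop,
      exponentQU (p n) (q n) V U (Real.log (n / K n)) (K n) (M n) ≤ (1 - γ) * Real.log n →
      ∀ est : Obs 𝒴 n (M n) → Labels n, Measurable est →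
        recoveryProb n (K n) (M n) (p n) (q n) V U est ≤ ENNReal.ofReal (1 / 2) := by
  have hB := hS.nonneg
  set e4 := Real.exp (4 * B) with he4
  have he : 1 ≤ e4 := Real.one_le_exp (by linarith)
  set c := δ ^ 2 / (16 * e4) with hc
  have hc0 : 0 < c := by positivity
  -- The first bound gives `θ + 5ηW ≤ W`; the second, with `c W ≤ L`, gives `6ηW ≤ γ L / 2`.
  set η := min (δ / 5) (γ * c / 12) with hη
  have hη0 : 0 < η := by positivity
  have hη1 : η ≤ δ / 5 := min_le_left _ _
  have hη2 : η ≤ γ * c / 12 := min_le_right _ _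
  set c2 := LLRBound.cgfConst 2 B with hc2
  have hc20 : 0 ≤ c2 := LLRBound.cgfConst_nonneg (by norm_num)
  -- `T` will have at most `2εK` nodes: removing it as partners keeps `θ` attainable by tilting, and
  -- the pairs inside it shift a statistic by little.
  set ε := min (δ / 2) (η / (4 * (c2 + 1))) with hε
  have hε0 : 0 < ε := by positivity
  have hε1 : ε ≤ δ / 2 := min_le_left _ _
  have hε2 : ε * (4 * (c2 + 1)) ≤ η := by
    rw [← le_div_iff₀ (by positivity)]; exact min_le_right _ _
  have hlog : Tendsto (fun n : ℕ => Real.log n) atTop atTop :=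
    Real.tendsto_log_atTop.comp tendsto_natCast_atTop_atTop
  have hbig : Tendsto (fun n : ℕ => Real.exp (γ / 2 * Real.log n)) atTop atTop :=
    Real.tendsto_exp_atTop.comp (hlog.const_mul_atTop (by positivity))
  have hKr : Tendsto (fun n => (K n : ℝ)) atTop atTop := tendsto_natCast_atTop_atTop.comp hK
  filter_upwards [hE, hK.eventually_ge_atTop 1, hKr.eventually_ge_atTop (1 / ε), hKn, hθ, hgap,
    hgap_top.eventually_ge_atTop 1, hgap_top.eventually_ge_atTop (8 * e4 / η ^ 2),
    hgap_top.eventually_ge_atTop (B / η), hgap_top.eventually_ge_atTop (14 / η),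
    hbig.eventually_ge_atTop (14 / ε), hbig.eventually_ge_atTop 28]
    with n hE hK hKε hKn hθ hgap hw1 hw2 hw3 hw4 hb1 hb2 hexp est hest
  have hWw := gapQU_le_divQU (p n) (q n) V U (M n) hK
  set W := divQU (p n) (q n) V U (K n) (M n) with hW
  set w := gapQU (p n) (q n) V U (K n) (M n) with hw
  set L := Real.log (n : ℝ) with hL
  set θ := Real.log ((n : ℝ) / K n) with hθ'
  set Ex := exponentQU (p n) (q n) V U θ (K n) (M n) with hEx
  set D := klReal (edgeLaw (p n)) (edgeLaw (q n)) with hD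
  have hD0 : 0 ≤ D := LLRBound.klReal_nonneg
  have hMD0 : 0 ≤ (M n : ℝ) * klReal V U := mul_nonneg (Nat.cast_nonneg _) LLRBound.klReal_nonneg
  have hWeq : W = K n * D + M n * klReal V U := rfl
  have hK1 : (1 : ℝ) ≤ K n := by exact_mod_cast hK
  have hn0 : (0 : ℝ) < n := by
    have : 0 < n := by omega
    exact_mod_cast this
  have hθL : Real.log (K n) + θ = L := by
    rw [hθ', Real.log_div hn0.ne' (by linarith)]; ring
  have hθW : θ ≤ (1 - δ) * W := hgap.trans (mul_le_mul_of_nonneg_left hWw (by linarith))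
  have hEW : c * W ≤ Ex := mul_divQU_le_exponentQU hE hS hδ hδ1 hθ hθW
  have hW1 : 1 ≤ W := hw1.trans hWw
  have hηW : 0 < η * W := by positivity
  have hηL : 6 * (η * W) ≤ γ / 2 * L := by
    have h1 : c * W ≤ L := by
      have hL0 : 0 ≤ L := Real.log_nonneg (by
        have : 1 ≤ n := by omega
        exact_mod_cast this)
      have := mul_nonneg hγ.le hL0
      linarith
    have h2 := mul_le_mul_of_nonneg_right hη2 (by linarith : 0 ≤ W)
    have h3 := mul_le_mul_of_nonneg_left h1 hγ.le
    linarith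
  have hW0 : 0 ≤ W := zero_le_one.trans hW1
  have hwη := mul_le_mul_of_nonneg_right hWw hη0.le
  have hηW14 : 14 ≤ η * W := by
    rw [div_le_iff₀ hη0] at hw4; linarith
  have hBW : B ≤ η * W := by
    rw [div_le_iff₀ hη0] at hw3; linarith
  have hvar : 2 * (4 * e4 * W) ≤ (η * W) ^ 2 := by
    rw [div_le_iff₀ (by positivity)] at hw2
    have : 8 * e4 ≤ W * η ^ 2 := hw2.trans (by gcongr)
    have := mul_le_mul_of_nonneg_right this hW0
    linarith
  have hexp_small : ∀ y : ℝ, 7 ≤ y → Real.exp (-y) ≤ 1 / 8 := by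
    intro y hy
    have h2 : (8 : ℝ) ≤ Real.exp y := by linarith [Real.add_one_le_exp y]
    rw [Real.exp_neg, one_div]
    exact inv_anti₀ (by norm_num) h2
  have hδbound : ∀ x ∈ communityLabels n (K n), (obsLaw n (M n) (p n) (q n) V U x).real
      {ω | ∃ x' ∈ communityLabels n (K n), score (p n) (q n) V U (community x) ω + η * W
        ≤ score (p n) (q n) V U (community x') ω}ᶜ ≤ 3 / 8 := by
    intro x hx
    rw [mem_communityLabels] at hx
    have hcle : ⌈ε * K n⌉₊ ≤ (community x).card := by
      rw [hx, Nat.ceil_le]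
      exact mul_le_of_le_one_left (Nat.cast_nonneg _) (by linarith)
    obtain ⟨T, hT, hTc⟩ := Finset.exists_subset_card_eq hcle
    have hT1 : ε * K n ≤ T.card := by rw [hTc]; exact Nat.le_ceil _
    have hT2 : (T.card : ℝ) ≤ 2 * ε * K n := by
      rw [hTc]
      -- Rounding up adds at most one, which is at most `εK` for large `K`.
      have h1 := (Nat.ceil_lt_add_one (by positivity : 0 ≤ ε * K n)).le
      rw [div_le_iff₀ hε0] at hKε
      linarith
    have hsd : (((community x \ T).card : ℕ) : ℝ) = K n - T.card := by
      rw [Finset.card_sdiff_of_subset hT, Nat.cast_sub (Finset.card_le_card hT), hx]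
    have hTD : (T.card : ℝ) * D ≤ 2 * ε * W := by
      have h1 := mul_le_mul_of_nonneg_right hT2 hD0
      have h2 : 2 * ε * (K n * D) ≤ 2 * ε * W := by
        refine mul_le_mul_of_nonneg_left ?_ (by positivity)
        rw [hWeq]; linarith
      linarith
    have hηδ := mul_le_mul_of_nonneg_right hη1 hW0
    have hεδ := mul_le_mul_of_nonneg_right hε1 hW0
    have hεW := mul_nonneg hε0.le hW0
    have hεη := mul_le_mul_of_nonneg_right hε2 hW0
    have hfail := measureReal_compl_exists_score_le x hE hS hx (θ := θ) (η := η) (W := W) hT hθ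
      hWeq hηW (by linarith) (by rw [hsd]; linarith) hvar (by
        have h1 := mul_le_mul_of_nonneg_left hTD hc20
        linarith) hBW
    refine hfail.trans ?_
    have i1 : Real.exp (-(T.card * (Real.exp (θ - Ex - η * W) / 2))) ≤ 1 / 8 := by
      refine hexp_small _ ?_
      -- As `log K + θ = L`, the exponent is `L - Ex - ηW ≥ γ L - ηW ≥ γ L / 2`.
      have h1 : Real.exp (γ / 2 * L) ≤ K n * Real.exp (θ - Ex - η * W) := by
        rw [← Real.exp_log (by linarith : (0 : ℝ) < K n), ← Real.exp_add]
        exact Real.exp_le_exp.2 (by linarith)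
      have h2 := mul_le_mul_of_nonneg_right hT1 (Real.exp_pos (θ - Ex - η * W)).le
      have h3 := mul_le_mul_of_nonneg_left h1 hε0.le
      rw [div_le_iff₀ hε0] at hb1
      linarith
    have i2 : Real.exp (-(η * W / 2)) ≤ 1 / 8 := hexp_small _ (by linarith)
    have i3 : Real.exp (-(((community x)ᶜ.card : ℝ)
        * (Real.exp (-Ex - 6 * (η * W)) / 2))) ≤ 1 / 8 := by
      refine hexp_small _ ?_
      have hcc : (n : ℝ) / 2 ≤ (community x)ᶜ.card := by
        rw [Finset.card_compl, hx, Fintype.card_fin, Nat.cast_sub (by omega)]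
        have : (2 : ℝ) * K n ≤ n := by exact_mod_cast hKn
        linarith
      have h1 : Real.exp (γ / 2 * L) ≤ n * Real.exp (-Ex - 6 * (η * W)) := by
        rw [← Real.exp_log hn0, ← Real.exp_add]
        exact Real.exp_le_exp.2 (by linarith)
      have h2 := mul_le_mul_of_nonneg_right hcc (Real.exp_pos (-Ex - 6 * (η * W))).le
      linarith
    linarith
  -- The three failure probabilities and `exp (-ηW)` are each at most `1/8`, which adds up to `1/2`.
  refine (recoveryProb_le hE hS (by norm_num) hest hδbound).trans (ENNReal.ofReal_le_ofReal ?_)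
  linarith [hexp_small (η * W) (by linarith)]

end Asymptotics

end SingleCommunity

end

/-! ### The threshold theorem -/

open SingleCommunity in
theorem theorem2 {𝒴 : Type*} [MeasurableSpace 𝒴]
    (V U : Measure 𝒴) [IsProbabilityMeasure V] [IsProbabilityMeasure U]
    (hLLR : BoundedLLR V U)
    (K M : ℕ → ℕ) (p q : ℕ → I)
    -- the standing assumptions on the model
    (hK_top : Tendsto K atTop atTop)
    (hK_small : (fun n => (K n : ℝ)) =o[atTop] (fun n => (n : ℝ)))
    (hq : ∀ n, 0 < (q n : ℝ))
    (hpq : ∀ n, (q n : ℝ) ≤ p n)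
    (hratio : (fun n => (p n : ℝ) / q n) =Θ[atTop] (fun _ => (1 : ℝ)))
    (hp : limsup (fun n => (p n : ℝ)) atTop < 1)
    -- the weak-recovery conditions
    (hweak₁ : Tendsto
      (fun n => ((K n : ℝ) - 1) * klReal (edgeLaw (p n)) (edgeLaw (q n)) + M n * klReal V U)
      atTop atTop)
    (hweak₂ : 2 < liminf
      (fun n => (((((K n : ℝ) - 1) * klReal (edgeLaw (p n)) (edgeLaw (q n))
        + 2 * M n * klReal V U) / Real.log (n / K n) : ℝ) : EReal)) atTop)
    -- the critical case is left out
    (hcrit : liminf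
      (fun n : ℕ => ((exponentQU (p n) (q n) V U (Real.log (n / K n)) (K n) (M n)
        / Real.log n : ℝ) : EReal)) atTop ≠ 1) :
    ExactRecovery K M p q V U ↔
      1 < liminf
        (fun n : ℕ => ((exponentQU (p n) (q n) V U (Real.log (n / K n)) (K n) (M n)
          / Real.log n : ℝ) : EReal)) atTop := by
  have hθ_top : Tendsto (fun n : ℕ => Real.log (n / K n)) atTop atTop := by
    refine tendsto_atTop.2 fun b => ?_
    filter_upwards [hK_small.bound (Real.exp_pos (-b)), hK_top.eventually_ge_atTop 1] with n h1 h2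
    have hK0 : (0 : ℝ) < K n := by exact_mod_cast h2
    rw [Real.norm_of_nonneg hK0.le, Real.norm_of_nonneg (Nat.cast_nonneg n)] at h1
    have h3 : Real.exp b ≤ n / K n := by
      rw [le_div_iff₀ hK0]
      calc Real.exp b * K n ≤ Real.exp b * (Real.exp (-b) * n) := by gcongr
        _ = n := by rw [← mul_assoc, ← Real.exp_add]; simp
    rw [← Real.log_exp b]
    exact Real.log_le_log (Real.exp_pos b) h3
  have hKn : ∀ᶠ n in atTop, 2 * K n ≤ n := by
    filter_upwards [hK_small.bound (by norm_num : (0 : ℝ) < 1 / 2)] with n h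
    simp only [RCLike.norm_natCast] at h
    have : (2 : ℝ) * K n ≤ n := by linarith
    exact_mod_cast this
  have hK0 : ∀ᶠ n in atTop, 0 < K n := hK_top.eventually_gt_atTop 0
  have hlog : ∀ᶠ n : ℕ in atTop, 0 < Real.log n :=
    (Real.tendsto_log_atTop.comp tendsto_natCast_atTop_atTop).eventually_gt_atTop 0
  have hθ0 : ∀ᶠ n : ℕ in atTop, 0 ≤ Real.log (n / K n) := hθ_top.eventually_ge_atTop 0
  obtain ⟨hVU, hUV, B₀, hB₀⟩ := hLLR
  obtain ⟨P, hP, hP1⟩ := exists_between hp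
  obtain ⟨R, hR⟩ := hratio.1.bound
  set B := max B₀ (max (Real.log R) (-Real.log (1 - P)))
  have hS : LLRBound V U B := ⟨hVU, hUV, hB₀.mono fun y hy => hy.trans (le_max_left _ _)⟩
  have hE : ∀ᶠ n in atTop, LLRBound (edgeLaw (p n)) (edgeLaw (q n)) B := by
    have hbdd : IsBoundedUnder (· ≤ ·) atTop fun n => (p n : ℝ) :=
      isBoundedUnder_of ⟨1, fun n => (p n).2.2⟩
    filter_upwards [eventually_lt_of_limsup_lt hP hbdd, hR] with n h1 h2
    have h3 : (p n : ℝ) / q n ≤ R := by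
      have := (le_abs_self _).trans h2
      simpa using this
    exact llrBound_edgeLaw (hq n) (hpq n) h1.le hP1 h3
      ((le_max_left _ _).trans (le_max_right _ _)) ((le_max_right _ _).trans (le_max_right _ _))
  obtain ⟨r, hr, hr'⟩ := EReal.lt_iff_exists_real_btwn.1 hweak₂
  have hr2 : (2 : ℝ) < r := EReal.coe_lt_coe_iff.1 (show ((2 : ℝ) : EReal) < r from hr)
  -- The numerator in the second weak-recovery condition is twice `gapQU`, so a ratio above `r > 2`
  -- says that `θ < (2 / r) * gapQU = (1 - δ) * gapQU`.
  set δ := 1 - 2 / r with hδ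
  have hδ0 : 0 < δ := by
    rw [hδ, sub_pos, div_lt_one (by linarith)]; exact hr2
  have hδ1 : δ ≤ 1 := by
    have : 0 < 2 / r := by positivity
    linarith
  have hgap : ∀ᶠ n : ℕ in atTop,
      Real.log (n / K n) ≤ (1 - δ) * gapQU (p n) (q n) V U (K n) (M n) := by
    filter_upwards [eventually_lt_of_lt_liminf hr', hθ_top.eventually_gt_atTop 0] with n h1 h2
    have h3 := EReal.coe_lt_coe_iff.1 h1
    rw [lt_div_iff₀ h2] at h3
    rw [hδ, sub_sub_cancel, div_mul_eq_mul_div, le_div_iff₀ (by linarith), gapQU]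
    linarith
  have hgap_top : Tendsto (fun n => gapQU (p n) (q n) V U (K n) (M n)) atTop atTop := by
    refine tendsto_atTop_mono (fun n => ?_) (hweak₁.atTop_div_const two_pos)
    have : 0 ≤ (M n : ℝ) * klReal V U :=
      mul_nonneg (Nat.cast_nonneg _) LLRBound.klReal_nonneg
    rw [gapQU]
    linarith
  constructor
  · rintro ⟨est, hmeas, hest⟩
    by_contra hcon
    obtain ⟨ρ, hρ, hρ1⟩ := EReal.lt_iff_exists_real_btwn.1 (lt_of_le_of_ne (not_lt.1 hcon) hcrit)
    have hρ1' : ρ < 1 := by exact_mod_cast hρ1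
    have hfail := eventually_recoveryProb_le (γ := 1 - ρ) hS hδ0 hδ1 (by linarith) hE hK_top hKn
      hθ0 hgap hgap_top
    have hhalf : ENNReal.ofReal (1 / 2) < 1 := by
      rw [← ENNReal.ofReal_one]
      exact (ENNReal.ofReal_lt_ofReal_iff one_pos).2 (by norm_num)
    -- A liminf below `1` gives a small exponent only for infinitely many `n`, but one large such
    -- `n` already contradicts recovery with probability above one half.
    obtain ⟨n, h1, h2, h3, h4⟩ := ((frequently_lt_of_liminf_lt (by isBoundedDefault) hρ).and_eventually
      (hfail.and (hlog.and (hest.eventually (lt_mem_nhds hhalf))))).exists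
    have h5 := EReal.coe_lt_coe_iff.1 h1
    rw [div_lt_iff₀ h3] at h5
    exact h4.not_ge (h2 (by linarith) (est n) (hmeas n))
  · intro hlim
    obtain ⟨ρ, hρ1, hρ⟩ := EReal.lt_iff_exists_real_btwn.1 hlim
    have hρ1' : 1 < ρ := by exact_mod_cast hρ1
    have hexp : ∀ᶠ n : ℕ in atTop, (1 + (ρ - 1)) * Real.log n
        ≤ exponentQU (p n) (q n) V U (Real.log (n / K n)) (K n) (M n) := by
      filter_upwards [eventually_lt_of_lt_liminf hρ, hlog] with n h1 h2
      have h3 := EReal.coe_lt_coe_iff.1 h1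
      rw [lt_div_iff₀ h2] at h3
      linarith
    refine ⟨fun n => maxLikelihood n (K n) (M n) (p n) (q n) V U,
      fun n => measurable_maxLikelihood, tendsto_order.2 ⟨fun a ha => ?_, fun a ha =>
        .of_forall fun n => (recoveryProb_le_one _).trans_lt ha⟩⟩
    -- The error bound holds eventually for each fixed `R ≥ 1`, so letting `R` grow brings the
    -- success probability above any `a < 1`.
    have hlim' : Tendsto (fun R : ℝ => 1 - ENNReal.ofReal (6 * Real.exp (-R))) atTop (𝓝 1) := by
      have h1 : Tendsto (fun R : ℝ => 6 * Real.exp (-R)) atTop (𝓝 0) := by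
        simpa using Real.tendsto_exp_neg_atTop_nhds_zero.const_mul 6
      have h2 := ENNReal.tendsto_ofReal h1
      rw [ENNReal.ofReal_zero] at h2
      simpa using ENNReal.Tendsto.sub tendsto_const_nhds h2 (Or.inl ENNReal.one_ne_top)
    obtain ⟨R, hRa, hR1⟩ := ((hlim'.eventually (lt_mem_nhds ha)).and
      (eventually_ge_atTop (1 : ℝ))).exists
    filter_upwards [eventually_measureReal_exists_score_le (γ := ρ - 1) hS hδ0 hδ1 (by linarith)
      hE hK0 hθ0 hgap hgap_top hexp hR1, hKn] with n h1 h2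
    refine hRa.trans_le (one_sub_le_recoveryProb ?_ h1)
    obtain ⟨C, -, hC⟩ := Finset.exists_subset_card_eq
      (show K n ≤ (Finset.univ : Finset (Fin n)).card by simp; omega)
    refine ⟨fun i => decide (i ∈ C), mem_communityLabels.2 ?_⟩
    simpa [community] using hC
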